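/- **Setting.** Let $d>2$, and let $D\subset\mathbb R^d$ be open, bounded and star-shaped with respect to the origin. Let $(\Phi,\mathcal R)$ be a marked point process on $\mathbb R^d\times[0,\infty)$ over a probability space $(\Omega,\mathcal F,\mathbb P)$: a random locally finite set $\Phi$ of points $z_j\in\mathbb R^d$ (the centres) with marks $\rho_j\ge 0$ (the radii). Write $\langle\cdot\rangle$ for the expectation, $N(B)=\#(\Phi\cap B)$, and $\frac1\varepsilon D=\{x:\varepsilon x\in D\}$. Assume: 1. $\Phi$ is stationary: for every $x\in\mathbb R^d$, $\Phi+x$ and $\Phi$ have the same law. 2. There is $\lambda<\infty$ with $\langle N(Q)^2\rangle^{1/2}\le\lambda$ for every unit cube $Q$. 3. (Strong mixing.) For $A$ bounded Borel let $\mathcal F(A)$ be the $\sigma$-algebra generated by the variables $N(B)$, $B\subset A$ Borel. There are $C_1<\infty$ and $\gamma>d$ such that for every such $A$, every $x\in\mathbb R^d$ with $|x|>\operatorname{diam}A$, and all square-integrable $\xi_1,\xi_2$ measurable with respect to $\mathcal F(A)$ and $\mathcal F(A+x)$ respectively, $$|\langle\xi_1\xi_2\rangle-\langle\xi_1\rangle\langle\xi_2\rangle|\le\frac{C_1}{1+(|x|-\operatorname{diam}A)^\gamma}\langle\xi_1^2\rangle^{1/2}\langle\xi_2^2\rangle^{1/2}.$$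 4. Conditionally on $\Phi$, each mark has law $h(d\rho)$ on $[0,\infty)$, and the marks of two distinct centres $z_i\ne z_j$ have joint law $h(d\rho_i)h(d\rho_j)+g(|z_i-z_j|,\rho_i,\rho_j)\,d\rho_i\,d\rho_j$, where $\int\rho^{d-2}\,h(d\rho)<\infty$ and $g$ is a measurable function with $|g(r,\rho_1,\rho_2)|\le\dfrac{c}{(1+r^{\gamma'})(1+\rho_1^{p})(1+\rho_2^{p})}$ for some $p>d-1$, $\gamma'>d$ and $c$. Let $B_r(x)$ be the open ball, and let $$H^\varepsilon(\omega)=\bigcup_{z_j\in\Phi(\omega)\cap\frac1\varepsilon D}B_{\varepsilon^{d/(d-2)}\rho_j}(\varepsilon z_j).$$ For $\delta>0$ let $\Phi_\delta$ be the set of those points of $\Phi$ whose distance to every other point of $\Phi$ is at least $\delta$. For open sets $A\subset B$ let $\operatorname{Cap}(A,B)=\inf\{\int|\nabla v|^2: v\in C_c^\infty(B),\ v\ge\mathbf 1_A\}$. Distances to or from the empty set are $+\infty$. **Lemma 4.2.** There is $\varepsilon_0=\varepsilon_0(d)>0$, depending only on $d$, and there are random variables $r_\varepsilon>0$ ($\varepsilon>0$),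 such that for $\mathbb P$-almost every $\omega$ we have $\lim_{\varepsilon\downarrow0}r_\varepsilon(\omega)=0$, and for every $0<\varepsilon\le\varepsilon_0$ there are sets $H_g^\varepsilon,H_b^\varepsilon,D_b^\varepsilon\subset\mathbb R^d$, with $H_b^\varepsilon$ and $D_b^\varepsilon$ open, and a set $n^\varepsilon\subset\Phi(\omega)\cap\frac1\varepsilon D$ (all depending on $\omega$) with $$H^\varepsilon(\omega)=H_g^\varepsilon\cup H_b^\varepsilon,\qquad H_b^\varepsilon\subset D_b^\varepsilon,\qquad \operatorname{dist}(H_g^\varepsilon,D_b^\varepsilon)\ge\frac{\varepsilon r_\varepsilon(\omega)}2,\qquad \lim_{\varepsilon\downarrow0}\operatorname{Cap}(H_b^\varepsilon,D_b^\varepsilon)=0.$$ Moreover $H_g^\varepsilon=\bigcup_{z_j\in n^\varepsilon}B_{\varepsilon^{d/(d-2)}\rho_j}(\varepsilon z_j)$ is a union of pairwise disjoint balls, and $$\min_{z_i\ne z_j\in n^\varepsilon}\varepsilon|z_i-z_j|\ge2r_\varepsilon(\omega)\varepsilon,\qquad \varepsilon^{\frac d{d-2}}\rho_j\le\frac{\varepsilon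 r_\varepsilon(\omega)}2\ \ (z_j\in n^\varepsilon),\qquad \lim_{\varepsilon\downarrow0}\varepsilon^d\,\#n^\varepsilon=\langle N(Q)\rangle\,|D|,$$ where $Q$ is any unit cube. Furthermore, for every $\delta>0$, $$\lim_{\varepsilon\downarrow0}\varepsilon^d\,\#\Bigl\{z_i\in\Phi_{2\delta}(\omega)\cap\tfrac1\varepsilon D:\ \operatorname{dist}(\varepsilon z_i,D_b^\varepsilon)\le\delta\varepsilon\Bigr\}=0.$$ -/

import Mathlib

open MeasureTheory Filter Topology Set
open scoped ENNReal NNReal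

namespace PerforatedDomain

/-- Euclidean space `ℝᵈ`. -/
abbrev Space (d : ℕ) : Type := EuclideanSpace ℝ (Fin d)

/-- The half-open unit cube with lower corner `q`. -/
def unitCube {d : ℕ} (q : Space d) : Set (Space d) :=
  {y | ∀ i, q i ≤ y i ∧ y i < q i + 1}

/-- The rescaled set `(1/ε) D = {x : ε x ∈ D}`. -/
def dilate {d : ℕ} (ε : ℝ) (D : Set (Space d)) : Set (Space d) :=
  {x | ε • x ∈ D}

/-- The thinning of a configuration `S`: the points of `S` whose distance from every other point
of `S` is at least `δ`. -/
def thin {d : ℕ} (δ : ℝ) (S : Set (Space d)) : Set (Space d) :=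
  {x | x ∈ S ∧ ∀ y ∈ S, y ≠ x → δ ≤ dist x y}

/-- The σ-algebra on point configurations generated by the counting maps `S ↦ #(S ∩ B)`,
where `B` ranges over the Borel subsets of `K`. -/
@[reducible] noncomputable def countingSigma {d : ℕ} (K : Set (Space d)) : MeasurableSpace (Set (Space d)) :=
  ⨆ B : {B : Set (Space d) // MeasurableSet B ∧ B ⊆ K},
    MeasurableSpace.comap (fun S => (S ∩ B.1).encard) (⊤ : MeasurableSpace ℕ∞)

section Points

variable {d : ℕ} {Ω : Type*} [MeasurableSpace Ω]

/-- A (simple) marked point process on `ℝᵈ × [0, ∞)`: `Φ ω` is the set of centres and `ρ ω z` is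
the mark (radius) of the centre `z ∈ Φ ω`. Every realisation is
locally finite, and the counting variables of the marked points are random variables.
The values of `ρ ω` off `Φ ω` are irrelevant. -/
structure IsMarkedPointProcess (Φ : Ω → Set (Space d)) (ρ : Ω → Space d → ℝ) : Prop where
  locallyFinite : ∀ ω, ∀ A : Set (Space d), Bornology.IsBounded A → (Φ ω ∩ A).Finite
  mark_nonneg : ∀ ω, ∀ z ∈ Φ ω, 0 ≤ ρ ω z
  measurable_count : ∀ A : Set (Space d), MeasurableSet A → ∀ B : Set ℝ, MeasurableSet B →
    Measurable fun ω => {z | z ∈ Φ ω ∩ A ∧ ρ ω z ∈ B}.encard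

/-- `Φ + x` has the same law as `Φ`, for every `x ∈ ℝᵈ`. -/
def IsStationary (P : Measure Ω) (Φ : Ω → Set (Space d)) : Prop :=
  ∀ x : Space d, ∀ 𝒜 : Set (Set (Space d)), MeasurableSet[countingSigma univ] 𝒜 →
    P {ω | (fun z => z + x) '' Φ ω ∈ 𝒜} = P {ω | Φ ω ∈ 𝒜}

/-- `⟨#(Φ ∩ Q)²⟩^{1/2} ≤ lam` for every unit cube `Q`, with a finite `lam`. -/
def HasFiniteSecondMoment (P : Measure Ω) (Φ : Ω → Set (Space d)) : Prop :=
  ∃ lam : ℝ≥0, ∀ q : Space d,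
    (∫⁻ ω, ((Φ ω ∩ unitCube q).encard : ℝ≥0∞) ^ 2 ∂P) ^ (1 / 2 : ℝ) ≤ lam

/-- The strong mixing condition for the centres. Here `(countingSigma A).comap Φ` is the σ-algebra
on `Ω` generated by the variables `#(Φ ∩ B)`, `B ⊆ A` Borel. -/
def IsStronglyMixing (P : Measure Ω) (Φ : Ω → Set (Space d)) : Prop :=
  ∃ C γ : ℝ, (d : ℝ) < γ ∧
    ∀ A : Set (Space d), Bornology.IsBounded A → MeasurableSet A →
    ∀ x : Space d, Metric.diam A < ‖x‖ →
    ∀ ξ₁ ξ₂ : Ω → ℝ,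
      Measurable[(countingSigma A).comap Φ] ξ₁ →
      Measurable[(countingSigma ((fun z => z + x) '' A)).comap Φ] ξ₂ →
      MemLp ξ₁ 2 P → MemLp ξ₂ 2 P →
      |(∫ ω, ξ₁ ω * ξ₂ ω ∂P) - (∫ ω, ξ₁ ω ∂P) * (∫ ω, ξ₂ ω ∂P)|
        ≤ C / (1 + (‖x‖ - Metric.diam A) ^ γ)
          * (√(∫ ω, ξ₁ ω ^ 2 ∂P) * √(∫ ω, ξ₂ ω ^ 2 ∂P))

/-- The mass that the two-mark correlation function `h(s) h(t) + g(r, s, t)` gives to the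
rectangle `B × B'` of marks (the marks are nonnegative, so `g` only matters for `s, t ≥ 0`). The
law `h(s) ds` of one mark is written as the probability measure `h`. -/
noncomputable def pairMass (h : Measure ℝ) (g : ℝ → ℝ → ℝ → ℝ) (r : ℝ) (B B' : Set ℝ) : ℝ :=
  h.real B * h.real B' + ∫ p in (B ∩ Ici 0) ×ˢ (B' ∩ Ici 0), g r p.1 p.2

/-- Conditionally on the centres `Φ`, each mark has law `h`, and the marks of two distinct
centres `z, w` have joint law `h(s) h(t) + g(|z - w|, s, t)`. Conditioning on `Φ` is expressed by
testing with all events `F` of the σ-algebra generated by `Φ` and all bounded Borel sets `A, A'` of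
positions. (`pairMass` is then a conditional probability, so `ENNReal.ofReal` truncates nothing.) -/
structure HasMarkCorrelations (P : Measure Ω) (Φ : Ω → Set (Space d)) (ρ : Ω → Space d → ℝ)
    (h : Measure ℝ) (g : ℝ → ℝ → ℝ → ℝ) : Prop where
  one_point : ∀ F : Set Ω, MeasurableSet[(countingSigma univ).comap Φ] F →
    ∀ A : Set (Space d), MeasurableSet A → Bornology.IsBounded A →
    ∀ B : Set ℝ, MeasurableSet B →
      ∫⁻ ω in F, ({z | z ∈ Φ ω ∩ A ∧ ρ ω z ∈ B}.encard : ℝ≥0∞) ∂P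
        = h B * ∫⁻ ω in F, ((Φ ω ∩ A).encard : ℝ≥0∞) ∂P
  two_point : ∀ F : Set Ω, MeasurableSet[(countingSigma univ).comap Φ] F →
    ∀ A A' : Set (Space d), MeasurableSet A → Bornology.IsBounded A →
      MeasurableSet A' → Bornology.IsBounded A' →
    ∀ B B' : Set ℝ, MeasurableSet B → MeasurableSet B' →
      ∫⁻ ω in F, ({p : Space d × Space d | p.1 ∈ Φ ω ∩ A ∧ p.2 ∈ Φ ω ∩ A' ∧ p.1 ≠ p.2 ∧
          ρ ω p.1 ∈ B ∧ ρ ω p.2 ∈ B'}.encard : ℝ≥0∞) ∂P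
        = ∫⁻ ω in F, ∑' p : {p : Space d × Space d |
            p.1 ∈ Φ ω ∩ A ∧ p.2 ∈ Φ ω ∩ A' ∧ p.1 ≠ p.2},
            ENNReal.ofReal (pairMass h g (dist p.1.1 p.1.2) B B') ∂P

/-- The marks have one- and two-point correlation functions `h(s)` and
`h(s) h(t) + g(|z - w|, s, t)` with `∫ s^{d-2} h(s) ds < ∞` and
`|g(r, s, t)| ≤ c / ((1 + r^γ) (1 + s^p) (1 + t^p))`, where `p > d - 1` and `γ > d`. -/
def HasShortRangeMarks (P : Measure Ω) (Φ : Ω → Set (Space d)) (ρ : Ω → Space d → ℝ) : Prop :=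
  ∃ (h : Measure ℝ) (g : ℝ → ℝ → ℝ → ℝ),
    IsProbabilityMeasure h ∧ h (Iio 0) = 0 ∧
    (∫⁻ s, ENNReal.ofReal (s ^ (d - 2)) ∂h) < ∞ ∧
    Measurable (fun q : ℝ × ℝ × ℝ => g q.1 q.2.1 q.2.2) ∧
    (∃ c p γ : ℝ, (d : ℝ) - 1 < p ∧ (d : ℝ) < γ ∧
      ∀ r s t : ℝ, 0 ≤ r → 0 ≤ s → 0 ≤ t →
        |g r s t| ≤ c / ((1 + r ^ γ) * (1 + s ^ p) * (1 + t ^ p))) ∧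
    HasMarkCorrelations P Φ ρ h g

/-- `⟨#(Φ ∩ Q)⟩`. -/
noncomputable def meanCount (P : Measure Ω) (Φ : Ω → Set (Space d)) (Q : Set (Space d)) : ℝ :=
  ∫ ω, ((Φ ω ∩ Q).ncard : ℝ) ∂P

end Points

/-- The scaled radius `ε^{d/(d-2)} s`. -/
noncomputable def scaledRadius (d : ℕ) (ε s : ℝ) : ℝ :=
  ε ^ ((d : ℝ) / ((d : ℝ) - 2)) * s

/-- The union of the (open) scaled balls with centres `ε z`, `z ∈ S`, and radii
`ε^{d/(d-2)} ρ z`. -/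
noncomputable def ballUnion {d : ℕ} (ε : ℝ) (S : Set (Space d)) (ρ : Space d → ℝ) :
    Set (Space d) :=
  ⋃ z ∈ S, Metric.ball (ε • z) (scaledRadius d ε (ρ z))

/-- The harmonic capacity `inf {∫ |∇v|² : v ∈ C_c^∞(B), v ≥ 1_A}` (it is `∞` if there is no such
`v`). -/
noncomputable def capacity {d : ℕ} (A B : Set (Space d)) : ℝ≥0∞ :=
  ⨅ v ∈ {v : Space d → ℝ | ContDiff ℝ (⊤ : ℕ∞) v ∧ HasCompactSupport v ∧ tsupport v ⊆ B ∧
      ∀ x, A.indicator (fun _ => (1 : ℝ)) x ≤ v x},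
    ∫⁻ x, ENNReal.ofReal (‖fderiv ℝ v x‖ ^ 2)

end PerforatedDomain

/-! The scale is deterministic: `r ε = ε ^ (1/(d-2))`. It tends to zero, yet a scaled radius above
`ε r / 2` forces a mark above `ε ^ (-1/(d-2)) / 2`, which tends to infinity. A centre is bad if its
ball is large in this sense, if another centre lies within `2 r`, or if it lies too close to the
double of a large ball. The safety layer consists of the doubled balls around bad centres, and the
separation is then the triangle inequality.

For a fixed realisation, everything else follows from three properties: the centres in the dilated
domain have the right density (`ae_tendsto_ncard_dilate`); centres with a neighbour within `2 δ`
have small density when `δ` is small (`FewCrowdedCentres`); and large marks contribute little to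
`ε^d ∑ ρ^(d-2)` (`TightMarks`). Tightness makes large centres rare. A shadowed centre is either
crowded at a fixed scale `δ`, or belongs to a `2 δ`-separated family packed into slightly enlarged
large balls, whose number is controlled by volume. So bad centres have density zero. Since
`(ε^(d/(d-2)) ρ)^(d-2) = ε^d ρ^(d-2)`, the capacity is bounded by a constant times the same mark sum
over bad centres, which tends to zero by tightness. The same packing bounds the separated points
near the safety layer.

The first two properties come from a strong law of large numbers for local functions of the centres:
mixing makes covariances summable over the lattice, so variances grow like the volume, and
normalised variances are summable because `d > 1`. Stationarity identifies the mean count with a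
multiple of Lebesgue measure, and star-shapedness passes from `ε = 1/n` to all `ε`. For crowding the
law is applied to cells containing at least two points.

Tightness assumes only an integrable `(d-2)`-th power, so the marks are truncated as in Etemadi's
proof of the strong law. In cubes of side proportional to `2^n`, marks with `ρ^(d-2) ≥ 2^(dn)`
almost surely stop occurring (a first-moment bound), and the truncated sum is compared in mean
square with its conditional mean given the centres. The correlation `g` contributes only a term of
volume order, because `γ > d` makes it summable in space and `p > d - 1` makes `s^(d-2)/(1+s^p)`
integrable. -/

namespace PerforatedDomain

/-! ### Capacity of finite unions of balls. -/

/-- A cut-off function for the ball `B_R(c)` inside `B_{2R}(c)` with energy of order `R^{d-2}`. -/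
theorem exists_cutoff (d : ℕ) (hd : 2 < d) : ∃ C : ℝ, 0 ≤ C ∧ ∀ (c : Space d) (R : ℝ), 0 < R →
    ∃ v : Space d → ℝ, ContDiff ℝ (⊤ : ℕ∞) v ∧ HasCompactSupport v ∧
      tsupport v ⊆ Metric.ball c (2 * R) ∧ (∀ x ∈ Metric.ball c R, v x = 1) ∧
      ∫⁻ x, ENNReal.ofReal (‖fderiv ℝ v x‖ ^ 2) ≤ ENNReal.ofReal (C * R ^ (d - 2)) := by
  have : Nonempty (Fin d) := ⟨⟨0, by omega⟩⟩
  let φ : ContDiffBump (0 : Space d) := ⟨1, 3 / 2, by norm_num, by norm_num⟩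
  have hφ : ContDiff ℝ (⊤ : ℕ∞) φ := φ.contDiff
  obtain ⟨K, hK⟩ := (φ.hasCompactSupport.fderiv (𝕜 := ℝ)).exists_bound_of_continuous
    (hφ.continuous_fderiv (by simp))
  have hK0 : 0 ≤ K := (norm_nonneg _).trans (hK 0)
  set V : ℝ := volume.real (Metric.ball (0 : Space d) 1) with hV
  -- The gradient of the rescaled bump is at most `K / R` on a ball of volume `(2R)^d V`, and
  -- vanishes elsewhere.
  refine ⟨K ^ 2 * (2 ^ d * V), by positivity, fun c R hR => ?_⟩
  have hsupp : tsupport (fun x : Space d => φ (R⁻¹ • (x - c))) ⊆ Metric.closedBall c (3 / 2 * R) := by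
    refine closure_minimal (fun x hx => ?_) Metric.isClosed_closedBall
    have h1 : R⁻¹ • (x - c) ∈ Function.support φ := hx
    rw [φ.support_eq, mem_ball_zero_iff, norm_smul, Real.norm_eq_abs, abs_of_pos (by positivity)] at h1
    rw [Metric.mem_closedBall, dist_eq_norm]
    have h2 : R⁻¹ * ‖x - c‖ < 3 / 2 := h1
    rw [inv_mul_lt_iff₀ hR] at h2
    linarith
  refine ⟨fun x => φ (R⁻¹ • (x - c)), ?_, ?_, ?_, ?_, ?_⟩
  · exact hφ.comp (by fun_prop)
  · exact HasCompactSupport.of_support_subset_isCompact (isCompact_closedBall c (3 / 2 * R))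
      ((subset_tsupport _).trans hsupp)
  · exact hsupp.trans (Metric.closedBall_subset_ball (by linarith))
  · intro x hx
    apply φ.one_of_mem_closedBall
    rw [mem_closedBall_zero_iff, norm_smul, Real.norm_eq_abs, abs_of_pos (by positivity)]
    rw [Metric.mem_ball, dist_eq_norm] at hx
    change R⁻¹ * ‖x - c‖ ≤ 1
    rw [inv_mul_le_iff₀ hR]
    linarith
  · have hb : ∀ x, ENNReal.ofReal (‖fderiv ℝ (fun x : Space d => φ (R⁻¹ • (x - c))) x‖ ^ 2) ≤
        (Metric.ball c (2 * R)).indicator (fun _ => ENNReal.ofReal ((K * R⁻¹) ^ 2)) x := by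
      intro x
      by_cases hx : x ∈ Metric.ball c (2 * R)
      · rw [indicator_of_mem hx]
        apply ENNReal.ofReal_le_ofReal
        gcongr
        have h1 : HasFDerivAt (fun x : Space d => φ (R⁻¹ • (x - c)))
            ((fderiv ℝ φ (R⁻¹ • (x - c))).comp (R⁻¹ • ContinuousLinearMap.id ℝ (Space d))) x := by
          have h2 : HasFDerivAt (fun x : Space d => R⁻¹ • (x - c))
              (R⁻¹ • ContinuousLinearMap.id ℝ (Space d)) x :=
            ((hasFDerivAt_id x).sub_const c).const_smul R⁻¹
          exact ((hφ.differentiable (by simp) _).hasFDerivAt).comp x h2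
        rw [h1.fderiv]
        refine (ContinuousLinearMap.opNorm_comp_le _ _).trans ?_
        gcongr
        · exact hK _
        · rw [norm_smul, Real.norm_eq_abs, abs_of_pos (by positivity)]
          exact mul_le_of_le_one_right (by positivity) ContinuousLinearMap.norm_id_le
      · rw [indicator_of_notMem hx]
        have h3 : x ∉ tsupport (fun x : Space d => φ (R⁻¹ • (x - c))) := fun h =>
          hx (Metric.closedBall_subset_ball (by linarith) (hsupp h))
        rw [fderiv_of_notMem_tsupport (𝕜 := ℝ) h3]
        simp
    refine (lintegral_mono hb).trans ?_
    rw [lintegral_indicator Metric.isOpen_ball.measurableSet, setLIntegral_const,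
      Measure.addHaar_ball _ _ (by positivity : 0 ≤ 2 * R), finrank_euclideanSpace_fin,
      ← ENNReal.ofReal_toReal (measure_ball_lt_top.ne : volume (Metric.ball (0 : Space d) 1) ≠ ⊤),
      ← ENNReal.ofReal_mul (by positivity), ← ENNReal.ofReal_mul (by positivity)]
    apply ENNReal.ofReal_le_ofReal
    change (K * R⁻¹) ^ 2 * ((2 * R) ^ d * V) ≤ _
    obtain ⟨e, rfl⟩ : ∃ e, d = e + 2 := ⟨d - 2, by omega⟩
    apply le_of_eq
    rw [Nat.add_sub_cancel]
    field_simp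
    ring

/-- The gradient is `∑ v_i ∇v_i / √(1 + ∑ v_i²)`, so Cauchy–Schwarz gives the bound. It combines
cut-offs smoothly, with no loss depending on how often their supports overlap; a maximum would not
be smooth. -/
theorem norm_fderiv_sqrt_one_add_sum_sq_le {E ι : Type*} [NormedAddCommGroup E] [NormedSpace ℝ E]
    (T : Finset ι) (v : ι → E → ℝ) (x : E) (hv : ∀ i ∈ T, DifferentiableAt ℝ (v i) x) :
    ‖fderiv ℝ (fun y => √(1 + ∑ i ∈ T, v i y ^ 2)) x‖ ^ 2 ≤ ∑ i ∈ T, ‖fderiv ℝ (v i) x‖ ^ 2 := by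
  have hpos : 0 < 1 + ∑ i ∈ T, v i x ^ 2 := by positivity
  have h1 : HasFDerivAt (fun y => 1 + ∑ i ∈ T, v i y ^ 2)
      (∑ i ∈ T, (2 * v i x) • fderiv ℝ (v i) x) x := by
    refine HasFDerivAt.const_add _ (HasFDerivAt.fun_sum fun i hi => ?_)
    simpa using (hv i hi).hasFDerivAt.pow 2
  have h2 := h1.sqrt hpos.ne'
  rw [h2.fderiv, Finset.smul_sum]
  set s := √(1 + ∑ i ∈ T, v i x ^ 2) with hs
  have hs0 : 0 < s := Real.sqrt_pos.2 hpos
  have h3 : ‖∑ i ∈ T, (1 / (2 * s)) • (2 * v i x) • fderiv ℝ (v i) x‖ ≤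
      s⁻¹ * ∑ i ∈ T, |v i x| * ‖fderiv ℝ (v i) x‖ := by
    refine (norm_sum_le _ _).trans ?_
    rw [Finset.mul_sum]
    refine Finset.sum_le_sum fun i _ => le_of_eq ?_
    rw [smul_smul, norm_smul, Real.norm_eq_abs, abs_mul, abs_mul, abs_of_pos (by positivity : 0 < 1 / (2 * s)),
      abs_of_pos (by norm_num : (0 : ℝ) < 2)]
    field_simp
  calc _ ≤ (s⁻¹ * ∑ i ∈ T, |v i x| * ‖fderiv ℝ (v i) x‖) ^ 2 := by gcongr
    _ = (s ^ 2)⁻¹ * (∑ i ∈ T, |v i x| * ‖fderiv ℝ (v i) x‖) ^ 2 := by rw [mul_pow, inv_pow]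
    _ ≤ (s ^ 2)⁻¹ * ((∑ i ∈ T, |v i x| ^ 2) * ∑ i ∈ T, ‖fderiv ℝ (v i) x‖ ^ 2) := by
        gcongr
        exact Finset.sum_mul_sq_le_sq_mul_sq _ _ _
    _ ≤ (s ^ 2)⁻¹ * (s ^ 2 * ∑ i ∈ T, ‖fderiv ℝ (v i) x‖ ^ 2) := by
        gcongr
        rw [hs, Real.sq_sqrt hpos.le]
        simp only [sq_abs]
        linarith
    _ = _ := by field_simp

/-- The capacity of a finite union of balls in the union of the concentric balls of twice the
radius is at most of order `∑ R_i^{d-2}`. -/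
theorem exists_capacity_iUnion_ball_le (d : ℕ) (hd : 2 < d) : ∃ C : ℝ, 0 ≤ C ∧
    ∀ {ι : Type} (T : Finset ι) (c : ι → Space d) (R : ι → ℝ), (∀ i ∈ T, 0 ≤ R i) →
      capacity (⋃ i ∈ T, Metric.ball (c i) (R i)) (⋃ i ∈ T, Metric.ball (c i) (2 * R i)) ≤
        ENNReal.ofReal (C * ∑ i ∈ T, R i ^ (d - 2)) := by
  obtain ⟨C, hC, hcut⟩ := exists_cutoff d hd
  refine ⟨(√2 + 1) ^ 2 * C, by positivity, fun {ι} T c R hR => ?_⟩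
  have hv : ∀ i, ∃ v : Space d → ℝ, i ∈ T → (ContDiff ℝ (⊤ : ℕ∞) v ∧ HasCompactSupport v ∧
      tsupport v ⊆ Metric.ball (c i) (2 * R i) ∧ (∀ x ∈ Metric.ball (c i) (R i), v x = 1) ∧
      ∫⁻ x, ENNReal.ofReal (‖fderiv ℝ v x‖ ^ 2) ≤ ENNReal.ofReal (C * R i ^ (d - 2))) := by
    intro i
    by_cases hi : 0 < R i
    · obtain ⟨v, hv⟩ := hcut (c i) (R i) hi
      exact ⟨v, fun _ => hv⟩
    -- For a nonpositive radius the ball is empty and the zero function serves.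
    · refine ⟨0, fun hiT => ⟨contDiff_const, HasCompactSupport.zero, ?_, ?_, ?_⟩⟩
      · rw [tsupport_eq_empty_iff.2 rfl]
        exact empty_subset _
      · intro x hx
        rw [Metric.ball_eq_empty.2 (not_lt.1 hi)] at hx
        exact hx.elim
      · simp
  choose v hv using hv
  have hsm : ContDiff ℝ (⊤ : ℕ∞) fun y => √(1 + ∑ i ∈ T, v i y ^ 2) := by
    refine ContDiff.sqrt (contDiff_const.add (ContDiff.sum fun i hi => ?_)) fun y => ?_
    · exact (hv i hi).1.pow 2
    · positivity
  -- Vanishes where all `v i` do, and is at least `1` where some `v i = 1`, because `(√2 + 1)(√2 -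
  -- 1) = 1`.
  set w : Space d → ℝ := fun y => (√2 + 1) * (√(1 + ∑ i ∈ T, v i y ^ 2) - 1) with hw
  have hsub : tsupport w ⊆ ⋃ i ∈ T, tsupport (v i) := by
    refine closure_minimal (fun y hy => ?_)
      (T.finite_toSet.isClosed_biUnion fun i _ => isClosed_tsupport _)
    by_contra hcon
    simp only [mem_iUnion, not_exists] at hcon
    apply hy
    have : ∑ i ∈ T, v i y ^ 2 = 0 := Finset.sum_eq_zero fun i hi => by
      rw [image_eq_zero_of_notMem_tsupport (hcon i hi)]; simp
    simp [hw, this]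
  refine iInf₂_le_of_le w (show w ∈ {v : Space d → ℝ | _ ∧ _ ∧ _ ∧ _} from ⟨?_, ?_, ?_, ?_⟩) ?_
  · exact contDiff_const.mul (hsm.sub contDiff_const)
  · refine HasCompactSupport.of_support_subset_isCompact
      (T.finite_toSet.isCompact_biUnion fun i hi => (hv i hi).2.1) ((subset_tsupport _).trans hsub)
  · exact hsub.trans (iUnion₂_mono fun i hi => (hv i hi).2.2.1)
  · intro x
    have h0 : 0 ≤ ∑ i ∈ T, v i x ^ 2 := Finset.sum_nonneg fun i _ => sq_nonneg _
    by_cases hx : x ∈ ⋃ i ∈ T, Metric.ball (c i) (R i)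
    · rw [indicator_of_mem hx]
      simp only [mem_iUnion] at hx
      obtain ⟨i, hi, hxi⟩ := hx
      have h1 : 1 ≤ ∑ i ∈ T, v i x ^ 2 := by
        have := Finset.single_le_sum (f := fun i => v i x ^ 2) (fun i _ => sq_nonneg _) hi
        simpa [(hv i hi).2.2.2.1 x hxi] using this
      have h2 : √2 ≤ √(1 + ∑ i ∈ T, v i x ^ 2) := Real.sqrt_le_sqrt (by linarith)
      have h3 : √2 * √2 = 2 := Real.mul_self_sqrt (by norm_num)
      calc (1 : ℝ) = (√2 + 1) * (√2 - 1) := by ring_nf; rw [sq, h3]; norm_num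
        _ ≤ w x := by simp only [hw]; gcongr
    · rw [indicator_of_notMem hx]
      have : 1 ≤ √(1 + ∑ i ∈ T, v i x ^ 2) := Real.one_le_sqrt.2 (by linarith)
      exact mul_nonneg (by positivity) (by linarith)
  · have hd1 : Differentiable ℝ fun y => √(1 + ∑ i ∈ T, v i y ^ 2) := hsm.differentiable (by simp)
    have hg : ∀ x, ENNReal.ofReal (‖fderiv ℝ w x‖ ^ 2) ≤
        ENNReal.ofReal ((√2 + 1) ^ 2) * ∑ i ∈ T, ENNReal.ofReal (‖fderiv ℝ (v i) x‖ ^ 2) := by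
      intro x
      rw [← ENNReal.ofReal_sum_of_nonneg fun i _ => sq_nonneg _, ← ENNReal.ofReal_mul (by positivity)]
      apply ENNReal.ofReal_le_ofReal
      have : fderiv ℝ w x = (√2 + 1) • fderiv ℝ (fun y => √(1 + ∑ i ∈ T, v i y ^ 2)) x := by
        rw [hw, fderiv_const_mul ((hd1 x).sub_const 1), fderiv_sub_const]
      rw [this, norm_smul, mul_pow, Real.norm_eq_abs, sq_abs]
      gcongr
      exact norm_fderiv_sqrt_one_add_sum_sq_le T v x fun i hi => (hv i hi).1.differentiable (by simp) x
    refine (lintegral_mono hg).trans ?_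
    rw [lintegral_const_mul' _ _ ENNReal.ofReal_ne_top, lintegral_finsetSum' _ fun i hi => ?_,
      mul_assoc, ENNReal.ofReal_mul (by positivity), Finset.mul_sum T (fun i => R i ^ (d - 2)) C,
      ENNReal.ofReal_sum_of_nonneg fun i hi => ?_]
    · gcongr with i hi
      exact (hv i hi).2.2.2.2
    · exact mul_nonneg hC (pow_nonneg (hR i hi) _)
    · have := (hv i hi).1.continuous_fderiv (by simp)
      exact (ENNReal.continuous_ofReal.comp (this.norm.pow 2)).aemeasurable

/-! ### Packing separated points into balls. -/

/-- Volume packing: points at mutual distance at least `2 s` that lie in a finite union of balls. -/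
theorem card_mul_pow_le_of_covered {d : ℕ} [Nonempty (Fin d)] {κ : Type*} (T : Finset (Space d)) (W : Finset κ)
    (c : κ → Space d) (q : κ → ℝ) {s : ℝ} (hs : 0 < s) (hq : ∀ w ∈ W, 0 ≤ q w)
    (hsep : ∀ x ∈ T, ∀ y ∈ T, x ≠ y → 2 * s ≤ dist x y)
    (hcov : ∀ x ∈ T, ∃ w ∈ W, dist x (c w) ≤ q w) :
    (T.card : ℝ) * s ^ d ≤ ∑ w ∈ W, (q w + s) ^ d := by
  set V := volume (Metric.ball (0 : Space d) 1)
  have hV0 : V ≠ 0 := (Metric.measure_ball_pos _ _ one_pos).ne'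
  have hVt : V ≠ ⊤ := measure_ball_lt_top.ne
  have h1 : volume (⋃ x ∈ T, Metric.ball x s) = T.card * (ENNReal.ofReal (s ^ d) * V) := by
    rw [measure_biUnion_finset _ fun _ _ => Metric.isOpen_ball.measurableSet]
    · rw [← nsmul_eq_mul, ← Finset.sum_const]
      refine Finset.sum_congr rfl fun x _ => ?_
      rw [Measure.addHaar_ball _ _ hs.le, finrank_euclideanSpace_fin]
    · intro x hx y hy hxy
      exact Metric.ball_disjoint_ball (by have := hsep x hx y hy hxy; linarith)
  have h2 : volume (⋃ x ∈ T, Metric.ball x s) ≤ ∑ w ∈ W, ENNReal.ofReal ((q w + s) ^ d) * V := by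
    have h3 : (⋃ x ∈ T, Metric.ball x s) ⊆ ⋃ w ∈ W, Metric.ball (c w) (q w + s) := by
      intro y hy
      simp only [mem_iUnion, Metric.mem_ball] at hy ⊢
      obtain ⟨x, hx, hyx⟩ := hy
      obtain ⟨w, hw, hxw⟩ := hcov x hx
      exact ⟨w, hw, by linarith [dist_triangle y x (c w)]⟩
    refine (measure_mono h3).trans ((measure_biUnion_finset_le _ _).trans (le_of_eq ?_))
    refine Finset.sum_congr rfl fun w hw => ?_
    rw [Measure.addHaar_ball _ _ (by have := hq w hw; linarith), finrank_euclideanSpace_fin]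
  rw [h1, ← Finset.sum_mul, ← mul_assoc, ENNReal.mul_le_mul_iff_left hV0 hVt,
    ← ENNReal.ofReal_sum_of_nonneg fun w hw => by have := hq w hw; positivity,
    ← ENNReal.ofReal_natCast, ← ENNReal.ofReal_mul (by positivity)] at h2
  exact (ENNReal.ofReal_le_ofReal_iff
    (Finset.sum_nonneg fun w hw => by have := hq w hw; positivity)).1 h2

/-- Packing at radius `δ` bounds the count by `∑ (2 R/ε + 3 δ)^d / δ^d`. Splitting the power
separates a term in `R^d` from a multiple of the number of balls. -/
theorem pow_mul_card_le_of_near {d : ℕ} (hd : 2 < d) {ε δ : ℝ} (hε : 0 < ε) (hδ : 0 < δ)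
    (T W : Finset (Space d)) (R : Space d → ℝ) (hR : ∀ w ∈ W, 0 ≤ R w)
    (hR1 : ∑ w ∈ W, R w ^ (d - 2) ≤ 1)
    (hsep : ∀ x ∈ T, ∀ y ∈ T, x ≠ y → 2 * δ ≤ dist x y)
    (hcov : ∀ x ∈ T, ∃ w ∈ W, dist (ε • x) (ε • w) ≤ 2 * R w + 2 * δ * ε) :
    ε ^ d * (T.card : ℝ) ≤
      4 ^ d / δ ^ d * ∑ w ∈ W, R w ^ (d - 2) + 6 ^ d * (ε ^ d * (W.card : ℝ)) := by
  have : Nonempty (Fin d) := ⟨⟨0, by omega⟩⟩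
  have h1 := card_mul_pow_le_of_covered T W id (fun w => 2 * R w / ε + 2 * δ) hδ
    (fun w hw => by have := hR w hw; positivity) hsep (fun x hx => by
      obtain ⟨w, hw, h⟩ := hcov x hx
      refine ⟨w, hw, ?_⟩
      rw [dist_smul₀, Real.norm_eq_abs, abs_of_pos hε] at h
      have : dist x w ≤ (2 * R w + 2 * δ * ε) / ε := by
        rw [le_div_iff₀ hε]; linarith
      refine this.trans (le_of_eq ?_)
      field_simp)
  have h2 : ∀ w ∈ W, (2 * R w / ε + 2 * δ + δ) ^ d ≤
      4 ^ d / ε ^ d * R w ^ (d - 2) + 6 ^ d * δ ^ d := by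
    intro w hw
    have hRw := hR w hw
    -- The sum being at most `1` forces each radius below `1`, so `R^d` may be replaced by the
    -- capacity scale `R^(d-2)`.
    have hle1 : R w ≤ 1 := by
      by_contra! hcon
      have h3 : R w ^ (d - 2) ≤ 1 :=
        (Finset.single_le_sum (f := fun w => R w ^ (d - 2))
          (fun i hi => pow_nonneg (hR i hi) _) hw).trans hR1
      exact absurd h3 (not_le.2 (one_lt_pow₀ hcon (by omega)))
    have h4 : R w ^ d ≤ R w ^ (d - 2) := pow_le_pow_of_le_one hRw hle1 (by omega)
    have ha : 0 ≤ 2 * R w / ε := by positivity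
    have h5 : (2 * R w / ε + 3 * δ) ^ d ≤ 2 ^ d * ((2 * R w / ε) ^ d + (3 * δ) ^ d) := by
      have h6 : 2 * R w / ε + 3 * δ ≤ 2 * max (2 * R w / ε) (3 * δ) := by
        linarith [le_max_left (2 * R w / ε) (3 * δ), le_max_right (2 * R w / ε) (3 * δ)]
      refine (pow_le_pow_left₀ (by positivity) h6 d).trans ?_
      rw [mul_pow]
      gcongr
      rcases le_total (2 * R w / ε) (3 * δ) with h | h
      · rw [max_eq_right h]
        exact le_add_of_nonneg_left (by positivity)
      · rw [max_eq_left h]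
        exact le_add_of_nonneg_right (by positivity)
    calc (2 * R w / ε + 2 * δ + δ) ^ d = (2 * R w / ε + 3 * δ) ^ d := by ring_nf
      _ ≤ _ := h5
      _ = 4 ^ d / ε ^ d * R w ^ d + 6 ^ d * δ ^ d := by
        rw [show (4 : ℝ) = 2 * 2 by norm_num, show (6 : ℝ) = 2 * 3 by norm_num]
        simp only [mul_pow, div_pow]
        ring
      _ ≤ _ := by gcongr
  have h7 := h1.trans (Finset.sum_le_sum h2)
  rw [Finset.sum_add_distrib, ← Finset.mul_sum, Finset.sum_const, nsmul_eq_mul] at h7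
  have h8 : ε ^ d * (T.card : ℝ) = ε ^ d / δ ^ d * (T.card * δ ^ d) := by field_simp
  rw [h8]
  refine (mul_le_mul_of_nonneg_left h7 (by positivity)).trans (le_of_eq ?_)
  field_simp

/-! ### Good and bad centres, and the separation of the holes. -/

section Configuration

variable {d : ℕ}

/-- The centres whose scaled radius exceeds `ε r / 2`. -/
def largeCentres (S : Set (Space d)) (ρ : Space d → ℝ) (D : Set (Space d)) (r ε : ℝ) :
    Set (Space d) :=
  {z | z ∈ S ∩ dilate ε D ∧ ε * r / 2 < scaledRadius d ε (ρ z)}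

/-- The centres with another centre at distance less than `2 r`. -/
def crowdedCentres (S : Set (Space d)) (D : Set (Space d)) (r ε : ℝ) : Set (Space d) :=
  {z | z ∈ S ∩ dilate ε D ∧ z ∉ thin (2 * r) S}

/-- The centres that come too close to a large ball. -/
def shadowedCentres (S : Set (Space d)) (ρ : Space d → ℝ) (D : Set (Space d)) (r ε : ℝ) :
    Set (Space d) :=
  {z | z ∈ S ∩ dilate ε D ∧ ∃ w ∈ largeCentres S ρ D r ε,
    dist (ε • z) (ε • w) < 2 * scaledRadius d ε (ρ w) + r * ε}

def badCentres (S : Set (Space d)) (ρ : Space d → ℝ) (D : Set (Space d)) (r ε : ℝ) :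
    Set (Space d) :=
  largeCentres S ρ D r ε ∪ crowdedCentres S D r ε ∪ shadowedCentres S ρ D r ε

def goodCentres (S : Set (Space d)) (ρ : Space d → ℝ) (D : Set (Space d)) (r ε : ℝ) :
    Set (Space d) :=
  (S ∩ dilate ε D) \ badCentres S ρ D r ε

/-- The union of the balls with twice the radius around the bad centres. -/
def safetyLayer (S : Set (Space d)) (ρ : Space d → ℝ) (D : Set (Space d)) (r ε : ℝ) :
    Set (Space d) :=
  ⋃ z ∈ badCentres S ρ D r ε, Metric.ball (ε • z) (2 * scaledRadius d ε (ρ z))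

variable {S : Set (Space d)} {ρ : Space d → ℝ} {D : Set (Space d)} {r ε : ℝ}

theorem badCentres_subset : badCentres S ρ D r ε ⊆ S ∩ dilate ε D := by
  rintro z ((h | h) | h) <;> exact h.1

theorem goodCentres_subset : goodCentres S ρ D r ε ⊆ S ∩ dilate ε D := sdiff_subset

theorem goodCentres_union_badCentres :
    goodCentres S ρ D r ε ∪ badCentres S ρ D r ε = S ∩ dilate ε D :=
  sdiff_union_of_subset badCentres_subset

theorem scaledRadius_nonneg (hε : 0 < ε) {s : ℝ} (hs : 0 ≤ s) : 0 ≤ scaledRadius d ε s :=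
  mul_nonneg (Real.rpow_nonneg hε.le _) hs

theorem ballUnion_union (A B : Set (Space d)) :
    ballUnion ε (A ∪ B) ρ = ballUnion ε A ρ ∪ ballUnion ε B ρ :=
  biUnion_union _ _ _

theorem isOpen_ballUnion (A : Set (Space d)) : IsOpen (ballUnion ε A ρ) :=
  isOpen_biUnion fun _ _ => Metric.isOpen_ball

theorem isOpen_safetyLayer : IsOpen (safetyLayer S ρ D r ε) :=
  isOpen_biUnion fun _ _ => Metric.isOpen_ball

theorem ballUnion_badCentres_subset (hε : 0 < ε) (hρ : ∀ z ∈ S, 0 ≤ ρ z) :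
    ballUnion ε (badCentres S ρ D r ε) ρ ⊆ safetyLayer S ρ D r ε :=
  iUnion₂_mono fun z hz => Metric.ball_subset_ball (by
    have := scaledRadius_nonneg (d := d) hε (hρ z (badCentres_subset hz).1)
    linarith)

theorem scaledRadius_le_of_mem_goodCentres {z : Space d} (hz : z ∈ goodCentres S ρ D r ε) :
    scaledRadius d ε (ρ z) ≤ ε * r / 2 := by
  by_contra! h
  exact hz.2 (Or.inl (Or.inl ⟨hz.1, h⟩))

theorem le_dist_of_mem_goodCentres {z w : Space d} (hz : z ∈ goodCentres S ρ D r ε)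
    (hw : w ∈ S) (hzw : w ≠ z) : 2 * r ≤ dist z w := by
  by_contra! h
  refine hz.2 (Or.inl (Or.inr ⟨hz.1, fun h' => ?_⟩))
  exact absurd (h'.2 w hw hzw) (not_le.2 h)

theorem pairwiseDisjoint_goodCentres (hε : 0 < ε) (hr : 0 < r) :
    (goodCentres S ρ D r ε).PairwiseDisjoint
      (fun z => Metric.ball (ε • z) (scaledRadius d ε (ρ z))) := by
  intro z hz w hw hzw
  apply Metric.ball_disjoint_ball
  have h1 := scaledRadius_le_of_mem_goodCentres hz
  have h2 := scaledRadius_le_of_mem_goodCentres hw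
  have h3 := le_dist_of_mem_goodCentres hz hw.1.1 hzw.symm
  rw [dist_smul₀, Real.norm_eq_abs, abs_of_pos hε]
  have := mul_le_mul_of_nonneg_left h3 hε.le
  have := mul_pos hε hr
  linarith

/-- A point of a good ball is within `ε r / 2` of its centre. If the bad ball is large, the good
centre is not shadowed, leaving `r ε - ε r / 2`. Otherwise the doubled bad ball has radius at most
`ε r`, and the centres are `2 r ε` apart because the good one is not crowded. -/
theorem le_dist_safetyLayer (hε : 0 < ε) :
    ∀ x ∈ ballUnion ε (goodCentres S ρ D r ε) ρ, ∀ y ∈ safetyLayer S ρ D r ε,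
      ε * r / 2 ≤ dist x y := by
  intro x hx y hy
  simp only [ballUnion, safetyLayer, mem_iUnion, Metric.mem_ball] at hx hy
  obtain ⟨z, hz, hxz⟩ := hx
  obtain ⟨w, hw, hyw⟩ := hy
  have h1 := scaledRadius_le_of_mem_goodCentres hz
  have h4 := dist_triangle4 (ε • z) x y (ε • w)
  rw [dist_comm _ x] at h4
  by_cases hl : w ∈ largeCentres S ρ D r ε
  · have h2 : ¬ dist (ε • z) (ε • w) < 2 * scaledRadius d ε (ρ w) + r * ε := fun h =>
      hz.2 (Or.inr ⟨hz.1, w, hl, h⟩)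
    linarith
  · have hwS := badCentres_subset hw
    have h2 : scaledRadius d ε (ρ w) ≤ ε * r / 2 := by
      by_contra! h
      exact hl ⟨hwS, h⟩
    have hne : w ≠ z := fun h => hz.2 (h ▸ hw)
    have h3 := mul_le_mul_of_nonneg_left (le_dist_of_mem_goodCentres hz hwS.1 hne) hε.le
    rw [dist_smul₀, Real.norm_eq_abs, abs_of_pos hε] at h4
    linarith

end Configuration

/-! ### Asymptotics for one realisation, from few crowded centres and tight marks. -/

section Asymptotics

variable {d : ℕ} {S : Set (Space d)} {ρ : Space d → ℝ} {D : Set (Space d)}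

/-- The density of the centres with a neighbour at distance less than `2 δ` vanishes with `δ`. -/
def FewCrowdedCentres (S D : Set (Space d)) : Prop :=
  ∀ κ : ℝ, 0 < κ → ∃ δ : ℝ, 0 < δ ∧ ∀ᶠ ε in 𝓝[>] (0 : ℝ),
    ε ^ d * ((crowdedCentres S D δ ε).ncard : ℝ) ≤ κ

/-- The sums `ε^d ∑ ρ^{d-2}` are uniformly integrable as `ε → 0`. -/
def TightMarks (S : Set (Space d)) (ρ : Space d → ℝ) (D : Set (Space d)) : Prop :=
  ∀ κ : ℝ, 0 < κ → ∃ M : ℝ, ∀ᶠ ε in 𝓝[>] (0 : ℝ), ∀ T : Finset (Space d),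
    (T : Set (Space d)) ⊆ S ∩ dilate ε D → (∀ z ∈ T, M < ρ z) →
      ε ^ d * ∑ z ∈ T, ρ z ^ (d - 2) ≤ κ

/-- The scale `r` tends to zero, but so slowly that `ε r / 2` is the scaled radius of arbitrarily
large marks. -/
structure IsSlowScale (d : ℕ) (r : ℝ → ℝ) : Prop where
  pos : ∀ ε, 0 < ε → 0 < r ε
  tendsto : Tendsto r (𝓝[>] 0) (𝓝 0)
  lt_of_lt : ∀ M : ℝ, ∀ᶠ ε in 𝓝[>] (0 : ℝ), ∀ s, ε * r ε / 2 < scaledRadius d ε s → M < s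

/-- The exponent `d/(d-2)` is critical: the capacity of one ball matches the volume per centre
`ε^d`. -/
theorem scaledRadius_pow (hd : 2 < d) {ε : ℝ} (hε : 0 < ε) (s : ℝ) :
    scaledRadius d ε s ^ (d - 2) = ε ^ d * s ^ (d - 2) := by
  have h2 : (d : ℝ) - 2 = ((d - 2 : ℕ) : ℝ) := by
    rw [Nat.cast_sub hd.le]; norm_num
  have h0 : ((d - 2 : ℕ) : ℝ) ≠ 0 := by
    have : d - 2 ≠ 0 := by omega
    exact_mod_cast this
  rw [scaledRadius, mul_pow, ← Real.rpow_natCast (ε ^ _) (d - 2), ← Real.rpow_mul hε.le, h2,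
    div_mul_cancel₀ _ h0, Real.rpow_natCast]

theorem isSlowScale_rpow (hd : 2 < d) : IsSlowScale d fun ε => ε ^ (1 / ((d : ℝ) - 2)) := by
  have h2 : 0 < (d : ℝ) - 2 := by
    have : (2 : ℝ) < d := by exact_mod_cast hd
    linarith
  refine ⟨fun ε hε => Real.rpow_pos_of_pos hε _, ?_, fun M => ?_⟩
  · have h : ContinuousAt (fun ε : ℝ => ε ^ (1 / ((d : ℝ) - 2))) 0 :=
      Real.continuousAt_rpow_const _ _ (Or.inr (by positivity))
    have h' := h.tendsto
    rw [Real.zero_rpow (by positivity)] at h'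
    exact h'.mono_left nhdsWithin_le_nhds
  · have ht : Tendsto (fun ε : ℝ => ε⁻¹ ^ (1 / ((d : ℝ) - 2)) / 2) (𝓝[>] 0) atTop :=
      ((tendsto_rpow_atTop (by positivity)).comp tendsto_inv_nhdsGT_zero).atTop_div_const
        (by norm_num)
    filter_upwards [ht.eventually_ge_atTop M, self_mem_nhdsWithin] with ε hM hε s hs
    refine hM.trans_lt ?_
    have hε : 0 < ε := hε
    have hp : 0 < ε ^ ((d : ℝ) / ((d : ℝ) - 2)) := Real.rpow_pos_of_pos hε _
    rw [scaledRadius] at hs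
    refine lt_of_mul_lt_mul_left (lt_of_eq_of_lt ?_ hs) hp.le
    -- Since `d/(d-2) = 1 + 2/(d-2)`, dividing `ε r` by the scaling factor leaves `ε ^ (-1/(d-2))`.
    have h3 : ε ^ ((d : ℝ) / ((d : ℝ) - 2)) = ε * ε ^ (1 / ((d : ℝ) - 2)) * ε ^ (1 / ((d : ℝ) - 2)) := by
      nth_rewrite 2 [← Real.rpow_one ε]
      rw [← Real.rpow_add hε, ← Real.rpow_add hε]
      congr 1
      field_simp
      ring
    have hq : 0 < ε ^ (1 / ((d : ℝ) - 2)) := Real.rpow_pos_of_pos hε _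
    rw [h3, Real.inv_rpow hε.le]
    field_simp

theorem thin_antitone {δ δ' : ℝ} (h : δ ≤ δ') : thin δ' S ⊆ thin δ S :=
  fun _ hx => ⟨hx.1, fun y hy hyx => h.trans (hx.2 y hy hyx)⟩

variable {r : ℝ → ℝ}

/-- Marks of large centres eventually exceed any threshold, so tightness bounds their sum. Once they
also exceed `1`, the same sum dominates the number of centres. -/
theorem eventually_largeCentres_small (hd : 2 < d) (hM : TightMarks S ρ D) (hr : IsSlowScale d r)
    {κ : ℝ} (hκ : 0 < κ) : ∀ᶠ ε in 𝓝[>] (0 : ℝ), ∀ T : Finset (Space d),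
      (T : Set (Space d)) ⊆ largeCentres S ρ D (r ε) ε →
        ∑ z ∈ T, scaledRadius d ε (ρ z) ^ (d - 2) ≤ κ ∧ ε ^ d * (T.card : ℝ) ≤ κ := by
  obtain ⟨M, hM⟩ := hM κ hκ
  filter_upwards [hM, hr.lt_of_lt (max M 1), self_mem_nhdsWithin] with ε h1 h2 hε T hT
  have hε : 0 < ε := hε
  have h3 : ∀ z ∈ T, max M 1 < ρ z := fun z hz => h2 _ (hT hz).2
  have h4 := h1 T (hT.trans fun z hz => hz.1) fun z hz => (le_max_left _ _).trans_lt (h3 z hz)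
  refine ⟨?_, le_trans ?_ h4⟩
  · simp_rw [scaledRadius_pow hd hε]
    rwa [← Finset.mul_sum]
  · gcongr
    rw [Finset.card_eq_sum_ones]
    push_cast
    exact Finset.sum_le_sum fun z hz =>
      one_le_pow₀ ((le_max_right M 1).trans (h3 z hz).le)

/-- The scale `δ` is fixed before `ε` tends to zero: crowding at scale `r ε ≤ δ` implies crowding at
scale `δ`, and shadowed centres not crowded at scale `δ` are separated enough for packing. -/
theorem eventually_badCentres_few (hd : 2 < d) (hfin : ∀ ε, 0 < ε → (S ∩ dilate ε D).Finite)
    (hρ : ∀ z ∈ S, 0 ≤ ρ z) (hC : FewCrowdedCentres S D) (hM : TightMarks S ρ D)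
    (hr : IsSlowScale d r) {κ : ℝ} (hκ : 0 < κ) :
    ∀ᶠ ε in 𝓝[>] (0 : ℝ), ε ^ d * ((badCentres S ρ D (r ε) ε).ncard : ℝ) ≤ κ := by
  obtain ⟨δ, hδ, hC⟩ := hC (κ / 4) (by positivity)
  set K : ℝ := 4 ^ d / δ ^ d + 6 ^ d with hK
  have hK0 : 0 < K := by positivity
  have hκ' : 0 < min 1 (min (κ / 4) (κ / 4 / K)) := by positivity
  filter_upwards [hC, eventually_largeCentres_small hd hM hr hκ', self_mem_nhdsWithin,
    hr.tendsto.eventually_le_const hδ] with ε h1 h2 hε hrδ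
  have hε : 0 < ε := hε
  have hLfin : (largeCentres S ρ D (r ε) ε).Finite := (hfin ε hε).subset fun z hz => hz.1
  have hTfin : (shadowedCentres S ρ D (r ε) ε ∩ thin (2 * δ) S).Finite :=
    (hfin ε hε).subset fun z hz => hz.1.1
  have hsub : badCentres S ρ D (r ε) ε ⊆ (largeCentres S ρ D (r ε) ε ∪ crowdedCentres S D δ ε) ∪
      (shadowedCentres S ρ D (r ε) ε ∩ thin (2 * δ) S) := by
    rintro z ((h | h) | h)
    · exact Or.inl (Or.inl h)
    · exact Or.inl (Or.inr ⟨h.1, fun h' => h.2 (thin_antitone (by linarith) h')⟩)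
    · by_cases hz : z ∈ thin (2 * δ) S
      · exact Or.inr ⟨h, hz⟩
      · exact Or.inl (Or.inr ⟨h.1, hz⟩)
  have hL := h2 hLfin.toFinset (by simp)
  have hL1 := hL.1.trans (min_le_left _ _)
  have hT := pow_mul_card_le_of_near hd hε hδ hTfin.toFinset hLfin.toFinset
    (fun w => scaledRadius d ε (ρ w))
    (fun w hw => scaledRadius_nonneg hε (hρ w ((hLfin.mem_toFinset.1 hw).1.1))) hL1
    (fun x hx y hy hxy => ((hTfin.mem_toFinset.1 hx).2.2 y (hTfin.mem_toFinset.1 hy).2.1 hxy.symm))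
    (fun x hx => by
      obtain ⟨w, hw, hxw⟩ := (hTfin.mem_toFinset.1 hx).1.2
      refine ⟨w, hLfin.mem_toFinset.2 hw, hxw.le.trans ?_⟩
      have := mul_le_mul_of_nonneg_right hrδ hε.le
      have := mul_pos hδ hε
      linarith)
  have hT' : ε ^ d * (hTfin.toFinset.card : ℝ) ≤ κ / 4 := by
    refine hT.trans ?_
    have h3 : min 1 (min (κ / 4) (κ / 4 / K)) ≤ κ / 4 / K := (min_le_right _ _).trans (min_le_right _ _)
    calc _ ≤ 4 ^ d / δ ^ d * (κ / 4 / K) + 6 ^ d * (κ / 4 / K) := by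
          gcongr
          · exact hL.1.trans h3
          · exact hL.2.trans h3
      _ = κ / 4 := by rw [← add_mul, ← hK]; field_simp
  have hL' : ε ^ d * (hLfin.toFinset.card : ℝ) ≤ κ / 4 :=
    hL.2.trans ((min_le_right _ _).trans (min_le_left _ _))
  rw [← ncard_eq_toFinset_card _ hTfin] at hT'
  rw [← ncard_eq_toFinset_card _ hLfin] at hL'
  have hcard : ((badCentres S ρ D (r ε) ε).ncard : ℝ) ≤ (largeCentres S ρ D (r ε) ε).ncard +
      (crowdedCentres S D δ ε).ncard + (shadowedCentres S ρ D (r ε) ε ∩ thin (2 * δ) S).ncard := by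
    have hCfin : (crowdedCentres S D δ ε).Finite := (hfin ε hε).subset fun z hz => hz.1
    have := (ncard_le_ncard hsub ((hLfin.union hCfin).union hTfin)).trans ((ncard_union_le _ _).trans
      (Nat.add_le_add_right (ncard_union_le _ _) _))
    exact_mod_cast this
  have := mul_le_mul_of_nonneg_left hcard (by positivity : 0 ≤ ε ^ d)
  linarith

/-- Marks above a threshold `M` are handled by tightness; those below contribute a bounded amount
each, and bad centres have vanishing density. -/
theorem eventually_badCentres_sum_small (hd : 2 < d)
    (hfin : ∀ ε, 0 < ε → (S ∩ dilate ε D).Finite)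
    (hρ : ∀ z ∈ S, 0 ≤ ρ z) (hC : FewCrowdedCentres S D) (hM : TightMarks S ρ D)
    (hr : IsSlowScale d r) {κ : ℝ} (hκ : 0 < κ) :
    ∀ᶠ ε in 𝓝[>] (0 : ℝ), ∀ T : Finset (Space d), (T : Set (Space d)) ⊆ badCentres S ρ D (r ε) ε →
      ∑ z ∈ T, scaledRadius d ε (ρ z) ^ (d - 2) ≤ κ := by
  obtain ⟨M, hM'⟩ := hM (κ / 2) (by positivity)
  set B : ℝ := max M 1 ^ (d - 2)
  have hB : 0 < B := by positivity
  filter_upwards [hM', eventually_badCentres_few hd hfin hρ hC hM hr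
    (by positivity : 0 < κ / 2 / B), self_mem_nhdsWithin] with ε h1 h2 hε T hT
  have hε : 0 < ε := hε
  have hbfin : (badCentres S ρ D (r ε) ε).Finite := (hfin ε hε).subset badCentres_subset
  simp_rw [scaledRadius_pow hd hε]
  rw [← Finset.mul_sum, ← Finset.sum_filter_add_sum_filter_not T (fun z => M < ρ z), mul_add]
  have h3 := h1 (T.filter fun z => M < ρ z)
    (fun z hz => badCentres_subset (hT (Finset.mem_filter.1 hz).1))
    (fun z hz => (Finset.mem_filter.1 hz).2)
  have h4 : ∑ z ∈ T.filter (fun z => ¬ M < ρ z), ρ z ^ (d - 2) ≤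
      ((badCentres S ρ D (r ε) ε).ncard : ℝ) * B := by
    have h5 : ∑ z ∈ T.filter (fun z => ¬ M < ρ z), ρ z ^ (d - 2) ≤
        (T.filter (fun z => ¬ M < ρ z)).card • B := by
      refine Finset.sum_le_card_nsmul _ _ _ fun z hz => ?_
      have hz' := Finset.mem_filter.1 hz
      have := hρ z (badCentres_subset (hT hz'.1)).1
      exact pow_le_pow_left₀ this ((not_lt.1 hz'.2).trans (le_max_left _ _)) _
    rw [nsmul_eq_mul] at h5
    refine h5.trans ?_
    gcongr
    rw [← ncard_coe_finset]
    exact ncard_le_ncard (fun z hz => hT (Finset.mem_filter.1 hz).1) hbfin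
  have h6 : ε ^ d * (((badCentres S ρ D (r ε) ε).ncard : ℝ) * B) ≤ κ / 2 := by
    rw [← mul_assoc]
    exact (le_div_iff₀ hB).1 h2
  have h7 := mul_le_mul_of_nonneg_left h4 (by positivity : 0 ≤ ε ^ d)
  linarith

theorem tendsto_capacity_badCentres (hd : 2 < d)
    (hfin : ∀ ε, 0 < ε → (S ∩ dilate ε D).Finite)
    (hρ : ∀ z ∈ S, 0 ≤ ρ z) (hC : FewCrowdedCentres S D) (hM : TightMarks S ρ D)
    (hr : IsSlowScale d r) :
    Tendsto (fun ε => capacity (ballUnion ε (badCentres S ρ D (r ε) ε) ρ)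
      (safetyLayer S ρ D (r ε) ε)) (𝓝[>] 0) (𝓝 0) := by
  obtain ⟨C, hC0, hcap⟩ := exists_capacity_iUnion_ball_le d hd
  refine ENNReal.tendsto_nhds_zero.2 fun κ hκ => ?_
  obtain ⟨κ', hκ'0, hκ'⟩ : ∃ κ' : ℝ, 0 < κ' ∧ ENNReal.ofReal (C * κ') ≤ κ := by
    by_cases ht : κ = ⊤
    · exact ⟨1, one_pos, ht ▸ le_top⟩
    · have h0 : 0 < κ.toReal := ENNReal.toReal_pos hκ.ne' ht
      refine ⟨κ.toReal / (C + 1), by positivity, ?_⟩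
      rw [ENNReal.ofReal_le_iff_le_toReal ht, mul_div_assoc', div_le_iff₀ (by positivity)]
      nlinarith
  filter_upwards [eventually_badCentres_sum_small hd hfin hρ hC hM hr hκ'0, self_mem_nhdsWithin]
    with ε h1 hε
  have hε : 0 < ε := hε
  have hbfin : (badCentres S ρ D (r ε) ε).Finite := (hfin ε hε).subset badCentres_subset
  have h2 := hcap hbfin.toFinset (fun z => ε • z) (fun z => scaledRadius d ε (ρ z))
    fun z hz => scaledRadius_nonneg hε (hρ z (badCentres_subset (hbfin.mem_toFinset.1 hz)).1)
  simp only [hbfin.mem_toFinset] at h2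
  refine h2.trans (le_trans (ENNReal.ofReal_le_ofReal ?_) hκ')
  gcongr
  exact h1 _ (by simp)

theorem tendsto_goodCentres_ncard (hd : 2 < d)
    (hfin : ∀ ε, 0 < ε → (S ∩ dilate ε D).Finite)
    (hρ : ∀ z ∈ S, 0 ≤ ρ z) (hC : FewCrowdedCentres S D) (hM : TightMarks S ρ D)
    (hr : IsSlowScale d r) {c : ℝ}
    (hN : Tendsto (fun ε => ε ^ d * ((S ∩ dilate ε D).ncard : ℝ)) (𝓝[>] 0) (𝓝 c)) :
    Tendsto (fun ε => ε ^ d * ((goodCentres S ρ D (r ε) ε).ncard : ℝ)) (𝓝[>] 0) (𝓝 c) := by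
  have hb : Tendsto (fun ε => ε ^ d * ((badCentres S ρ D (r ε) ε).ncard : ℝ)) (𝓝[>] 0) (𝓝 0) := by
    refine tendsto_order.2 ⟨fun a ha => ?_, fun a ha => ?_⟩
    · filter_upwards [self_mem_nhdsWithin] with ε hε
      have hε : 0 < ε := hε
      exact ha.trans_le (by positivity)
    · filter_upwards [eventually_badCentres_few hd hfin hρ hC hM hr (half_pos ha)] with ε h
      linarith
  have h := hN.sub hb
  rw [sub_zero] at h
  refine h.congr' ?_
  filter_upwards [self_mem_nhdsWithin] with ε hε
  have h1 := ncard_sdiff_add_ncard_of_subset (badCentres_subset (S := S) (ρ := ρ) (D := D)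
    (r := r ε) (ε := ε)) (hfin ε hε)
  rw [← h1, goodCentres]
  push_cast
  ring

theorem tendsto_ncard_near_safetyLayer (hd : 2 < d)
    (hfin : ∀ ε, 0 < ε → (S ∩ dilate ε D).Finite)
    (hρ : ∀ z ∈ S, 0 ≤ ρ z) (hC : FewCrowdedCentres S D) (hM : TightMarks S ρ D)
    (hr : IsSlowScale d r) {δ : ℝ} (hδ : 0 < δ) :
    Tendsto (fun ε => ε ^ d * (({z | z ∈ thin (2 * δ) S ∩ dilate ε D ∧
      Metric.infEDist (ε • z) (safetyLayer S ρ D (r ε) ε) ≤ ENNReal.ofReal (δ * ε)}.ncard : ℕ) : ℝ))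
      (𝓝[>] 0) (𝓝 0) := by
  set K : ℝ := 4 ^ d / δ ^ d + 6 ^ d with hK
  have hK0 : 0 < K := by positivity
  refine tendsto_order.2 ⟨fun a ha => ?_, fun a ha => ?_⟩
  · filter_upwards [self_mem_nhdsWithin] with ε hε
    have hε : 0 < ε := hε
    exact ha.trans_le (by positivity)
  have hκ' : 0 < min 1 (a / 2 / K) := by positivity
  filter_upwards [eventually_badCentres_few hd hfin hρ hC hM hr hκ',
    eventually_badCentres_sum_small hd hfin hρ hC hM hr hκ', self_mem_nhdsWithin] with ε h1 h2 hε
  have hε : 0 < ε := hε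
  have hbfin : (badCentres S ρ D (r ε) ε).Finite := (hfin ε hε).subset badCentres_subset
  set N := {z | z ∈ thin (2 * δ) S ∩ dilate ε D ∧
      Metric.infEDist (ε • z) (safetyLayer S ρ D (r ε) ε) ≤ ENNReal.ofReal (δ * ε)}
  have hNfin : N.Finite := (hfin ε hε).subset fun z hz => ⟨hz.1.1.1, hz.1.2⟩
  have h3 := h2 hbfin.toFinset (by simp)
  have hT := pow_mul_card_le_of_near hd hε hδ hNfin.toFinset hbfin.toFinset
    (fun w => scaledRadius d ε (ρ w))
    (fun w hw => scaledRadius_nonneg hε (hρ w (badCentres_subset (hbfin.mem_toFinset.1 hw)).1))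
    (h3.trans (min_le_left _ _))
    (fun x hx y hy hxy => ((hNfin.mem_toFinset.1 hx).1.1.2 y (hNfin.mem_toFinset.1 hy).1.1.1
      hxy.symm))
    (fun x hx => by
      -- Doubling `δ ε` makes the inequality strict, so that an actual point of the layer realises
      -- it.
      have h4 : Metric.infEDist (ε • x) (safetyLayer S ρ D (r ε) ε) < ENNReal.ofReal (2 * δ * ε) :=
        (hNfin.mem_toFinset.1 hx).2.trans_lt
          ((ENNReal.ofReal_lt_ofReal_iff (by positivity)).2 (by nlinarith [mul_pos hδ hε]))
      obtain ⟨y, hy, hxy⟩ := Metric.infEDist_lt_iff.1 h4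
      simp only [safetyLayer, mem_iUnion, Metric.mem_ball] at hy
      obtain ⟨w, hw, hyw⟩ := hy
      rw [edist_dist, ENNReal.ofReal_lt_ofReal_iff (by positivity)] at hxy
      exact ⟨w, hbfin.mem_toFinset.2 hw, by linarith [dist_triangle (ε • x) y (ε • w)]⟩)
  rw [← ncard_eq_toFinset_card _ hNfin, ← ncard_eq_toFinset_card _ hbfin] at hT
  refine hT.trans_lt ?_
  calc _ ≤ 4 ^ d / δ ^ d * (a / 2 / K) + 6 ^ d * (a / 2 / K) := by
        gcongr
        · exact h3.trans (min_le_right _ _)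
        · exact h1.trans (min_le_right _ _)
    _ = a / 2 := by rw [← add_mul, ← hK]; field_simp
    _ < a := by linarith

end Asymptotics

/-! ### Boxes and lattice cells. -/

section Boxes

variable {d : ℕ}

/-- The half-open box `∏ [a i, b i)`. -/
def box (a b : Fin d → ℝ) : Set (Space d) := {y | ∀ i, a i ≤ y i ∧ y i < b i}

theorem measurableSet_box (a b : Fin d → ℝ) : MeasurableSet (box a b) := by
  have : box a b = ⋂ i, {y : Space d | a i ≤ y i} ∩ {y | y i < b i} := by
    ext y; simp [box]
  rw [this]
  refine MeasurableSet.iInter fun i => ?_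
  exact (measurableSet_le measurable_const (by fun_prop)).inter
    (measurableSet_lt (by fun_prop) measurable_const)

theorem isBounded_box (a b : Fin d → ℝ) : Bornology.IsBounded (box a b) := by
  have h1 : Bornology.IsBounded (Set.pi univ fun i => Icc (a i) (b i)) :=
    Bornology.IsBounded.pi fun i => Metric.isBounded_Icc _ _
  refine ((PiLp.antilipschitzWith_ofLp 2 (fun _ : Fin d => ℝ)).isBounded_preimage h1).subset ?_
  intro y hy i _
  exact ⟨(hy i).1, (hy i).2.le⟩

theorem image_add_box (a b : Fin d → ℝ) (x : Space d) :
    (fun z => z + x) '' box a b = box (fun i => a i + x i) (fun i => b i + x i) := by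
  ext y
  constructor
  · rintro ⟨z, hz, rfl⟩ i
    have := hz i
    simp only [PiLp.add_apply]
    constructor <;> linarith
  · intro hy
    refine ⟨y - x, fun i => ?_, by simp⟩
    have := hy i
    simp only [PiLp.sub_apply]
    constructor <;> linarith

/-- The cube with lower corner `k / m` and side length `t / m`. -/
def cell (m t : ℕ) (k : Fin d → ℤ) : Set (Space d) :=
  box (fun i => (k i : ℝ) / m) (fun i => ((k i : ℝ) + t) / m)

theorem image_add_cell (m t : ℕ) (k l : Fin d → ℤ) :
    (fun z => z + WithLp.toLp 2 fun i => ((l i : ℝ) - k i) / m) '' cell m t k = cell m t l := by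
  rw [cell, image_add_box, cell]
  congr 1 <;> ext i <;> simp only <;> ring

theorem diam_cell (m t : ℕ) (k : Fin d → ℤ) :
    Metric.diam (cell m t k) = Metric.diam (cell m t (0 : Fin d → ℤ)) := by
  rw [← image_add_cell m t 0 k]
  exact (IsometryEquiv.addRight _).isometry.diam_image _

end Boxes

/-! ### Summability of decaying kernels over the lattice. -/

section LatticeSums

variable {d : ℕ}

theorem summable_one_add_norm_rpow_neg {γ : ℝ} (hγ : (d : ℝ) < γ) :
    Summable fun v : Fin d → ℤ => (1 + ‖v‖) ^ (-γ) := by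
  have hγ0 : 0 < γ := (Nat.cast_nonneg d).trans_lt hγ
  let L := Submodule.span ℤ (Set.range (Pi.basisFun ℝ (Fin d)))
  have hrank : Module.finrank ℤ L = d := by
    rw [ZLattice.rank ℝ L]; simp
  have h1 := ZLattice.summable_norm_rpow L (-γ) (by rw [hrank]; linarith)
  have hmem : ∀ v : Fin d → ℤ, (fun i => (v i : ℝ)) ∈ L := by
    intro v
    have : (fun i => (v i : ℝ)) = ∑ i, v i • Pi.basisFun ℝ (Fin d) i := by
      ext j
      simp [Finset.sum_apply, Pi.single_apply]
    rw [this]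
    exact Submodule.sum_mem _ fun i _ => Submodule.smul_mem _ _ (Submodule.subset_span ⟨i, rfl⟩)
  let e : (Fin d → ℤ) → L := fun v => ⟨fun i => (v i : ℝ), hmem v⟩
  have he : Function.Injective e := by
    intro v w h
    ext i
    have : ((v i : ℤ) : ℝ) = (w i : ℤ) := congrFun (congrArg Subtype.val h) i
    exact_mod_cast this
  have hn : ∀ v, ‖e v‖ = ‖v‖ := by
    intro v
    change ‖(fun i => (v i : ℝ))‖ = ‖v‖
    simp only [Pi.norm_def, nnnorm]
    rfl
  have h2 : Summable fun v : Fin d → ℤ => ‖v‖ ^ (-γ) := by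
    have := h1.comp_injective he
    simpa only [Function.comp_def, hn] using this
  -- The power `‖v‖ ^ (-γ)` takes the value `0` at the origin, so that term must be supplied
  -- separately.
  have h3 : Summable fun v : Fin d → ℤ => if v = 0 then (1 : ℝ) else 0 :=
    summable_of_ne_finset_zero (s := {0}) fun v hv => by simp_all
  refine (h2.add h3).of_nonneg_of_le (fun v => by positivity) fun v => ?_
  by_cases hv : v = 0
  · simp [hv, Real.zero_rpow (neg_ne_zero.2 hγ0.ne')]
  · simp only [hv, if_false, add_zero]
    exact Real.rpow_le_rpow_of_nonpos (norm_pos_iff.2 hv) (by linarith [norm_nonneg v]) (by linarith)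

theorem sum_one_add_norm_sub_rpow_neg_le {γ : ℝ} (hγ : (d : ℝ) < γ) (I : Finset (Fin d → ℤ))
    (k : Fin d → ℤ) :
    ∑ l ∈ I, (1 + ‖l - k‖) ^ (-γ) ≤ ∑' v : Fin d → ℤ, (1 + ‖v‖) ^ (-γ) := by
  have h := (summable_one_add_norm_rpow_neg hγ)
  have h1 : ∑ l ∈ I, (1 + ‖l - k‖) ^ (-γ) =
      ∑ v ∈ I.map (Equiv.subRight k).toEmbedding, (1 + ‖v‖) ^ (-γ) := by
    rw [Finset.sum_map]; rfl
  rw [h1]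
  exact h.sum_le_tsum _ fun v _ => by positivity

/-- Converts the decay profile `1 / (1 + u^γ)` in a Euclidean distance into a lattice profile,
whenever the two distances are comparable up to additive constants. -/
theorem one_div_one_add_rpow_le {γ u a v : ℝ} (hγ : 0 ≤ γ) (hu : 0 ≤ u) (ha : 0 ≤ a) (hv : 0 ≤ v)
    (h : 1 + v ≤ a * (1 + u)) : 1 / (1 + u ^ γ) ≤ (2 * a) ^ γ * (1 + v) ^ (-γ) := by
  have h1 : (1 + v) ^ γ ≤ (2 * a) ^ γ * (1 + u ^ γ) := by
    have h2 : 1 + v ≤ 2 * a * max 1 u := by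
      nlinarith [le_max_left 1 u, le_max_right 1 u]
    calc (1 + v) ^ γ ≤ (2 * a * max 1 u) ^ γ := by gcongr
      _ = (2 * a) ^ γ * (max 1 u) ^ γ := Real.mul_rpow (by positivity) (by positivity)
      _ ≤ (2 * a) ^ γ * (1 + u ^ γ) := by
        gcongr
        rcases le_total 1 u with h | h
        · rw [max_eq_right h]; linarith
        · rw [max_eq_left h, Real.one_rpow]; linarith [Real.rpow_nonneg hu γ]
  have h3 : 0 < 1 + u ^ γ := by positivity
  rw [Real.rpow_neg (by positivity), div_le_iff₀ h3, mul_right_comm, ← div_eq_mul_inv,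
    le_div_iff₀ (by positivity), one_mul]
  exact h1

end LatticeSums

/-! ### A strong law of large numbers under mixing. -/

section LawOfLargeNumbers

open ProbabilityTheory

variable {d : ℕ} {Ω : Type*} [MeasurableSpace Ω] {P : Measure Ω}

/-- Summable second moments make `∑ Y n ^ 2` integrable, hence almost surely finite, so its terms
tend to zero. -/
theorem ae_tendsto_zero_of_lintegral_sq_le {Y : ℕ → Ω → ℝ} (hY : ∀ n, AEMeasurable (Y n) P)
    {a : ℕ → ℝ} (ha : Summable a) (ha0 : ∀ n, 0 ≤ a n)
    (h : ∀ n, ∫⁻ ω, ENNReal.ofReal (Y n ω ^ 2) ∂P ≤ ENNReal.ofReal (a n)) :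
    ∀ᵐ ω ∂P, Tendsto (fun n => Y n ω) atTop (𝓝 0) := by
  have hm : ∀ n, AEMeasurable (fun ω => ENNReal.ofReal (Y n ω ^ 2)) P := fun n =>
    ((hY n).pow_const 2).ennreal_ofReal
  have h1 : ∫⁻ ω, ∑' n, ENNReal.ofReal (Y n ω ^ 2) ∂P ≠ ⊤ := by
    rw [lintegral_tsum hm]
    refine ((ENNReal.tsum_le_tsum h).trans_lt ?_).ne
    rw [← ENNReal.ofReal_tsum_of_nonneg ha0 ha]
    exact ENNReal.ofReal_lt_top
  filter_upwards [ae_lt_top' (AEMeasurable.tsum hm) h1] with ω hω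
  have h2 := ENNReal.tendsto_atTop_zero_of_tsum_ne_top hω.ne
  have h3 : Tendsto (fun n => Y n ω ^ 2) atTop (𝓝 0) := by
    have := (ENNReal.tendsto_toReal ENNReal.zero_ne_top).comp h2
    simpa [Function.comp_def, ENNReal.toReal_ofReal (sq_nonneg _)] using this
  have h4 := (Real.continuous_sqrt.tendsto 0).comp h3
  simp only [Function.comp_def, Real.sqrt_zero, Real.sqrt_sq_eq_abs] at h4
  exact (tendsto_zero_iff_abs_tendsto_zero _).2 h4

variable [IsProbabilityMeasure P]

theorem abs_covariance_le_of_integral_sq_le {X Y : Ω → ℝ} {Λ : ℝ} (hX : MemLp X 2 P)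
    (hY : MemLp Y 2 P) (hX2 : ∫ ω, X ω ^ 2 ∂P ≤ Λ) (hY2 : ∫ ω, Y ω ^ 2 ∂P ≤ Λ) :
    |(∫ ω, X ω * Y ω ∂P) - (∫ ω, X ω ∂P) * (∫ ω, Y ω ∂P)| ≤ 2 * Λ := by
  have hXY : Integrable (fun ω => X ω * Y ω) P := hX.integrable_mul hY
  have h1 : |∫ ω, X ω * Y ω ∂P| ≤ Λ := by
    refine abs_integral_le_integral_abs.trans ?_
    have h2 : ∫ ω, |X ω * Y ω| ∂P ≤ ∫ ω, (X ω ^ 2 + Y ω ^ 2) / 2 ∂P := by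
      refine integral_mono hXY.abs ((hX.integrable_sq.add hY.integrable_sq).div_const 2) fun ω => ?_
      simp only [abs_mul]
      nlinarith [sq_nonneg (|X ω| - |Y ω|), sq_abs (X ω), sq_abs (Y ω)]
    rw [integral_div, integral_add hX.integrable_sq hY.integrable_sq] at h2
    linarith
  have hsq : ∀ {Z : Ω → ℝ}, MemLp Z 2 P → (∫ ω, Z ω ∂P) ^ 2 ≤ ∫ ω, Z ω ^ 2 ∂P := by
    intro Z hZ
    have := variance_nonneg Z P
    rw [variance_eq_sub hZ] at this
    simpa using this
  have h3 : |(∫ ω, X ω ∂P) * (∫ ω, Y ω ∂P)| ≤ Λ := by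
    rw [abs_mul]
    nlinarith [sq_nonneg (|∫ ω, X ω ∂P| - |∫ ω, Y ω ∂P|), sq_abs (∫ ω, X ω ∂P),
      sq_abs (∫ ω, Y ω ∂P), hsq hX, hsq hY]
  refine (abs_sub _ _).trans ?_
  linarith

/-- The covariance of local variables of two lattice cells decays faster than `|k - l|^{-d}`. -/
theorem exists_abs_covariance_cell_le {Φ : Ω → Set (Space d)} (hmix : IsStronglyMixing P Φ)
    {m : ℕ} (hm : 0 < m) (t : ℕ) (Λ : ℝ) : ∃ C γ : ℝ, 0 ≤ C ∧ (d : ℝ) < γ ∧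
    ∀ (k l : Fin d → ℤ) (X Y : Ω → ℝ), Measurable[(countingSigma (cell m t k)).comap Φ] X →
      Measurable[(countingSigma (cell m t l)).comap Φ] Y → MemLp X 2 P → MemLp Y 2 P →
      ∫ ω, X ω ^ 2 ∂P ≤ Λ → ∫ ω, Y ω ^ 2 ∂P ≤ Λ →
      |(∫ ω, X ω * Y ω ∂P) - (∫ ω, X ω ∂P) * (∫ ω, Y ω ∂P)| ≤ C * (1 + ‖l - k‖) ^ (-γ) := by
  obtain ⟨C, γ, hγ, hmix⟩ := hmix
  have hγ0 : 0 < γ := (Nat.cast_nonneg d).trans_lt hγ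
  set Δ := Metric.diam (cell m t (0 : Fin d → ℤ)) with hΔ
  have hΔ0 : 0 ≤ Δ := Metric.diam_nonneg
  have hm0 : (0 : ℝ) < m := by exact_mod_cast hm
  -- The first summand covers cells too close for the mixing condition, where Cauchy–Schwarz-type
  -- bounds suffice; the second covers distant cells.
  refine ⟨2 * |Λ| * (1 + m * Δ) ^ γ + |C| * (2 * (1 + m + m * Δ)) ^ γ * |Λ|, γ, by positivity, hγ,
    fun k l X Y hXm hYm hX hY hX2 hY2 => ?_⟩
  set x : Space d := WithLp.toLp 2 fun i => ((l i : ℝ) - k i) / m with hx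
  have hv : ‖l - k‖ ≤ m * ‖x‖ := by
    refine (pi_norm_le_iff_of_nonneg (by positivity)).2 fun i => ?_
    have h1 : ‖x i‖ ≤ ‖x‖ := PiLp.norm_apply_le x i
    have h2 : ‖(l - k) i‖ = m * ‖x i‖ := by
      rw [← Int.norm_cast_real, hx]
      simp only [Pi.sub_apply, Int.cast_sub, norm_div, Real.norm_natCast]
      field_simp
    rw [h2]
    gcongr
  have hdec : 0 < (1 + ‖l - k‖) ^ (-γ) := by positivity
  have hΛ0 : 0 ≤ Λ := (integral_nonneg fun ω => sq_nonneg (X ω)).trans hX2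
  rw [abs_of_nonneg hΛ0]
  by_cases hxΔ : Δ < ‖x‖
  · have h1 := hmix (cell m t k) (isBounded_box _ _) (measurableSet_box _ _) x
      (by rwa [diam_cell]) X Y hXm (by rwa [hx, image_add_cell]) hX hY
    rw [diam_cell, ← hΔ] at h1
    have hu : 0 ≤ ‖x‖ - Δ := by linarith
    have hbase : 1 + ‖l - k‖ ≤ (1 + m + m * Δ) * (1 + (‖x‖ - Δ)) := by
      nlinarith [mul_nonneg hm0.le hΔ0, mul_nonneg hm0.le hu, mul_nonneg (mul_nonneg hm0.le hΔ0) hu]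
    have h2 := one_div_one_add_rpow_le (a := 1 + m + m * Δ) hγ0.le hu (by positivity)
      (norm_nonneg (l - k)) hbase
    have h3 : √(∫ ω, X ω ^ 2 ∂P) * √(∫ ω, Y ω ^ 2 ∂P) ≤ Λ := by
      calc _ ≤ √Λ * √Λ := by gcongr
        _ = Λ := Real.mul_self_sqrt hΛ0
    calc _ ≤ _ := h1
      _ ≤ (|C| * (1 / (1 + (‖x‖ - Δ) ^ γ))) * Λ := by
        rw [mul_one_div]
        gcongr
        exact le_abs_self C
      _ ≤ (|C| * ((2 * (1 + m + m * Δ)) ^ γ * (1 + ‖l - k‖) ^ (-γ))) * Λ := by gcongr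
      _ ≤ _ := by
        have : 0 ≤ 2 * Λ * (1 + m * Δ) ^ γ * (1 + ‖l - k‖) ^ (-γ) := by positivity
        linarith
  · refine (abs_covariance_le_of_integral_sq_le hX hY hX2 hY2).trans ?_
    have h1 : 1 ≤ (1 + m * Δ) ^ γ * (1 + ‖l - k‖) ^ (-γ) := by
      rw [Real.rpow_neg (by positivity), ← div_eq_mul_inv, le_div_iff₀ (by positivity), one_mul]
      gcongr
      exact hv.trans (by gcongr; exact not_lt.1 hxΔ)
    have h2 : 0 ≤ |C| * (2 * (1 + m + m * Δ)) ^ γ * Λ * (1 + ‖l - k‖) ^ (-γ) := by positivity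
    have h3 := mul_le_mul_of_nonneg_left h1 (by positivity : 0 ≤ 2 * Λ)
    linarith

/-- The strong law of large numbers along the lattice for uniformly square-integrable arrays of
local variables of a strongly mixing process. -/
theorem ae_tendsto_average_of_mixing (hd : 1 < d) {Φ : Ω → Set (Space d)}
    (hmix : IsStronglyMixing P Φ)
    {m : ℕ} (hm : 0 < m) (t : ℕ) (Λ K : ℝ) (X : ℕ → (Fin d → ℤ) → Ω → ℝ)
    (I : ℕ → Finset (Fin d → ℤ)) (hI : ∀ n, ((I n).card : ℝ) ≤ K * (n : ℝ) ^ d)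
    (hXm : ∀ n k, Measurable[(countingSigma (cell m t k)).comap Φ] (X n k))
    (hX : ∀ n k, MemLp (X n k) 2 P) (hX2 : ∀ n k, ∫ ω, X n k ω ^ 2 ∂P ≤ Λ) :
    ∀ᵐ ω ∂P, Tendsto (fun n : ℕ => ((n : ℝ) ^ d)⁻¹ *
      (∑ k ∈ I n, X n k ω - ∑ k ∈ I n, ∫ ω, X n k ω ∂P)) atTop (𝓝 0) := by
  obtain ⟨C, γ, hC, hγ, hcov⟩ := exists_abs_covariance_cell_le hmix hm t Λ
  set Z := ∑' v : Fin d → ℤ, (1 + ‖v‖) ^ (-γ)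
  have hZ : 0 ≤ Z := tsum_nonneg fun v => by positivity
  -- Each cell has covariances with all others summing to at most `C * Z`, so the variance is of the
  -- order of the number of cells rather than its square.
  have hvar : ∀ n, Var[∑ k ∈ I n, X n k; P] ≤ C * Z * (K * (n : ℝ) ^ d) := by
    intro n
    rw [variance_sum' fun k _ => hX n k]
    calc ∑ k ∈ I n, ∑ l ∈ I n, cov[X n k, X n l; P] ≤ ∑ k ∈ I n, C * Z := by
          refine Finset.sum_le_sum fun k _ => ?_
          calc ∑ l ∈ I n, cov[X n k, X n l; P] ≤ ∑ l ∈ I n, C * (1 + ‖l - k‖) ^ (-γ) := by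
                refine Finset.sum_le_sum fun l _ => ?_
                rw [covariance_eq_sub (hX n k) (hX n l)]
                exact (le_abs_self _).trans (hcov k l _ _ (hXm n k) (hXm n l) (hX n k) (hX n l)
                  (hX2 n k) (hX2 n l))
            _ ≤ C * Z := by
                rw [← Finset.mul_sum]
                gcongr
                exact sum_one_add_norm_sub_rpow_neg_le hγ _ _
      _ = C * Z * (I n).card := by rw [Finset.sum_const, nsmul_eq_mul, mul_comm]
      _ ≤ _ := by gcongr; exact hI n
  have hS : ∀ n, MemLp (∑ k ∈ I n, X n k) 2 P := fun n => memLp_finsetSum' _ fun k _ => hX n k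
  have hK : 0 ≤ K := by
    have := hI 1
    simp only [Nat.cast_one, one_pow, mul_one] at this
    exact (Nat.cast_nonneg _).trans this
  have hmean : ∀ n, ∑ k ∈ I n, ∫ ω, X n k ω ∂P = ∫ ω, (∑ k ∈ I n, X n k) ω ∂P := by
    intro n
    simp only [Finset.sum_apply]
    rw [integral_finsetSum _ fun k _ => (hX n k).integrable one_le_two]
  have hmeas : ∀ n : ℕ, AEMeasurable (fun ω => ((n : ℝ) ^ d)⁻¹ *
      (∑ k ∈ I n, X n k ω - ∑ k ∈ I n, ∫ ω, X n k ω ∂P)) P := by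
    intro n
    have := ((hS n).aemeasurable.sub_const (∑ k ∈ I n, ∫ ω, X n k ω ∂P)).const_mul ((n : ℝ) ^ d)⁻¹
    simpa only [Finset.sum_apply] using this
  refine ae_tendsto_zero_of_lintegral_sq_le (a := fun n => C * Z * K * ((n : ℝ) ^ d)⁻¹) hmeas ?_
    (fun n => by positivity) fun n => ?_
  -- The normalised variance is of order `n^(-d)`; this is where `d > 1` enters.
  · exact (Real.summable_nat_pow_inv.2 hd).mul_left _
  · have h1 : ∫⁻ ω, ENNReal.ofReal ((((n : ℝ) ^ d)⁻¹ *
        (∑ k ∈ I n, X n k ω - ∑ k ∈ I n, ∫ ω, X n k ω ∂P)) ^ 2) ∂P =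
        ENNReal.ofReal ((((n : ℝ) ^ d)⁻¹) ^ 2 * Var[∑ k ∈ I n, X n k; P]) := by
      rw [variance_eq_integral (hS n).aemeasurable, ← integral_const_mul,
        ofReal_integral_eq_lintegral_ofReal]
      · simp only [hmean, mul_pow, Finset.sum_apply]
      · exact (((hS n).sub (memLp_const _)).integrable_sq).const_mul _
      · exact Eventually.of_forall fun ω => by positivity
    rw [h1]
    apply ENNReal.ofReal_le_ofReal
    refine (mul_le_mul_of_nonneg_left (hvar n) (by positivity)).trans (le_of_eq ?_)
    rcases Nat.eq_zero_or_pos n with rfl | hn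
    · have : d ≠ 0 := by omega
      simp [this]
    · have : (0 : ℝ) < n := by exact_mod_cast hn
      field_simp

end LawOfLargeNumbers

/-! ### Counting variables, their moments and the intensity. -/

section Counting

variable {d : ℕ} {Ω : Type*} [MeasurableSpace Ω] {P : Measure Ω}
  {Φ : Ω → Set (Space d)} {ρ : Ω → Space d → ℝ}

/-- The number of points of a configuration in `A`, as a real number. -/
noncomputable def cnt (S A : Set (Space d)) : ℝ := ((S ∩ A).ncard : ℝ)

theorem cnt_nonneg (S A : Set (Space d)) : 0 ≤ cnt S A := Nat.cast_nonneg _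

theorem cnt_mono {S A B : Set (Space d)} (hAB : A ⊆ B) (hB : (S ∩ B).Finite) :
    cnt S A ≤ cnt S B :=
  Nat.cast_le.2 (ncard_le_ncard (inter_subset_inter_right _ hAB) hB)

theorem measurable_cnt_comap {Ω : Type*} {Φ : Ω → Set (Space d)} {K A : Set (Space d)} (hA : MeasurableSet A) (hAK : A ⊆ K) :
    Measurable[(countingSigma K).comap Φ] fun ω => cnt (Φ ω) A := by
  have h1 : Measurable[countingSigma K] fun S : Set (Space d) => (S ∩ A).encard := by
    have h2 : MeasurableSpace.comap (fun S : Set (Space d) => (S ∩ A).encard) ⊤ ≤ countingSigma K :=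
      le_iSup (fun B : {B : Set (Space d) // MeasurableSet B ∧ B ⊆ K} =>
        MeasurableSpace.comap (fun S => (S ∩ B.1).encard) (⊤ : MeasurableSpace ℕ∞)) ⟨A, hA, hAK⟩
    exact (measurable_iff_comap_le.2 le_rfl).mono h2 le_rfl
  have h3 : Measurable fun x : ℕ∞ => ((x.toNat : ℕ) : ℝ) := Measurable.of_discrete
  exact h3.comp (h1.comp (comap_measurable Φ))

namespace IsMarkedPointProcess

theorem measurable_encard (hΦ : IsMarkedPointProcess Φ ρ) {A : Set (Space d)} (hA : MeasurableSet A) :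
    Measurable fun ω => (Φ ω ∩ A).encard := by
  simpa using hΦ.measurable_count A hA univ MeasurableSet.univ

theorem measurable_cnt (hΦ : IsMarkedPointProcess Φ ρ) {A : Set (Space d)} (hA : MeasurableSet A) :
    Measurable fun ω => cnt (Φ ω) A := by
  have h3 : Measurable fun x : ℕ∞ => ((x.toNat : ℕ) : ℝ) := Measurable.of_discrete
  exact h3.comp (hΦ.measurable_encard hA)

theorem comap_le (hΦ : IsMarkedPointProcess Φ ρ) : (countingSigma univ).comap Φ ≤ (inferInstance : MeasurableSpace Ω) := by
  rw [countingSigma, MeasurableSpace.comap_iSup]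
  refine iSup_le fun B => ?_
  rw [MeasurableSpace.comap_comp]
  exact measurable_iff_comap_le.1 (hΦ.measurable_encard B.2.1)

theorem encard_eq_ofReal_cnt (hΦ : IsMarkedPointProcess Φ ρ) {A : Set (Space d)} (hA : Bornology.IsBounded A) (ω : Ω) :
    ((Φ ω ∩ A).encard : ℝ≥0∞) = ENNReal.ofReal (cnt (Φ ω) A) := by
  rw [cnt, ENNReal.ofReal_natCast, ← (hΦ.locallyFinite ω A hA).cast_ncard_eq]
  rfl

theorem countable (hΦ : IsMarkedPointProcess Φ ρ) (ω : Ω) : (Φ ω).Countable := by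
  have : Φ ω = ⋃ n : ℕ, Φ ω ∩ Metric.ball 0 n := by
    rw [← inter_iUnion, Metric.iUnion_ball_nat, inter_univ]
  rw [this]
  exact countable_iUnion fun n => (hΦ.locallyFinite ω _ Metric.isBounded_ball).countable

/-- The intensity measure of the centres. -/
theorem exists_intensity (hΦ : IsMarkedPointProcess Φ ρ) (P : Measure Ω) : ∃ μ : Measure (Space d), ∀ A, MeasurableSet A →
    μ A = ∫⁻ ω, ((Φ ω ∩ A).encard : ℝ≥0∞) ∂P := by
  have hcount : ∀ ω A, MeasurableSet A → ((Φ ω ∩ A).encard : ℝ≥0∞) = Measure.count (Φ ω ∩ A) :=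
    fun ω A hA => (Measure.count_apply ((hΦ.countable ω).measurableSet.inter hA)).symm
  refine ⟨Measure.ofMeasurable (fun A _ => ∫⁻ ω, ((Φ ω ∩ A).encard : ℝ≥0∞) ∂P) (by simp) ?_,
    fun A hA => Measure.ofMeasurable_apply A hA⟩
  intro f hf hdisj
  rw [← lintegral_tsum fun i => ?_]
  · refine lintegral_congr fun ω => ?_
    rw [hcount ω _ (MeasurableSet.iUnion hf), inter_iUnion, measure_iUnion]
    · exact tsum_congr fun i => (hcount ω _ (hf i)).symm
    · exact fun i j hij => (hdisj hij).mono inter_subset_right inter_subset_right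
    · exact fun i => (hΦ.countable ω).measurableSet.inter (hf i)
  · exact (measurable_from_top.comp (hΦ.measurable_encard (hf i))).aemeasurable

end IsMarkedPointProcess

theorem IsStationary.map_encard_image_add (hst : IsStationary P Φ) (hΦ : IsMarkedPointProcess Φ ρ)
    {A : Set (Space d)} (hA : MeasurableSet A) (x : Space d) :
    P.map (fun ω => (Φ ω ∩ ((fun z => z + x) '' A)).encard) =
      P.map (fun ω => (Φ ω ∩ A).encard) := by
  have hA' : MeasurableSet ((fun z => z + x) '' A) :=
    (MeasurableEquiv.addRight x).measurableSet_image.2 hA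
  ext s hs
  rw [Measure.map_apply (hΦ.measurable_encard hA') hs, Measure.map_apply (hΦ.measurable_encard hA) hs]
  have h1 := hst x {S | (S ∩ ((fun z => z + x) '' A)).encard ∈ s} (by
    have h2 : MeasurableSpace.comap (fun S : Set (Space d) => (S ∩ ((fun z => z + x) '' A)).encard) ⊤
        ≤ countingSigma univ :=
      le_iSup (fun B : {B : Set (Space d) // MeasurableSet B ∧ B ⊆ univ} =>
        MeasurableSpace.comap (fun S => (S ∩ B.1).encard) (⊤ : MeasurableSpace ℕ∞))
        ⟨_, hA', subset_univ _⟩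
    exact h2 _ ⟨s, trivial, rfl⟩)
  simp only [mem_ofPred_eq] at h1
  refine Eq.trans h1.symm (congrArg P ?_)
  ext ω
  simp only [mem_ofPred_eq, mem_preimage]
  rw [← image_inter (add_left_injective x), (add_left_injective x).encard_image]

theorem IsStationary.integral_comp_cnt_image_add (hst : IsStationary P Φ)
    (hΦ : IsMarkedPointProcess Φ ρ) {A : Set (Space d)} (hA : MeasurableSet A) (x : Space d)
    (f : ℝ → ℝ) :
    ∫ ω, f (cnt (Φ ω) ((fun z => z + x) '' A)) ∂P = ∫ ω, f (cnt (Φ ω) A) ∂P := by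
  have hA' : MeasurableSet ((fun z => z + x) '' A) :=
    (MeasurableEquiv.addRight x).measurableSet_image.2 hA
  have h3 : Measurable fun y : ℕ∞ => f ((y.toNat : ℕ) : ℝ) := Measurable.of_discrete
  have h4 : ∀ B : Set (Space d), MeasurableSet B → ∫ ω, f (cnt (Φ ω) B) ∂P =
      ∫ y, f ((ENat.toNat y : ℕ) : ℝ) ∂(P.map fun ω => (Φ ω ∩ B).encard) := fun B hB =>
    (integral_map (hΦ.measurable_encard hB).aemeasurable h3.aestronglyMeasurable).symm
  rw [h4 _ hA', h4 _ hA, hst.map_encard_image_add hΦ hA x]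

theorem unitCube_eq_box (q : Space d) : unitCube q = box (fun i => q i) (fun i => q i + 1) := rfl

theorem HasFiniteSecondMoment.exists_memLp (hsm : HasFiniteSecondMoment P Φ)
    (hΦ : IsMarkedPointProcess Φ ρ) : ∃ Λ : ℝ, 0 ≤ Λ ∧ ∀ (A : Set (Space d)) (q : Space d),
      MeasurableSet A → A ⊆ unitCube q →
        MemLp (fun ω => cnt (Φ ω) A) 2 P ∧ ∫ ω, cnt (Φ ω) A ^ 2 ∂P ≤ Λ := by
  obtain ⟨lam, hlam⟩ := hsm
  refine ⟨lam ^ 2, by positivity, fun A q hA hAq => ?_⟩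
  have hb : Bornology.IsBounded (unitCube q) := isBounded_box _ _
  have h1 : ∫⁻ ω, ENNReal.ofReal (cnt (Φ ω) A ^ 2) ∂P ≤ ENNReal.ofReal ((lam : ℝ) ^ 2) := by
    have h2 : ∫⁻ ω, ((Φ ω ∩ unitCube q).encard : ℝ≥0∞) ^ 2 ∂P ≤ (lam : ℝ≥0∞) ^ 2 := by
      have := ENNReal.rpow_le_rpow (hlam q) (by norm_num : (0 : ℝ) ≤ 2)
      rw [← ENNReal.rpow_mul] at this
      simpa using this
    rw [ENNReal.ofReal_pow (by positivity), ENNReal.ofReal_coe_nnreal]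
    refine le_trans (lintegral_mono fun ω => ?_) h2
    rw [hΦ.encard_eq_ofReal_cnt hb, ← ENNReal.ofReal_pow (cnt_nonneg _ _)]
    exact ENNReal.ofReal_le_ofReal (pow_le_pow_left₀ (cnt_nonneg _ _)
      (cnt_mono hAq (hΦ.locallyFinite ω _ hb)) _)
  have hm := hΦ.measurable_cnt hA
  have hint : Integrable (fun ω => cnt (Φ ω) A ^ 2) P := by
    refine ⟨(hm.pow_const 2).aestronglyMeasurable, ?_⟩
    rw [hasFiniteIntegral_iff_ofReal (Eventually.of_forall fun ω => sq_nonneg _)]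
    exact h1.trans_lt ENNReal.ofReal_lt_top
  refine ⟨(memLp_two_iff_integrable_sq hm.aestronglyMeasurable).2 hint, ?_⟩
  rw [integral_eq_lintegral_of_nonneg_ae (Eventually.of_forall fun ω => sq_nonneg _)
    (hm.pow_const 2).aestronglyMeasurable]
  exact ENNReal.toReal_le_of_le_ofReal (by positivity) h1

/-- The index of the lattice cell of side `1 / m` that contains a point. -/
noncomputable def cellIndex (m : ℕ) (z : Space d) : Fin d → ℤ := fun i => ⌊(m : ℝ) * z i⌋

theorem mem_cell_one_iff {m : ℕ} (hm : 0 < m) {z : Space d} {k : Fin d → ℤ} :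
    z ∈ cell m 1 k ↔ cellIndex m z = k := by
  have hm0 : (0 : ℝ) < m := by exact_mod_cast hm
  rw [funext_iff]
  refine forall_congr' fun i => ?_
  rw [cellIndex, Int.floor_eq_iff, div_le_iff₀ hm0, lt_div_iff₀ hm0, mul_comm (z i), Nat.cast_one]

/-- The lattice points in `[-M, M)^d`. -/
noncomputable def latticeBox (d M : ℕ) : Finset (Fin d → ℤ) :=
  Fintype.piFinset fun _ => Finset.Ico (-(M : ℤ)) M

theorem card_latticeBox (d M : ℕ) : (latticeBox d M).card = (2 * M) ^ d := by
  have h : ((M : ℤ) + M).toNat = M + M := by omega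
  simp [latticeBox, Fintype.card_piFinset, two_mul, h]

/-- The cube `[-L, L)^d`. -/
def cube (d : ℕ) (L : ℝ) : Set (Space d) := box (fun _ => -L) (fun _ => L)

theorem cellIndex_mem_latticeBox {m M : ℕ} {L : ℝ} (hm : 0 < m) (hM : m * L ≤ M) {z : Space d}
    (hz : z ∈ cube d L) : cellIndex m z ∈ latticeBox d M := by
  have hm0 : (0 : ℝ) < m := by exact_mod_cast hm
  refine Fintype.mem_piFinset.2 fun i => Finset.mem_Ico.2 ⟨?_, ?_⟩
  · rw [cellIndex, Int.le_floor]
    push_cast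
    nlinarith [(hz i).1]
  · rw [cellIndex, Int.floor_lt]
    push_cast
    nlinarith [(hz i).2]

theorem cnt_eq_sum_cells {S A : Set (Space d)} {L : ℝ} {M : ℕ} (hfin : (S ∩ A).Finite)
    (hA : A ⊆ cube d L) (hM : L ≤ M) :
    cnt S A = ∑ k ∈ latticeBox d M, cnt S (A ∩ cell 1 1 k) := by
  classical
  rw [cnt, ncard_eq_toFinset_card _ hfin, Finset.card_eq_sum_card_fiberwise (f := cellIndex 1)
    (t := latticeBox d M)]
  · push_cast
    refine Finset.sum_congr rfl fun k _ => ?_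
    rw [cnt, ← ncard_coe_finset]
    congr 2
    ext z
    simp only [Finset.coe_filter, Finite.mem_toFinset, mem_ofPred_eq, mem_inter_iff,
      mem_cell_one_iff one_pos, and_assoc]
  · intro z hz
    exact cellIndex_mem_latticeBox one_pos (by simpa using hM) (hA ((hfin.mem_toFinset.1 hz).2))

theorem exists_subset_cube {A : Set (Space d)} (hA : Bornology.IsBounded A) :
    ∃ L : ℕ, 0 < L ∧ A ⊆ cube d L := by
  obtain ⟨R, hR⟩ := hA.exists_norm_le
  refine ⟨⌈|R|⌉₊ + 1, Nat.succ_pos _, fun z hz i => ?_⟩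
  have h1 : |z i| ≤ R := (PiLp.norm_apply_le z i).trans (hR z hz)
  have h2 := Nat.le_ceil |R|
  have h3 := abs_le.1 (h1.trans (le_abs_self R))
  push_cast
  constructor <;> linarith

theorem cell_one_one_eq (k : Fin d → ℤ) :
    cell 1 1 k = unitCube (WithLp.toLp 2 fun i => (k i : ℝ)) := by
  rw [cell, unitCube_eq_box]
  simp

theorem HasFiniteSecondMoment.memLp_cnt (hsm : HasFiniteSecondMoment P Φ)
    (hΦ : IsMarkedPointProcess Φ ρ) {A : Set (Space d)} (hA : MeasurableSet A)
    (hb : Bornology.IsBounded A) : MemLp (fun ω => cnt (Φ ω) A) 2 P := by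
  obtain ⟨Λ, -, hΛ⟩ := hsm.exists_memLp hΦ
  obtain ⟨L, -, hL⟩ := exists_subset_cube hb
  have h1 : (fun ω => cnt (Φ ω) A) =
      fun ω => ∑ k ∈ latticeBox d L, cnt (Φ ω) (A ∩ cell 1 1 k) :=
    funext fun ω => cnt_eq_sum_cells (hΦ.locallyFinite ω A hb) hL le_rfl
  rw [h1]
  refine memLp_finsetSum _ fun k _ => (hΛ _ (WithLp.toLp 2 fun i => (k i : ℝ))
    (hA.inter (measurableSet_box _ _)) ?_).1
  exact inter_subset_right.trans (cell_one_one_eq k).subset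

variable [IsProbabilityMeasure P]

/-- The mean number of centres in a bounded set is proportional to the volume. -/
theorem integral_cnt_eq (hst : IsStationary P Φ) (hsm : HasFiniteSecondMoment P Φ)
    (hΦ : IsMarkedPointProcess Φ ρ) {A : Set (Space d)} (hA : MeasurableSet A)
    (hb : Bornology.IsBounded A) (q : Space d) :
    ∫ ω, cnt (Φ ω) A ∂P = meanCount P Φ (unitCube q) * volume.real A := by
  obtain ⟨μ, hμ⟩ := hΦ.exists_intensity P
  have hμb : ∀ B : Set (Space d), MeasurableSet B → Bornology.IsBounded B →
      μ B = ENNReal.ofReal (∫ ω, cnt (Φ ω) B ∂P) := by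
    intro B hB hBb
    rw [hμ B hB, ofReal_integral_eq_lintegral_ofReal
      ((hsm.memLp_cnt hΦ hB hBb).integrable one_le_two) (Eventually.of_forall fun ω => cnt_nonneg _ _)]
    exact lintegral_congr fun ω => hΦ.encard_eq_ofReal_cnt hBb ω
  have hfin : IsFiniteMeasureOnCompacts μ := ⟨fun K hK => by
    rw [hμb K hK.measurableSet hK.isBounded]; exact ENNReal.ofReal_lt_top⟩
  -- Stationarity makes the intensity translation invariant, so uniqueness of Haar measure makes it
  -- a multiple of Lebesgue measure; the unit cube fixes the multiple.
  have hinv : μ.IsAddLeftInvariant := by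
    refine (forall_measure_preimage_add_iff μ).1 fun x B hB => ?_
    have h1 : (fun h => x + h) ⁻¹' B = (fun z => z + -x) '' B := by
      ext z
      simp only [mem_preimage, mem_image]
      exact ⟨fun h => ⟨x + z, h, by abel⟩, by rintro ⟨y, hy, rfl⟩; simpa using hy⟩
    have h3 : Measurable fun y : ℕ∞ => (y : ℝ≥0∞) := measurable_from_top
    have h4 : ∀ B : Set (Space d), MeasurableSet B → μ B =
        ∫⁻ y, (y : ℝ≥0∞) ∂(P.map fun ω => (Φ ω ∩ B).encard) := fun B hB => by
      rw [lintegral_map h3 (hΦ.measurable_encard hB), hμ B hB]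
    have hA' : MeasurableSet ((fun z => z + -x) '' B) :=
      (MeasurableEquiv.addRight (-x)).measurableSet_image.2 hB
    rw [h1, h4 _ hA', h4 _ hB, hst.map_encard_image_add hΦ hB]
  have hsmul := Measure.isAddLeftInvariant_eq_smul μ (volume : Measure (Space d))
  set c := μ.addHaarScalarFactor (volume : Measure (Space d))
  have hval : ∀ B : Set (Space d), MeasurableSet B → Bornology.IsBounded B →
      ∫ ω, cnt (Φ ω) B ∂P = c * volume.real B := by
    intro B hB hBb
    have h1 := hμb B hB hBb
    rw [hsmul, Measure.smul_apply] at h1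
    have h2 := congrArg ENNReal.toReal h1
    rw [ENNReal.toReal_ofReal (integral_nonneg fun ω => cnt_nonneg _ _), ENNReal.toReal_smul] at h2
    rw [← h2]
    rfl
  have hvol : volume.real (unitCube q) = 1 := by
    have h1 : unitCube q = (MeasurableEquiv.toLp 2 (Fin d → ℝ)).symm ⁻¹'
        (Set.pi univ fun i => Ico (q i) (q i + 1)) := by
      ext y; simp [unitCube]
    rw [measureReal_def, h1, (EuclideanSpace.volume_preserving_symm_measurableEquiv_toLp
      (Fin d)).measure_preimage_equiv, Real.volume_pi_Ico]
    simp
  have hq : meanCount P Φ (unitCube q) = c := by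
    have := hval (unitCube q) (measurableSet_box _ _) (isBounded_box _ _)
    rw [hvol, mul_one] at this
    exact this
  rw [hval A hA hb, hq]

end Counting

/-! ### Density of the centres in the dilated domain. -/

section CountingAsymptotics

variable {d : ℕ} {Ω : Type*} [MeasurableSpace Ω] {P : Measure Ω} [IsProbabilityMeasure P]
  {Φ : Ω → Set (Space d)} {ρ : Ω → Space d → ℝ}

/-- Cutting the set into unit cells writes the count as a sum of local variables with uniformly
bounded second moments, to which the mixing law applies. -/
theorem ae_tendsto_cnt_sub_integral (hd : 1 < d) (hΦ : IsMarkedPointProcess Φ ρ)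
    (hsm : HasFiniteSecondMoment P Φ) (hmix : IsStronglyMixing P Φ) (A : ℕ → Set (Space d)) (L : ℕ)
    (hA : ∀ n, MeasurableSet (A n)) (hAL : ∀ n, A n ⊆ cube d (L * n : ℕ)) :
    ∀ᵐ ω ∂P, Tendsto (fun n : ℕ => ((n : ℝ) ^ d)⁻¹ *
      (cnt (Φ ω) (A n) - ∫ ω, cnt (Φ ω) (A n) ∂P)) atTop (𝓝 0) := by
  obtain ⟨Λ, -, hΛ⟩ := hsm.exists_memLp hΦ
  have hcell : ∀ n k, MeasurableSet (A n ∩ cell 1 1 k) := fun n k =>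
    (hA n).inter (measurableSet_box _ _)
  have hsub : ∀ n k, A n ∩ cell 1 1 k ⊆ unitCube (WithLp.toLp 2 fun i => (k i : ℝ)) := fun n k =>
    inter_subset_right.trans (cell_one_one_eq k).subset
  have hb : ∀ n, Bornology.IsBounded (A n) := fun n => (isBounded_box _ _).subset (hAL n)
  have h := ae_tendsto_average_of_mixing hd hmix one_pos 1 Λ ((2 * L) ^ d)
    (fun n k ω => cnt (Φ ω) (A n ∩ cell 1 1 k)) (fun n => latticeBox d (L * n))
    (fun n => by rw [card_latticeBox]; push_cast; rw [← mul_pow, mul_assoc])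
    (fun n k => measurable_cnt_comap (hcell n k) inter_subset_right)
    (fun n k => (hΛ _ _ (hcell n k) (hsub n k)).1) (fun n k => (hΛ _ _ (hcell n k) (hsub n k)).2)
  have hsum : ∀ n ω, ∑ k ∈ latticeBox d (L * n), cnt (Φ ω) (A n ∩ cell 1 1 k) = cnt (Φ ω) (A n) :=
    fun n ω => (cnt_eq_sum_cells (hΦ.locallyFinite ω _ (hb n)) (hAL n) le_rfl).symm
  filter_upwards [h] with ω hω
  refine hω.congr fun n => ?_
  rw [hsum, ← integral_finsetSum _ fun k _ =>
    (hΛ _ _ (hcell n k) (hsub n k)).1.integrable one_le_two]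
  simp only [hsum]

theorem volume_real_dilate {ε : ℝ} (hε : 0 < ε) (D : Set (Space d)) :
    volume.real (dilate ε D) = (ε ^ d)⁻¹ * volume.real D := by
  have h1 : dilate ε D = (fun x => ε • x) ⁻¹' D := rfl
  rw [measureReal_def, h1, Measure.addHaar_preimage_smul _ hε.ne', finrank_euclideanSpace_fin,
    ENNReal.toReal_mul, ENNReal.toReal_ofReal (abs_nonneg _), abs_of_pos (by positivity)]
  rfl

theorem measurableSet_dilate {ε : ℝ} {D : Set (Space d)} (hD : MeasurableSet D) :
    MeasurableSet (dilate ε D) :=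
  (measurable_const_smul ε) hD

theorem dilate_subset_cube {D : Set (Space d)} {L ε M : ℝ} (hL : D ⊆ cube d L) (hε : 0 < ε)
    (hM : L ≤ ε * M) : dilate ε D ⊆ cube d M := by
  intro x hx i
  have h1 := hL hx i
  simp only [PiLp.smul_apply, smul_eq_mul] at h1
  exact ⟨by nlinarith, by nlinarith⟩

/-- Star-shapedness makes the dilated domains monotone in `ε`, which allows interpolation between
integer scales. -/
theorem dilate_antitone {D : Set (Space d)} (hD : StarConvex ℝ 0 D) {ε ε' : ℝ} (hε : 0 ≤ ε)
    (h : ε ≤ ε') (hε' : 0 < ε') : dilate ε' D ⊆ dilate ε D := by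
  intro x hx
  have h1 := hD.smul_mem (show ε' • x ∈ D from hx) (div_nonneg hε hε'.le) ((div_le_one hε').2 h)
  rwa [smul_smul, div_mul_cancel₀ _ hε'.ne'] at h1

theorem isBounded_dilate {D : Set (Space d)} (hD : Bornology.IsBounded D) {ε : ℝ} (hε : 0 < ε) :
    Bornology.IsBounded (dilate ε D) := by
  obtain ⟨L, -, hL⟩ := exists_subset_cube hD
  refine (isBounded_box _ _).subset (dilate_subset_cube (M := L / ε) hL hε (le_of_eq ?_))
  field_simp

/-- The number of centres in the dilated domain grows like its volume. -/
theorem ae_tendsto_ncard_dilate (hd : 1 < d) {D : Set (Space d)} (hDm : MeasurableSet D)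
    (hDb : Bornology.IsBounded D) (hDs : StarConvex ℝ 0 D) (hΦ : IsMarkedPointProcess Φ ρ)
    (hst : IsStationary P Φ) (hsm : HasFiniteSecondMoment P Φ) (hmix : IsStronglyMixing P Φ) :
    ∀ᵐ ω ∂P, ∀ q : Space d, Tendsto (fun ε => ε ^ d * ((Φ ω ∩ dilate ε D).ncard : ℝ)) (𝓝[>] 0)
      (𝓝 (meanCount P Φ (unitCube q) * volume.real D)) := by
  obtain ⟨L, -, hL⟩ := exists_subset_cube hDb
  have hsub : ∀ n : ℕ, 0 < n → dilate (n : ℝ)⁻¹ D ⊆ cube d (L * n : ℕ) := by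
    intro n hn
    have hn0 : (0 : ℝ) < n := by exact_mod_cast hn
    refine dilate_subset_cube hL (by positivity) (le_of_eq ?_)
    push_cast
    field_simp
  have h := ae_tendsto_cnt_sub_integral hd hΦ hsm hmix
    (fun n => dilate (n : ℝ)⁻¹ D ∩ cube d (L * n : ℕ)) L
    (fun n => (measurableSet_dilate hDm).inter (measurableSet_box _ _)) (fun n => inter_subset_right)
  filter_upwards [h] with ω hω q
  set ℓ := meanCount P Φ (unitCube q) * volume.real D with hℓ
  have hseq : Tendsto (fun n : ℕ => ((n : ℝ) ^ d)⁻¹ * cnt (Φ ω) (dilate (n : ℝ)⁻¹ D)) atTop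
      (𝓝 ℓ) := by
    have h1 := hω.add_const ℓ
    rw [zero_add] at h1
    refine h1.congr' ?_
    filter_upwards [eventually_gt_atTop 0] with n hn
    have hn0 : (0 : ℝ) < n := by exact_mod_cast hn
    rw [inter_eq_left.2 (hsub n hn), integral_cnt_eq hst hsm hΦ (measurableSet_dilate hDm)
      ((isBounded_box _ _).subset (hsub n hn)) q, volume_real_dilate (by positivity), hℓ, inv_pow, inv_inv]
    field_simp
    ring
  have hinv : Tendsto (fun ε : ℝ => ε⁻¹) (𝓝[>] 0) atTop := tendsto_inv_nhdsGT_zero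
  have hfl : Tendsto (fun ε : ℝ => ⌊ε⁻¹⌋₊) (𝓝[>] 0) atTop := tendsto_nat_floor_atTop.comp hinv
  have hid : Tendsto (fun ε : ℝ => ε) (𝓝[>] 0) (𝓝 0) := tendsto_id.mono_left nhdsWithin_le_nhds
  -- The count at `ε` is sandwiched between those at the integer scales `⌊1/ε⌋` and `⌊1/ε⌋ + 1`;
  -- both ratios to `1/ε` tend to `1`.
  have hlow : Tendsto (fun ε : ℝ => ε * ⌊ε⁻¹⌋₊) (𝓝[>] 0) (𝓝 1) := by
    have h1 := (tendsto_nat_floor_div_atTop (R := ℝ)).comp hinv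
    refine h1.congr fun ε => ?_
    simp only [Function.comp_apply, div_inv_eq_mul, mul_comm]
  have hup : Tendsto (fun ε : ℝ => ε * (⌊ε⁻¹⌋₊ + 1 : ℕ)) (𝓝[>] 0) (𝓝 1) := by
    have h1 := hlow.add hid
    rw [add_zero] at h1
    refine h1.congr fun ε => ?_
    push_cast
    ring
  have h1 := (hlow.pow d).mul (hseq.comp hfl)
  have h2 := (hup.pow d).mul (hseq.comp ((tendsto_add_atTop_nat 1).comp hfl))
  rw [one_pow, one_mul] at h1 h2
  refine tendsto_of_tendsto_of_tendsto_of_le_of_le' h1 h2 ?_ ?_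
  · filter_upwards [self_mem_nhdsWithin, hfl.eventually_gt_atTop 0] with ε hε hn
    have hε : 0 < ε := hε
    have hn0 : (0 : ℝ) < ⌊ε⁻¹⌋₊ := by exact_mod_cast hn
    simp only [Function.comp_apply]
    have h3 : cnt (Φ ω) (dilate (⌊ε⁻¹⌋₊ : ℝ)⁻¹ D) ≤ cnt (Φ ω) (dilate ε D) := by
      refine cnt_mono (dilate_antitone hDs hε.le ?_ (by positivity))
        (hΦ.locallyFinite ω _ (isBounded_dilate hDb hε))
      rw [le_inv_comm₀ hε hn0]
      exact Nat.floor_le (by positivity)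
    rw [mul_pow, mul_assoc, mul_inv_cancel_left₀ (by positivity)]
    exact mul_le_mul_of_nonneg_left h3 (by positivity)
  · filter_upwards [self_mem_nhdsWithin] with ε hε
    have hε : 0 < ε := hε
    have hn0 : (0 : ℝ) < (⌊ε⁻¹⌋₊ + 1 : ℕ) := by positivity
    simp only [Function.comp_apply]
    have h3 : cnt (Φ ω) (dilate ε D) ≤ cnt (Φ ω) (dilate ((⌊ε⁻¹⌋₊ + 1 : ℕ) : ℝ)⁻¹ D) := by
      refine cnt_mono (dilate_antitone hDs (by positivity) ?_ hε)
        (hΦ.locallyFinite ω _ (isBounded_dilate hDb (by positivity)))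
      rw [inv_le_comm₀ hn0 hε]
      push_cast
      exact (Nat.lt_floor_add_one _).le
    rw [mul_pow, mul_assoc, mul_inv_cancel_left₀ (by positivity)]
    exact mul_le_mul_of_nonneg_left h3 (by positivity)

end CountingAsymptotics

/-! ### Rarity of crowded centres. -/

section CrowdedCentres

variable {d : ℕ} {Ω : Type*} [MeasurableSpace Ω] {P : Measure Ω} [IsProbabilityMeasure P]
  {Φ : Ω → Set (Space d)} {ρ : Ω → Space d → ℝ}

/-- The identity, cut off below `2`. -/
noncomputable def multi (x : ℝ) : ℝ := if 2 ≤ x then x else 0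

theorem measurable_multi : Measurable multi :=
  Measurable.ite measurableSet_Ici measurable_id measurable_const

theorem multi_nonneg {x : ℝ} : 0 ≤ multi x := by
  rw [multi]; split_ifs <;> linarith

theorem multi_le {x : ℝ} (hx : 0 ≤ x) : multi x ≤ x := by
  rw [multi]; split_ifs <;> linarith

theorem mem_cell_iff {m t : ℕ} (hm : 0 < m) {z : Space d} {k : Fin d → ℤ} :
    z ∈ cell m t k ↔ ∀ i, (k i : ℝ) ≤ m * z i ∧ m * z i < k i + t := by
  have hm0 : (0 : ℝ) < m := by exact_mod_cast hm
  refine forall_congr' fun i => ?_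
  rw [div_le_iff₀ hm0, lt_div_iff₀ hm0, mul_comm (z i)]

theorem exists_mem_cell_two_of_cnt {S : Set (Space d)} {A : Set (Space d)}
    (h : multi (cnt S A) ≠ 0) : ∃ z ∈ S ∩ A, ∃ w ∈ S ∩ A, z ≠ w := by
  have h1 : 2 ≤ cnt S A := by
    by_contra hcon
    exact h (by rw [multi, if_neg hcon])
  have h2 : 1 < (S ∩ A).ncard := by
    have : 2 ≤ (S ∩ A).ncard := by rw [cnt] at h1; exact_mod_cast h1
    omega
  have hfin : (S ∩ A).Finite := finite_of_ncard_pos (by omega)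
  exact (one_lt_ncard hfin).1 h2

/-- Finitely many points have pairwise coordinate gaps bounded below, so no half-open cell of side
`2 / m` holds two of them once `m` is large. -/
theorem eventually_sum_multi_eq_zero {S : Set (Space d)} {A : Set (Space d)}
    (hfin : (S ∩ A).Finite) (I : ℕ → Finset (Fin d → ℤ))
    (hI : ∀ m, 0 < m → ∀ k ∈ I m, cell m 2 k ⊆ A) :
    ∀ᶠ m : ℕ in atTop, ∑ k ∈ I m, multi (cnt S (cell m 2 k)) = 0 := by
  have h1 : ∀ᶠ m : ℕ in atTop, ∀ z ∈ S ∩ A, ∀ w ∈ S ∩ A, z ≠ w →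
      ∀ k, z ∈ cell m 2 k → w ∉ cell m 2 k := by
    refine (eventually_all_finite hfin).2 fun z _ => (eventually_all_finite hfin).2 fun w _ => ?_
    by_cases hzw : z = w
    · exact Eventually.of_forall fun m h => absurd hzw h
    · obtain ⟨i, hi⟩ : ∃ i, z i ≠ w i := by
        by_contra! hcon
        exact hzw (by ext i; exact hcon i)
      have hpos : 0 < |z i - w i| := abs_pos.2 (sub_ne_zero.2 hi)
      have h2 : Tendsto (fun m : ℕ => (m : ℝ) * |z i - w i|) atTop atTop :=
        tendsto_natCast_atTop_atTop.atTop_mul_const hpos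
      filter_upwards [h2.eventually_ge_atTop 2, eventually_gt_atTop 0] with m h3 hm _ k hz hw
      have h4 := (mem_cell_iff hm).1 hz i
      have h5 := (mem_cell_iff hm).1 hw i
      push_cast at h4 h5
      rcases abs_cases (z i - w i) with h6 | h6 <;> rw [h6.1] at h3 <;> nlinarith
  filter_upwards [h1, eventually_gt_atTop 0] with m hm hm0
  refine Finset.sum_eq_zero fun k hk => ?_
  by_contra hcon
  obtain ⟨z, hz, w, hw, hzw⟩ := exists_mem_cell_two_of_cnt hcon
  exact hm z ⟨hz.1, hI m hm0 k hk hz.2⟩ w ⟨hw.1, hI m hm0 k hk hw.2⟩ hzw k hz.2 hw.2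

theorem sum_cnt_cell_two_le {S : Set (Space d)} {A : Set (Space d)}
    (hfin : (S ∩ A).Finite) {m : ℕ} (hm : 0 < m) (I : Finset (Fin d → ℤ))
    (hI : ∀ k ∈ I, cell m 2 k ⊆ A) :
    ∑ k ∈ I, cnt S (cell m 2 k) ≤ 2 ^ d * cnt S A := by
  classical
  have h1 : ∀ k ∈ I, (S ∩ cell m 2 k).ncard = (hfin.toFinset.filter fun z => z ∈ cell m 2 k).card := by
    intro k hk
    rw [← ncard_coe_finset]
    congr 1
    ext z
    simp only [Finset.coe_filter, Finite.mem_toFinset, mem_ofPred_eq, mem_inter_iff]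
    exact ⟨fun h => ⟨⟨h.1, hI k hk h.2⟩, h.2⟩, fun h => ⟨h.1.1, h.2⟩⟩
  have h2 : ∀ z ∈ hfin.toFinset, (I.filter fun k => z ∈ cell m 2 k).card ≤ 2 ^ d := by
    intro z _
    -- Cells of side `2 / m` on a grid of mesh `1 / m` overlap: each coordinate admits two possible
    -- indices, hence the factor `2 ^ d`.
    have h3 : (I.filter fun k => z ∈ cell m 2 k) ⊆
        Fintype.piFinset fun i => Finset.Icc (cellIndex m z i - 1) (cellIndex m z i) := by
      intro k hk
      have h4 := (mem_cell_iff hm).1 (Finset.mem_filter.1 hk).2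
      refine Fintype.mem_piFinset.2 fun i => Finset.mem_Icc.2 ⟨?_, ?_⟩
      · have h5 : cellIndex m z i < k i + 2 := by
          rw [cellIndex, Int.floor_lt]
          push_cast
          exact (h4 i).2
        omega
      · rw [cellIndex, Int.le_floor]
        exact (h4 i).1
    refine (Finset.card_le_card h3).trans (le_of_eq ?_)
    rw [Fintype.card_piFinset]
    simp
  have h7 : ∑ k ∈ I, (S ∩ cell m 2 k).ncard ≤ 2 ^ d * (S ∩ A).ncard := by
    rw [Finset.sum_congr rfl h1]
    have h8 := Finset.sum_card_bipartiteAbove_eq_sum_card_bipartiteBelow (s := I)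
      (t := hfin.toFinset) (fun k z => z ∈ cell m 2 k)
    simp only [Finset.bipartiteAbove, Finset.bipartiteBelow] at h8
    rw [h8, ncard_eq_toFinset_card _ hfin, mul_comm, ← smul_eq_mul, ← Finset.sum_const]
    exact Finset.sum_le_sum h2
  simp only [cnt]
  exact_mod_cast h7

/-- By stationarity the quantity is the mean of a sum over the `m^d` cells with lower corners in
`[0,1)^d`. That sum vanishes eventually for each realisation and is dominated by a multiple of the
count in a fixed cube. -/
theorem tendsto_pow_mul_integral_multi (hΦ : IsMarkedPointProcess Φ ρ)
    (hst : IsStationary P Φ) (hsm : HasFiniteSecondMoment P Φ) :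
    Tendsto (fun m : ℕ => (m : ℝ) ^ d * ∫ ω, multi (cnt (Φ ω) (cell m 2 0)) ∂P) atTop (𝓝 0) := by
  set I : ℕ → Finset (Fin d → ℤ) := fun m => Fintype.piFinset fun _ => Finset.Ico 0 (m : ℤ) with hI
  set A : Set (Space d) := box (fun _ => 0) (fun _ => 2) with hA
  have hAb : Bornology.IsBounded A := isBounded_box _ _
  have hIA : ∀ m, 0 < m → ∀ k ∈ I m, cell m 2 k ⊆ A := by
    intro m hm k hk z hz i
    have h1 := Finset.mem_Ico.1 (Fintype.mem_piFinset.1 hk i)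
    have h2 := (mem_cell_iff hm).1 hz i
    have hm0 : (0 : ℝ) < m := by exact_mod_cast hm
    have hm1 : (1 : ℝ) ≤ m := by exact_mod_cast hm
    have h3 : (0 : ℝ) ≤ k i := by exact_mod_cast h1.1
    have h4 : (k i : ℝ) + 1 ≤ m := by exact_mod_cast h1.2
    push_cast at h2
    exact ⟨by by_contra! h; nlinarith, by by_contra! h; nlinarith⟩
  have hm : ∀ m k, Measurable fun ω => multi (cnt (Φ ω) (cell m 2 k)) := fun m k =>
    measurable_multi.comp (hΦ.measurable_cnt (measurableSet_box _ _))
  have hint : ∀ m k, Integrable (fun ω => multi (cnt (Φ ω) (cell m 2 k))) P := fun m k =>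
    ((hsm.memLp_cnt hΦ (measurableSet_box _ _) (isBounded_box _ _)).integrable one_le_two).mono'
      (hm m k).aestronglyMeasurable (Eventually.of_forall fun ω => by
        rw [Real.norm_eq_abs, abs_of_nonneg multi_nonneg]
        exact multi_le (cnt_nonneg _ _))
  have hlim : Tendsto (fun m => ∫ ω, ∑ k ∈ I m, multi (cnt (Φ ω) (cell m 2 k)) ∂P) atTop
      (𝓝 (∫ _, (0 : ℝ) ∂P)) := by
    refine tendsto_integral_filter_of_dominated_convergence (fun ω => 2 ^ d * cnt (Φ ω) A) ?_ ?_ ?_ ?_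
    · exact Eventually.of_forall fun m =>
        (Finset.measurable_sum _ fun k _ => hm m k).aestronglyMeasurable
    · filter_upwards [eventually_gt_atTop 0] with m hm0
      refine Eventually.of_forall fun ω => ?_
      rw [Real.norm_eq_abs, abs_of_nonneg (Finset.sum_nonneg fun k _ => multi_nonneg)]
      exact (Finset.sum_le_sum fun k _ => multi_le (cnt_nonneg _ _)).trans
        (sum_cnt_cell_two_le (hΦ.locallyFinite ω A hAb) hm0 (I m) (hIA m hm0))
    · exact ((hsm.memLp_cnt hΦ (measurableSet_box _ _) hAb).integrable one_le_two).const_mul _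
    · exact Eventually.of_forall fun ω => tendsto_const_nhds.congr' <|
        (eventually_sum_multi_eq_zero (hΦ.locallyFinite ω A hAb) I hIA).mono fun m h => h.symm
  rw [integral_zero] at hlim
  refine hlim.congr fun m => ?_
  rw [integral_finsetSum _ fun k _ => hint m k]
  have h1 : ∀ k ∈ I m, ∫ ω, multi (cnt (Φ ω) (cell m 2 k)) ∂P =
      ∫ ω, multi (cnt (Φ ω) (cell m 2 0)) ∂P := fun k _ => by
    rw [← image_add_cell m 2 0 k]
    exact hst.integral_comp_cnt_image_add hΦ (measurableSet_box _ _) _ multi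
  rw [Finset.sum_congr rfl h1, Finset.sum_const, nsmul_eq_mul]
  simp [hI, Fintype.card_piFinset]

/-- Two points at distance less than `1 / m` share a cell of side `2 / m`; this is why the cells
have twice the mesh size. -/
theorem crowdedCentres_ncard_le {S D : Set (Space d)} {L m n : ℕ} (hm : 0 < m) (hn : 0 < n)
    {ε : ℝ} (hS : ∀ A, Bornology.IsBounded A → (S ∩ A).Finite)
    (hD : dilate ε D ⊆ cube d (L * n : ℕ)) :
    ((crowdedCentres S D (1 / (2 * m)) ε).ncard : ℝ) ≤
      ∑ k ∈ latticeBox d (m * (L + 1) * n), multi (cnt S (cell m 2 k)) := by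
  classical
  have hm0 : (0 : ℝ) < m := by exact_mod_cast hm
  have hn1 : (1 : ℝ) ≤ n := by exact_mod_cast hn
  set J := (latticeBox d (m * (L + 1) * n)).filter fun k => 2 ≤ (S ∩ cell m 2 k).ncard
  have hcell : ∀ k, (S ∩ cell m 2 k).Finite := fun k => hS _ (isBounded_box _ _)
  have hsub : crowdedCentres S D (1 / (2 * m)) ε ⊆ ⋃ k ∈ J, S ∩ cell m 2 k := by
    rintro z ⟨⟨hzS, hzD⟩, hz⟩
    obtain ⟨y, hy, hyz, hdist⟩ : ∃ y ∈ S, y ≠ z ∧ dist z y < 2 * (1 / (2 * m)) := by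
      by_contra! hcon
      exact hz ⟨hzS, hcon⟩
    have hi : ∀ i, m * |z i - y i| < 1 := by
      intro i
      have h1 : |z i - y i| ≤ dist z y := by
        rw [dist_eq_norm]; exact PiLp.norm_apply_le (z - y) i
      have h2 : |z i - y i| < 1 / m := h1.trans_lt (hdist.trans_le (le_of_eq (by field_simp)))
      rwa [lt_div_iff₀ hm0, mul_comm] at h2
    -- The corner is taken below the coordinatewise minimum: the smaller coordinate lies in the
    -- first mesh interval and the other at most one mesh further.
    set k : Fin d → ℤ := fun i => ⌊(m : ℝ) * min (z i) (y i)⌋ with hk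
    have hfl : ∀ i, (k i : ℝ) ≤ m * min (z i) (y i) ∧ m * min (z i) (y i) < k i + 1 := fun i =>
      ⟨Int.floor_le _, Int.lt_floor_add_one _⟩
    have hzk : z ∈ cell m 2 k := by
      refine (mem_cell_iff hm).2 fun i => ?_
      have h1 := hfl i
      have h2 := hi i
      rw [← abs_of_pos hm0, ← abs_mul, abs_lt] at h2
      push_cast
      rcases le_total (z i) (y i) with h | h
      · rw [min_eq_left h] at h1; constructor <;> linarith
      · rw [min_eq_right h] at h1
        have := mul_le_mul_of_nonneg_left h hm0.le
        constructor <;> linarith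
    have hyk : y ∈ cell m 2 k := by
      refine (mem_cell_iff hm).2 fun i => ?_
      have h1 := hfl i
      have h2 := hi i
      rw [← abs_of_pos hm0, ← abs_mul, abs_lt] at h2
      push_cast
      rcases le_total (z i) (y i) with h | h
      · rw [min_eq_left h] at h1
        have := mul_le_mul_of_nonneg_left h hm0.le
        constructor <;> linarith
      · rw [min_eq_right h] at h1; constructor <;> linarith
    have hbox : k ∈ latticeBox d (m * (L + 1) * n) := by
      -- The neighbour may leave the cube by less than `1 / m`; enlarging `L` to `L + 1` absorbs
      -- this.
      refine Fintype.mem_piFinset.2 fun i => Finset.mem_Ico.2 ?_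
      have h1 := hD hzD i
      have h2 := hi i
      have h3 := hfl i
      rw [← abs_of_pos hm0, ← abs_mul, abs_lt] at h2
      push_cast at h1
      have h4 := mul_le_mul_of_nonneg_left h1.1 hm0.le
      have h5 := mul_lt_mul_of_pos_left h1.2 hm0
      have hm1 : (1 : ℝ) ≤ m := by exact_mod_cast hm
      have h6 : (1 : ℝ) ≤ m * n := by nlinarith
      constructor
      · rw [hk, Int.le_floor]
        push_cast
        rcases le_total (z i) (y i) with h | h
        · rw [min_eq_left h]; nlinarith
        · rw [min_eq_right h]; nlinarith
      · rw [hk, Int.floor_lt]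
        push_cast
        have := mul_le_mul_of_nonneg_left (min_le_left (z i) (y i)) hm0.le
        nlinarith
    have htwo : 2 ≤ (S ∩ cell m 2 k).ncard :=
      (one_lt_ncard (hcell k)).2 ⟨z, ⟨hzS, hzk⟩, y, ⟨hy, hyk⟩, hyz.symm⟩
    exact mem_biUnion (Finset.mem_coe.2 (Finset.mem_filter.2 ⟨hbox, htwo⟩)) ⟨hzS, hzk⟩
  have h1 : (crowdedCentres S D (1 / (2 * m)) ε).ncard ≤ ∑ k ∈ J, (S ∩ cell m 2 k).ncard :=
    (ncard_le_ncard hsub (J.finite_toSet.biUnion fun k _ => hcell k)).trans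
      (Finset.set_ncard_biUnion_le _ _)
  have h2 : ∑ k ∈ latticeBox d (m * (L + 1) * n), multi (cnt S (cell m 2 k)) =
      ∑ k ∈ J, ((S ∩ cell m 2 k).ncard : ℝ) := by
    rw [Finset.sum_filter]
    refine Finset.sum_congr rfl fun k _ => ?_
    rw [multi, cnt]
    norm_cast
  rw [h2]
  exact_mod_cast h1

theorem tendsto_ceil_inv_nhdsGT : Tendsto (fun ε : ℝ => ⌈ε⁻¹⌉₊) (𝓝[>] 0) atTop :=
  tendsto_nat_ceil_atTop.comp tendsto_inv_nhdsGT_zero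

theorem ae_fewCrowdedCentres (hd : 1 < d) {D : Set (Space d)}
    (hDb : Bornology.IsBounded D) (hΦ : IsMarkedPointProcess Φ ρ)
    (hst : IsStationary P Φ) (hsm : HasFiniteSecondMoment P Φ) (hmix : IsStronglyMixing P Φ) :
    ∀ᵐ ω ∂P, FewCrowdedCentres (Φ ω) D := by
  obtain ⟨L, -, hL⟩ := exists_subset_cube hDb
  obtain ⟨Λ, -, hΛ⟩ := hsm.exists_memLp hΦ
  -- With `m ≥ 2` each cell fits in a unit cube, where the second moment is bounded.
  have hcell : ∀ m : ℕ, ∀ k : Fin d → ℤ, 2 ≤ m →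
      cell m 2 k ⊆ unitCube (WithLp.toLp 2 fun i => (k i : ℝ) / m) := by
    intro m k hm z hz i
    have hm0 : (0 : ℝ) < m := by positivity
    have hm2 : (2 : ℝ) ≤ m := by exact_mod_cast hm
    refine ⟨(hz i).1, (hz i).2.trans_le ?_⟩
    push_cast
    rw [add_div]
    gcongr
    exact (div_le_one hm0).2 hm2
  have hX : ∀ m : ℕ, ∀ k : Fin d → ℤ, 2 ≤ m →
      MemLp (fun ω => multi (cnt (Φ ω) (cell m 2 k))) 2 P ∧
        ∫ ω, multi (cnt (Φ ω) (cell m 2 k)) ^ 2 ∂P ≤ Λ := by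
    intro m k hm
    have h1 := hΛ (cell m 2 k) _ (measurableSet_box _ _) (hcell m k hm)
    have h2 : MemLp (fun ω => multi (cnt (Φ ω) (cell m 2 k))) 2 P :=
      h1.1.mono (measurable_multi.comp
        (hΦ.measurable_cnt (measurableSet_box _ _))).aestronglyMeasurable
        (Eventually.of_forall fun ω => by
          rw [Real.norm_eq_abs, abs_of_nonneg multi_nonneg, Real.norm_eq_abs,
            abs_of_nonneg (cnt_nonneg _ _)]
          exact multi_le (cnt_nonneg _ _))
    refine ⟨h2, le_trans (integral_mono h2.integrable_sq h1.1.integrable_sq fun ω => ?_) h1.2⟩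
    exact pow_le_pow_left₀ multi_nonneg (multi_le (cnt_nonneg _ _)) 2
  have hlln : ∀ᵐ ω ∂P, ∀ m : ℕ, 2 ≤ m → Tendsto (fun n : ℕ => ((n : ℝ) ^ d)⁻¹ *
      ∑ k ∈ latticeBox d (m * (L + 1) * n), multi (cnt (Φ ω) (cell m 2 k))) atTop
      (𝓝 ((2 * (L + 1)) ^ d * ((m : ℝ) ^ d * ∫ ω, multi (cnt (Φ ω) (cell m 2 0)) ∂P))) := by
    refine ae_all_iff.2 fun m => ?_
    by_cases hm : 2 ≤ m
    swap
    · exact Eventually.of_forall fun ω h => absurd h hm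
    have h := ae_tendsto_average_of_mixing hd hmix (by omega : 0 < m) 2 Λ ((2 * m * (L + 1)) ^ d)
      (fun _ k ω => multi (cnt (Φ ω) (cell m 2 k))) (fun n => latticeBox d (m * (L + 1) * n))
      (fun n => by rw [card_latticeBox]; push_cast; rw [← mul_pow]; ring_nf; rfl)
      (fun _ k => measurable_multi.comp (measurable_cnt_comap (measurableSet_box _ _) subset_rfl))
      (fun _ k => (hX m k hm).1) (fun _ k => (hX m k hm).2)
    filter_upwards [h] with ω hω _
    have h1 : ∀ k : Fin d → ℤ, ∫ ω, multi (cnt (Φ ω) (cell m 2 k)) ∂P =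
        ∫ ω, multi (cnt (Φ ω) (cell m 2 0)) ∂P := fun k => by
      rw [← image_add_cell m 2 0 k]
      exact hst.integral_comp_cnt_image_add hΦ (measurableSet_box _ _) _ multi
    have h2 := hω.add_const ((2 * (L + 1)) ^ d * ((m : ℝ) ^ d *
      ∫ ω, multi (cnt (Φ ω) (cell m 2 0)) ∂P))
    rw [zero_add] at h2
    refine h2.congr' ?_
    filter_upwards [eventually_gt_atTop 0] with n hn
    have hn0 : (0 : ℝ) < n := by exact_mod_cast hn
    simp only [h1]
    rw [Finset.sum_const, nsmul_eq_mul, card_latticeBox]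
    push_cast
    simp only [mul_pow]
    field_simp
    ring
  filter_upwards [hlln] with ω hω κ hκ
  have hp := (tendsto_pow_mul_integral_multi hΦ hst hsm).const_mul ((2 : ℝ) ^ d * (2 * (L + 1)) ^ d)
  rw [mul_zero] at hp
  obtain ⟨m, hmκ, hm2⟩ := ((hp.eventually_lt_const hκ).and (eventually_ge_atTop 2)).exists
  have hm0 : 0 < m := by omega
  refine ⟨1 / (2 * m), by positivity, ?_⟩
  have h1 := ((hω m hm2).const_mul ((2 : ℝ) ^ d)).comp tendsto_ceil_inv_nhdsGT
  rw [← mul_assoc] at h1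
  filter_upwards [h1.eventually_lt_const hmκ, self_mem_nhdsWithin,
    Ioo_mem_nhdsGT (zero_lt_one (α := ℝ))] with ε h2 hε hε1
  have hε : 0 < ε := hε
  have hn : 0 < ⌈ε⁻¹⌉₊ := Nat.ceil_pos.2 (by positivity)
  have hn0 : (0 : ℝ) < ⌈ε⁻¹⌉₊ := by exact_mod_cast hn
  refine le_trans ?_ h2.le
  simp only [Function.comp_apply]
  rw [← mul_assoc]
  -- Rounding `1/ε` up to an integer costs at most a factor `2` for `ε < 1`, the origin of `2 ^ d`
  -- in the choice of `m`.
  have h3 : ε * ⌈ε⁻¹⌉₊ ≤ 2 := by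
    have h4 : (⌈ε⁻¹⌉₊ : ℝ) ≤ ε⁻¹ + 1 := (Nat.ceil_lt_add_one (by positivity)).le
    calc ε * ⌈ε⁻¹⌉₊ ≤ ε * (ε⁻¹ + 1) := by gcongr
      _ = 1 + ε := by field_simp
      _ ≤ 2 := by linarith [hε1.2]
  have h5 : ε ^ d ≤ 2 ^ d * ((⌈ε⁻¹⌉₊ : ℝ) ^ d)⁻¹ := by
    rw [← div_eq_mul_inv, ← div_pow]
    gcongr
    exact (le_div_iff₀ hn0).2 h3
  have h6 : dilate ε D ⊆ cube d (L * ⌈ε⁻¹⌉₊ : ℕ) := by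
    refine dilate_subset_cube hL hε ?_
    push_cast
    have h7 : 1 ≤ ε * ⌈ε⁻¹⌉₊ := by
      have := mul_le_mul_of_nonneg_left (Nat.le_ceil ε⁻¹) hε.le
      rwa [mul_inv_cancel₀ hε.ne'] at this
    nlinarith [(Nat.cast_nonneg L : (0 : ℝ) ≤ L)]
  exact mul_le_mul h5 (crowdedCentres_ncard_le hm0 hn (hΦ.locallyFinite ω) h6)
    (Nat.cast_nonneg _) (by positivity)

end CrowdedCentres

/-! ### First moments of the marks and bounds on the pair correlation. -/

section MarkMoments

open ProbabilityTheory

variable {d : ℕ} {Ω : Type*} [MeasurableSpace Ω] {P : Measure Ω}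
  {Φ : Ω → Set (Space d)} {ρ : Ω → Space d → ℝ} {h : Measure ℝ} {g : ℝ → ℝ → ℝ → ℝ}

/-- The number of points in `A` with mark in `B`, as a real number. -/
noncomputable def markCnt (S : Set (Space d)) (ρ : Space d → ℝ) (A : Set (Space d)) (B : Set ℝ) : ℝ :=
  ({z | z ∈ S ∩ A ∧ ρ z ∈ B}.ncard : ℝ)

theorem markCnt_nonneg (S : Set (Space d)) (ρ : Space d → ℝ) (A : Set (Space d)) (B : Set ℝ) :
    0 ≤ markCnt S ρ A B := Nat.cast_nonneg _

theorem markCnt_le_cnt {S : Set (Space d)} {ρ : Space d → ℝ} {A : Set (Space d)} {B : Set ℝ}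
    (hfin : (S ∩ A).Finite) : markCnt S ρ A B ≤ cnt S A :=
  Nat.cast_le.2 (ncard_le_ncard (fun _ hz => hz.1) hfin)

theorem IsMarkedPointProcess.measurable_markCnt (hΦ : IsMarkedPointProcess Φ ρ)
    {A : Set (Space d)} (hA : MeasurableSet A) {B : Set ℝ} (hB : MeasurableSet B) :
    Measurable fun ω => markCnt (Φ ω) (ρ ω) A B := by
  have h3 : Measurable fun x : ℕ∞ => ((x.toNat : ℕ) : ℝ) := Measurable.of_discrete
  exact h3.comp (hΦ.measurable_count A hA B hB)

theorem IsMarkedPointProcess.encard_eq_ofReal_markCnt (hΦ : IsMarkedPointProcess Φ ρ)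
    {A : Set (Space d)} (hA : Bornology.IsBounded A) (B : Set ℝ) (ω : Ω) :
    ({z | z ∈ Φ ω ∩ A ∧ ρ ω z ∈ B}.encard : ℝ≥0∞) = ENNReal.ofReal (markCnt (Φ ω) (ρ ω) A B) := by
  have hfin : {z | z ∈ Φ ω ∩ A ∧ ρ ω z ∈ B}.Finite :=
    (hΦ.locallyFinite ω A hA).subset fun _ hz => hz.1
  rw [markCnt, ENNReal.ofReal_natCast, ← hfin.cast_ncard_eq]
  rfl

theorem HasFiniteSecondMoment.memLp_markCnt (hsm : HasFiniteSecondMoment P Φ)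
    (hΦ : IsMarkedPointProcess Φ ρ) {A : Set (Space d)} (hA : MeasurableSet A)
    (hb : Bornology.IsBounded A) {B : Set ℝ} (hB : MeasurableSet B) :
    MemLp (fun ω => markCnt (Φ ω) (ρ ω) A B) 2 P :=
  (hsm.memLp_cnt hΦ hA hb).mono (hΦ.measurable_markCnt hA hB).aestronglyMeasurable
    (Eventually.of_forall fun ω => by
      rw [Real.norm_eq_abs, abs_of_nonneg (markCnt_nonneg _ _ _ _), Real.norm_eq_abs,
        abs_of_nonneg (cnt_nonneg _ _)]
      exact markCnt_le_cnt (hΦ.locallyFinite ω A hb))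

/-- Layer-cake formula: `N = ∑ 1_{k < N}`. It turns an integral weighted by a count into integrals
over events, the form in which conditioning on the centres is given. -/
theorem lintegral_mul_encard_eq_tsum {N : Ω → ℕ} (hN : Measurable N) {f : Ω → ℝ≥0∞}
    (hf : Measurable f) :
    ∫⁻ ω, f ω * (N ω : ℝ≥0∞) ∂P = ∑' k : ℕ, ∫⁻ ω in {ω | k < N ω}, f ω ∂P := by
  have hms : ∀ k : ℕ, MeasurableSet {ω | k < N ω} := fun k => hN measurableSet_Ioi
  simp_rw [← lintegral_indicator (hms _)]
  rw [← lintegral_tsum fun k => (hf.indicator (hms k)).aemeasurable]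
  refine lintegral_congr fun ω => ?_
  rw [tsum_eq_sum (s := Finset.range (N ω))]
  · rw [Finset.sum_congr rfl fun k hk => indicator_of_mem (s := {ω | k < N ω})
      (show ω ∈ {ω | k < N ω} from Finset.mem_range.1 hk) f, Finset.sum_const, Finset.card_range,
      nsmul_eq_mul, mul_comm]
  · intro k hk
    exact indicator_of_notMem (s := {ω | k < N ω}) (a := ω) (fun hmem => hk (Finset.mem_range.2 hmem)) f

theorem HasMarkCorrelations.lintegral_markCnt [IsProbabilityMeasure P]
    [IsProbabilityMeasure h] (hc : HasMarkCorrelations P Φ ρ h g)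
    (hsm : HasFiniteSecondMoment P Φ)
    (hΦ : IsMarkedPointProcess Φ ρ) {A : Set (Space d)} (hA : MeasurableSet A)
    (hb : Bornology.IsBounded A) {B : Set ℝ} (hB : MeasurableSet B) :
    ∫⁻ ω, ENNReal.ofReal (markCnt (Φ ω) (ρ ω) A B) ∂P =
      ENNReal.ofReal (h.real B * ∫ ω, cnt (Φ ω) A ∂P) := by
  have h1 := hc.one_point univ MeasurableSet.univ A hA hb B hB
  simp only [Measure.restrict_univ, hΦ.encard_eq_ofReal_markCnt hb, hΦ.encard_eq_ofReal_cnt hb] at h1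
  rw [h1, ENNReal.ofReal_mul measureReal_nonneg, ofReal_integral_eq_lintegral_ofReal
    ((hsm.memLp_cnt hΦ hA hb).integrable one_le_two) (Eventually.of_forall fun ω => cnt_nonneg _ _),
    ofReal_measureReal]

/-- The count is determined by the centres, so conditionally on them the marked count has mean `h B`
times the count. The one-point property is tested on the events `{k < N}`. -/
theorem HasMarkCorrelations.integral_markCnt_mul_cnt (hc : HasMarkCorrelations P Φ ρ h g)
    (hΦ : IsMarkedPointProcess Φ ρ) {A : Set (Space d)} (hA : MeasurableSet A)
    (hb : Bornology.IsBounded A) {B : Set ℝ} (hB : MeasurableSet B) :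
    ∫ ω, markCnt (Φ ω) (ρ ω) A B * cnt (Φ ω) A ∂P = h.real B * ∫ ω, cnt (Φ ω) A ^ 2 ∂P := by
  set N : Ω → ℕ := fun ω => (Φ ω ∩ A).ncard with hNdef
  have hNm : Measurable[(countingSigma univ).comap Φ] N := by
    have h1 : Measurable fun x : ℝ => ⌊x⌋₊ := Nat.measurable_floor
    have h2 := h1.comp (measurable_cnt_comap (Φ := Φ) hA (subset_univ A))
    have h3 : N = (fun x : ℝ => ⌊x⌋₊) ∘ fun ω => cnt (Φ ω) A := by
      ext ω
      simp [hNdef, cnt]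
    rw [h3]
    exact h2
  have hNm' : Measurable N := hNm.mono hΦ.comap_le le_rfl
  have hcN : ∀ ω, (N ω : ℝ≥0∞) = ENNReal.ofReal (cnt (Φ ω) A) := fun ω => by
    rw [cnt, ENNReal.ofReal_natCast]
  have hM := hΦ.measurable_markCnt hA hB
  have hC := hΦ.measurable_cnt hA
  have h1 : ∫⁻ ω, ENNReal.ofReal (markCnt (Φ ω) (ρ ω) A B) * (N ω : ℝ≥0∞) ∂P =
      h B * ∫⁻ ω, ENNReal.ofReal (cnt (Φ ω) A) * (N ω : ℝ≥0∞) ∂P := by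
    rw [lintegral_mul_encard_eq_tsum hNm' hM.ennreal_ofReal,
      lintegral_mul_encard_eq_tsum hNm' hC.ennreal_ofReal, ← ENNReal.tsum_mul_left]
    refine tsum_congr fun k => ?_
    have h2 := hc.one_point {ω | k < N ω} (hNm measurableSet_Ioi) A hA hb B hB
    simpa only [hΦ.encard_eq_ofReal_markCnt hb, hΦ.encard_eq_ofReal_cnt hb] using h2
  have hMi : ∫ ω, markCnt (Φ ω) (ρ ω) A B * cnt (Φ ω) A ∂P =
      (∫⁻ ω, ENNReal.ofReal (markCnt (Φ ω) (ρ ω) A B) * (N ω : ℝ≥0∞) ∂P).toReal := by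
    rw [integral_eq_lintegral_of_nonneg_ae (Eventually.of_forall fun ω =>
      mul_nonneg (markCnt_nonneg _ _ _ _) (cnt_nonneg _ _)) (hM.mul hC).aestronglyMeasurable]
    congr 1
    refine lintegral_congr fun ω => ?_
    rw [ENNReal.ofReal_mul (markCnt_nonneg _ _ _ _), hcN]
  have hCi : ∫ ω, cnt (Φ ω) A ^ 2 ∂P =
      (∫⁻ ω, ENNReal.ofReal (cnt (Φ ω) A) * (N ω : ℝ≥0∞) ∂P).toReal := by
    rw [integral_eq_lintegral_of_nonneg_ae (Eventually.of_forall fun ω => sq_nonneg _)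
      (hC.pow_const 2).aestronglyMeasurable]
    congr 1
    refine lintegral_congr fun ω => ?_
    rw [sq, ENNReal.ofReal_mul (cnt_nonneg _ _), hcN]
  rw [hMi, hCi, h1, ENNReal.toReal_mul]
  rfl

/-- The mass of `B` under the integrable weight `1 / (1 + s^p)` on `[0, ∞)`. -/
noncomputable def weightMass (p : ℝ) (B : Set ℝ) : ℝ := ∫ s in B ∩ Ici 0, 1 / (1 + s ^ p)

theorem integrableOn_pow_div_one_add_rpow {p : ℝ} (n : ℕ) (hp : (n : ℝ) + 1 < p) :
    IntegrableOn (fun s : ℝ => s ^ n * (1 / (1 + s ^ p))) (Ici 0) := by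
  have hn : (0 : ℝ) ≤ n := Nat.cast_nonneg n
  have h1 : Integrable (fun s : ℝ => (1 + ‖s‖) ^ (-(p - n))) :=
    integrable_one_add_norm (by rw [Module.finrank_self]; push_cast; linarith)
  refine ((h1.const_mul (2 ^ p)).integrableOn (s := Ici 0)).mono' ?_ ?_
  · exact (by fun_prop : Measurable fun s : ℝ => s ^ n * (1 / (1 + s ^ p))).aestronglyMeasurable
  · refine (ae_restrict_iff' measurableSet_Ici).2 (Eventually.of_forall fun s hs => ?_)
    have hs : 0 ≤ s := hs
    -- Reduces to the integrability of `(1 + s)^(n - p)` on the line, where the exponent is below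
    -- `-1`.
    have h2 := one_div_one_add_rpow_le (γ := p) (a := 1) (by linarith) hs zero_le_one hs (by linarith)
    rw [mul_one] at h2
    rw [Real.norm_eq_abs, Real.norm_eq_abs, abs_of_nonneg hs, abs_of_nonneg (by positivity)]
    calc s ^ n * (1 / (1 + s ^ p)) ≤ (1 + s) ^ n * (2 ^ p * (1 + s) ^ (-p)) := by
          gcongr
          linarith
      _ = 2 ^ p * (1 + s) ^ (-(p - n)) := by
          rw [← Real.rpow_natCast (1 + s) n, mul_left_comm, ← Real.rpow_add (by linarith)]
          congr 2
          ring

theorem integrableOn_one_div_one_add_rpow {p : ℝ} (hp : 1 < p) :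
    IntegrableOn (fun s : ℝ => 1 / (1 + s ^ p)) (Ici 0) := by
  simpa using integrableOn_pow_div_one_add_rpow (p := p) 0 (by simpa using hp)

theorem pairMass_le {c p γ : ℝ} (hp : 1 < p)
    (hg : ∀ r s t : ℝ, 0 ≤ r → 0 ≤ s → 0 ≤ t →
      |g r s t| ≤ c / ((1 + r ^ γ) * (1 + s ^ p) * (1 + t ^ p)))
    {r : ℝ} (hr : 0 ≤ r) {B B' : Set ℝ} (hB : MeasurableSet B) (hB' : MeasurableSet B') :
    pairMass h g r B B' ≤ h.real B * h.real B' +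
      c * (weightMass p B * weightMass p B') * (1 / (1 + r ^ γ)) := by
  refine add_le_add le_rfl ?_
  have hint : ∀ {E : Set ℝ}, Integrable (fun s : ℝ => 1 / (1 + s ^ p)) (volume.restrict (E ∩ Ici 0)) :=
    (integrableOn_one_div_one_add_rpow hp).mono_set inter_subset_right
  have hprod : (volume : Measure (ℝ × ℝ)).restrict ((B ∩ Ici 0) ×ˢ (B' ∩ Ici 0)) =
      (volume.restrict (B ∩ Ici 0)).prod (volume.restrict (B' ∩ Ici 0)) := by
    rw [Measure.prod_restrict]; rfl
  have h1 : ‖∫ q in (B ∩ Ici 0) ×ˢ (B' ∩ Ici 0), g r q.1 q.2‖ ≤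
      ∫ q in (B ∩ Ici 0) ×ˢ (B' ∩ Ici 0),
        c * (1 / (1 + r ^ γ)) * ((1 / (1 + q.1 ^ p)) * (1 / (1 + q.2 ^ p))) := by
    refine norm_integral_le_of_norm_le ?_ ?_
    · rw [hprod]
      exact (hint.mul_prod hint).const_mul _
    · refine (ae_restrict_iff' ((hB.inter measurableSet_Ici).prod
        (hB'.inter measurableSet_Ici))).2 (Eventually.of_forall fun q hq => ?_)
      refine (hg r q.1 q.2 hr hq.1.2 hq.2.2).trans (le_of_eq ?_)
      field_simp
  refine (le_abs_self _).trans (h1.trans (le_of_eq ?_))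
  rw [hprod, integral_const_mul, integral_prod_mul (fun s : ℝ => 1 / (1 + s ^ p))
    (fun s : ℝ => 1 / (1 + s ^ p))]
  rw [weightMass, weightMass]
  ring

end MarkMoments

/-! ### Second moments of the marked counts. -/

section PairMoments

open ProbabilityTheory

variable {d : ℕ} {Ω : Type*} [MeasurableSpace Ω] {P : Measure Ω}
  {Φ : Ω → Set (Space d)} {ρ : Ω → Space d → ℝ} {h : Measure ℝ} {g : ℝ → ℝ → ℝ → ℝ}

/-- An upper bound for `∑ 1 / (1 + |z - w|^γ)` over the pairs of points in `A`, in terms of the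
numbers of points in the unit cells. -/
noncomputable def cellEnergy (γ : ℝ) (S A : Set (Space d)) (M : ℕ) : ℝ :=
  4 ^ γ * ∑ k ∈ latticeBox d M, ∑ l ∈ latticeBox d M,
    cnt S (A ∩ cell 1 1 k) * cnt S (A ∩ cell 1 1 l) * (1 + ‖l - k‖) ^ (-γ)

theorem cellEnergy_nonneg (γ : ℝ) (S A : Set (Space d)) (M : ℕ) : 0 ≤ cellEnergy γ S A M :=
  mul_nonneg (by positivity) (Finset.sum_nonneg fun k _ => Finset.sum_nonneg fun l _ =>
    mul_nonneg (mul_nonneg (cnt_nonneg _ _) (cnt_nonneg _ _)) (by positivity))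

theorem norm_cellIndex_sub_le (z w : Space d) :
    ‖cellIndex 1 w - cellIndex 1 z‖ ≤ dist z w + 1 := by
  refine (pi_norm_le_iff_of_nonneg (by positivity)).2 fun i => ?_
  have h1 : |z i - w i| ≤ dist z w := by
    rw [dist_eq_norm]; exact PiLp.norm_apply_le (z - w) i
  rw [← Int.norm_cast_real, Real.norm_eq_abs, Pi.sub_apply]
  simp only [cellIndex, Nat.cast_one, one_mul, Int.cast_sub]
  have h2 := Int.floor_le (z i)
  have h3 := Int.lt_floor_add_one (z i)
  have h4 := Int.floor_le (w i)
  have h5 := Int.lt_floor_add_one (w i)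
  have h6 := abs_le.1 h1
  rw [abs_le]
  constructor <;> linarith

theorem sum_offDiag_le_cellEnergy {S A : Set (Space d)} {L γ : ℝ} (hγ : 0 ≤ γ) {M : ℕ}
    (hfin : (S ∩ A).Finite) (hA : A ⊆ cube d L) (hM : L ≤ M) :
    ∑ p ∈ hfin.toFinset.offDiag, 1 / (1 + dist p.1 p.2 ^ γ) ≤ cellEnergy γ S A M := by
  classical
  have hmaps : ∀ z ∈ hfin.toFinset, cellIndex 1 z ∈ latticeBox d M := fun z hz =>
    cellIndex_mem_latticeBox one_pos (by simpa using hM) (hA (hfin.mem_toFinset.1 hz).2)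
  have hcard : ∀ k, ((hfin.toFinset.filter fun z => cellIndex 1 z = k).card : ℝ) =
      cnt S (A ∩ cell 1 1 k) := by
    intro k
    rw [cnt, ← ncard_coe_finset]
    congr 2
    ext z
    simp only [Finset.coe_filter, Finite.mem_toFinset, mem_ofPred_eq, mem_inter_iff,
      mem_cell_one_iff one_pos, and_assoc]
  have hsum : ∀ f : (Fin d → ℤ) → ℝ, ∑ z ∈ hfin.toFinset, f (cellIndex 1 z) =
      ∑ k ∈ latticeBox d M, cnt S (A ∩ cell 1 1 k) * f k := by
    intro f
    rw [← Finset.sum_fiberwise_of_maps_to hmaps]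
    refine Finset.sum_congr rfl fun k _ => ?_
    rw [← hcard k, ← nsmul_eq_mul, ← Finset.sum_const]
    exact Finset.sum_congr rfl fun z hz => by rw [(Finset.mem_filter.1 hz).2]
  calc ∑ p ∈ hfin.toFinset.offDiag, 1 / (1 + dist p.1 p.2 ^ γ)
      ≤ ∑ p ∈ hfin.toFinset.offDiag, 4 ^ γ * (1 + ‖cellIndex 1 p.2 - cellIndex 1 p.1‖) ^ (-γ) := by
        refine Finset.sum_le_sum fun p _ => ?_
        -- Passing to cell indices changes a distance by at most `1`, so `a = 2` works and yields
        -- the factor `4 ^ γ`.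
        have h1 := one_div_one_add_rpow_le (a := 2) hγ (dist_nonneg (x := p.1) (y := p.2)) (by norm_num)
          (norm_nonneg (cellIndex 1 p.2 - cellIndex 1 p.1))
          (by linarith [norm_cellIndex_sub_le p.1 p.2, dist_nonneg (x := p.1) (y := p.2)])
        norm_num at h1 ⊢
        exact h1
    _ ≤ ∑ p ∈ hfin.toFinset ×ˢ hfin.toFinset,
          4 ^ γ * (1 + ‖cellIndex 1 p.2 - cellIndex 1 p.1‖) ^ (-γ) := by
        refine Finset.sum_le_sum_of_subset_of_nonneg ?_ fun p _ _ => by positivity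
        exact fun p hp => Finset.mem_product.2
          ⟨(Finset.mem_offDiag.1 hp).1, (Finset.mem_offDiag.1 hp).2.1⟩
    _ = cellEnergy γ S A M := by
        rw [Finset.sum_product, cellEnergy, hsum fun k => ∑ y ∈ hfin.toFinset,
          4 ^ γ * (1 + ‖cellIndex 1 y - k‖) ^ (-γ), Finset.mul_sum]
        refine Finset.sum_congr rfl fun k _ => ?_
        rw [hsum fun l => 4 ^ γ * (1 + ‖l - k‖) ^ (-γ), Finset.mul_sum, Finset.mul_sum]
        exact Finset.sum_congr rfl fun l _ => by ring

/-- A product of counts counts pairs. The diagonal pairs give the one-point term with marks in `B ∩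
B'`; the others are those governed by the two-point correlation. -/
theorem ofReal_markCnt_mul_markCnt (hΦ : IsMarkedPointProcess Φ ρ) {A : Set (Space d)}
    (hb : Bornology.IsBounded A) (B B' : Set ℝ) (ω : Ω) :
    ENNReal.ofReal (markCnt (Φ ω) (ρ ω) A B * markCnt (Φ ω) (ρ ω) A B') =
      ENNReal.ofReal (markCnt (Φ ω) (ρ ω) A (B ∩ B')) +
        ({p : Space d × Space d | p.1 ∈ Φ ω ∩ A ∧ p.2 ∈ Φ ω ∩ A ∧ p.1 ≠ p.2 ∧
          ρ ω p.1 ∈ B ∧ ρ ω p.2 ∈ B'}.encard : ℝ≥0∞) := by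
  rw [ENNReal.ofReal_mul (markCnt_nonneg _ _ _ _)]
  simp only [← hΦ.encard_eq_ofReal_markCnt hb]
  rw [← ENat.toENNReal_mul, ← ENat.toENNReal_add, ← encard_prod]
  congr 1
  rw [← (show Function.Injective fun z : Space d => (z, z) from
    fun a b hab => (Prod.mk.inj hab).1).encard_image {z | z ∈ Φ ω ∩ A ∧ ρ ω z ∈ B ∩ B'},
    ← encard_union_eq]
  · congr 1
    ext ⟨z, w⟩
    simp only [mem_prod, mem_ofPred_eq, mem_union, mem_image, Prod.mk.injEq]
    constructor
    · rintro ⟨⟨hz, hzB⟩, hw, hwB⟩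
      by_cases hzw : z = w
      · subst hzw
        exact Or.inl ⟨z, ⟨hz, hzB, hwB⟩, rfl, rfl⟩
      · exact Or.inr ⟨hz, hw, hzw, hzB, hwB⟩
    · rintro (⟨y, ⟨hy, hyB⟩, rfl, rfl⟩ | ⟨hz, hw, -, hzB, hwB⟩)
      · exact ⟨⟨hy, hyB.1⟩, hy, hyB.2⟩
      · exact ⟨⟨hz, hzB⟩, hw, hwB⟩
  · rw [disjoint_left]
    rintro _ ⟨y, -, rfl⟩ hy
    exact hy.2.2.1 rfl

theorem HasFiniteSecondMoment.integrable_cellEnergy (hsm : HasFiniteSecondMoment P Φ)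
    (hΦ : IsMarkedPointProcess Φ ρ) {A : Set (Space d)} (hA : MeasurableSet A) (γ : ℝ) (M : ℕ) :
    Integrable (fun ω => cellEnergy γ (Φ ω) A M) P := by
  refine Integrable.const_mul (integrable_finsetSum _ fun k _ => integrable_finsetSum _ fun l _ =>
    Integrable.mul_const ?_ _) _
  have hm : ∀ k : Fin d → ℤ, MemLp (fun ω => cnt (Φ ω) (A ∩ cell 1 1 k)) 2 P := fun k =>
    hsm.memLp_cnt hΦ (hA.inter (measurableSet_box _ _)) ((isBounded_box _ _).subset inter_subset_right)
  exact (hm k).integrable_mul (hm l)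

/-- Products of cell counts have bounded mean and the kernel is summable because `γ > d`, so the
energy is of the order of the number of cells, not of pairs. -/
theorem HasFiniteSecondMoment.exists_integral_cellEnergy_le (hsm : HasFiniteSecondMoment P Φ)
    (hΦ : IsMarkedPointProcess Φ ρ) {γ : ℝ} (hγ : (d : ℝ) < γ) : ∃ C : ℝ, 0 ≤ C ∧
    ∀ (A : Set (Space d)) (M : ℕ), MeasurableSet A →
      ∫ ω, cellEnergy γ (Φ ω) A M ∂P ≤ C * (M : ℝ) ^ d := by
  obtain ⟨Λ, hΛ0, hΛ⟩ := hsm.exists_memLp hΦ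
  set Z := ∑' v : Fin d → ℤ, (1 + ‖v‖) ^ (-γ)
  have hZ : 0 ≤ Z := tsum_nonneg fun v => by positivity
  refine ⟨4 ^ γ * (Λ * Z) * 2 ^ d, by positivity, fun A M hA => ?_⟩
  have hm : ∀ k : Fin d → ℤ, MemLp (fun ω => cnt (Φ ω) (A ∩ cell 1 1 k)) 2 P ∧
      ∫ ω, cnt (Φ ω) (A ∩ cell 1 1 k) ^ 2 ∂P ≤ Λ := fun k =>
    hΛ _ (WithLp.toLp 2 fun i => (k i : ℝ)) (hA.inter (measurableSet_box _ _))
      (inter_subset_right.trans (cell_one_one_eq k).subset)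
  have hint : ∀ k l : Fin d → ℤ, Integrable (fun ω => cnt (Φ ω) (A ∩ cell 1 1 k) *
      cnt (Φ ω) (A ∩ cell 1 1 l)) P := fun k l => (hm k).1.integrable_mul (hm l).1
  have hprod : ∀ k l : Fin d → ℤ, ∫ ω, cnt (Φ ω) (A ∩ cell 1 1 k) *
      cnt (Φ ω) (A ∩ cell 1 1 l) ∂P ≤ Λ := by
    intro k l
    have h1 : ∫ ω, cnt (Φ ω) (A ∩ cell 1 1 k) * cnt (Φ ω) (A ∩ cell 1 1 l) ∂P ≤
        ∫ ω, (cnt (Φ ω) (A ∩ cell 1 1 k) ^ 2 + cnt (Φ ω) (A ∩ cell 1 1 l) ^ 2) / 2 ∂P := by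
      refine integral_mono (hint k l)
        (((hm k).1.integrable_sq.add (hm l).1.integrable_sq).div_const 2) fun ω => ?_
      simp only
      nlinarith [sq_nonneg (cnt (Φ ω) (A ∩ cell 1 1 k) - cnt (Φ ω) (A ∩ cell 1 1 l))]
    rw [integral_div, integral_add (hm k).1.integrable_sq (hm l).1.integrable_sq] at h1
    linarith [(hm k).2, (hm l).2]
  have h2 : ∫ ω, cellEnergy γ (Φ ω) A M ∂P = 4 ^ γ * ∑ k ∈ latticeBox d M, ∑ l ∈ latticeBox d M,
      (∫ ω, cnt (Φ ω) (A ∩ cell 1 1 k) * cnt (Φ ω) (A ∩ cell 1 1 l) ∂P) * (1 + ‖l - k‖) ^ (-γ) := by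
    simp only [cellEnergy]
    rw [integral_const_mul, integral_finsetSum _ fun k _ => integrable_finsetSum _ fun l _ =>
      (hint k l).mul_const _]
    congr 1
    refine Finset.sum_congr rfl fun k _ => ?_
    rw [integral_finsetSum _ fun l _ => (hint k l).mul_const _]
    exact Finset.sum_congr rfl fun l _ => integral_mul_const _ _
  rw [h2]
  have h3 : ∑ k ∈ latticeBox d M, ∑ l ∈ latticeBox d M,
      (∫ ω, cnt (Φ ω) (A ∩ cell 1 1 k) * cnt (Φ ω) (A ∩ cell 1 1 l) ∂P) * (1 + ‖l - k‖) ^ (-γ) ≤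
      ∑ k ∈ latticeBox d M, Λ * Z := by
    refine Finset.sum_le_sum fun k _ => ?_
    calc _ ≤ ∑ l ∈ latticeBox d M, Λ * (1 + ‖l - k‖) ^ (-γ) :=
          Finset.sum_le_sum fun l _ => mul_le_mul_of_nonneg_right (hprod k l) (by positivity)
      _ ≤ Λ * Z := by
          rw [← Finset.mul_sum]
          exact mul_le_mul_of_nonneg_left (sum_one_add_norm_sub_rpow_neg_le hγ _ _) hΛ0
  rw [Finset.sum_const, card_latticeBox, nsmul_eq_mul] at h3
  push_cast at h3
  refine (mul_le_mul_of_nonneg_left h3 (by positivity)).trans (le_of_eq ?_)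
  rw [mul_pow]
  ring

theorem weightMass_nonneg (p : ℝ) {B : Set ℝ} (hB : MeasurableSet B) : 0 ≤ weightMass p B :=
  setIntegral_nonneg (hB.inter measurableSet_Ici) fun s hs => by
    have : (0 : ℝ) ≤ s := hs.2
    positivity

variable [IsProbabilityMeasure P] [IsProbabilityMeasure h]

/-- The second moments of the numbers of points with given marks. -/
theorem HasMarkCorrelations.integral_markCnt_mul_markCnt_le (hc : HasMarkCorrelations P Φ ρ h g)
    (hsm : HasFiniteSecondMoment P Φ) (hΦ : IsMarkedPointProcess Φ ρ)
    {c p γ : ℝ} (hp : 1 < p) (hγ : 0 ≤ γ) (hc0 : 0 ≤ c)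
    (hg : ∀ r s t : ℝ, 0 ≤ r → 0 ≤ s → 0 ≤ t →
      |g r s t| ≤ c / ((1 + r ^ γ) * (1 + s ^ p) * (1 + t ^ p)))
    {A : Set (Space d)} (hA : MeasurableSet A) {L : ℝ} {M : ℕ} (hAL : A ⊆ cube d L) (hM : L ≤ M)
    {B B' : Set ℝ} (hB : MeasurableSet B) (hB' : MeasurableSet B') :
    ∫ ω, markCnt (Φ ω) (ρ ω) A B * markCnt (Φ ω) (ρ ω) A B' ∂P ≤
      h.real (B ∩ B') * ∫ ω, cnt (Φ ω) A ∂P + h.real B * h.real B' * ∫ ω, cnt (Φ ω) A ^ 2 ∂P +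
        c * (weightMass p B * weightMass p B') * ∫ ω, cellEnergy γ (Φ ω) A M ∂P := by
  classical
  have hb : Bornology.IsBounded A := (isBounded_box _ _).subset hAL
  have hN := hsm.memLp_cnt hΦ hA hb
  have hG : 0 ≤ c * (weightMass p B * weightMass p B') :=
    mul_nonneg hc0 (mul_nonneg (weightMass_nonneg p hB) (weightMass_nonneg p hB'))
  have hh : 0 ≤ h.real B * h.real B' := by positivity
  have hE := hsm.integrable_cellEnergy (P := P) hΦ hA γ M
  have hpoint : ∀ ω, (∑' q : {q : Space d × Space d | q.1 ∈ Φ ω ∩ A ∧ q.2 ∈ Φ ω ∩ A ∧ q.1 ≠ q.2},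
      ENNReal.ofReal (pairMass h g (dist q.1.1 q.1.2) B B')) ≤
      ENNReal.ofReal (h.real B * h.real B' * cnt (Φ ω) A ^ 2 +
        c * (weightMass p B * weightMass p B') * cellEnergy γ (Φ ω) A M) := by
    intro ω
    have hfin := hΦ.locallyFinite ω A hb
    have hset : {q : Space d × Space d | q.1 ∈ Φ ω ∩ A ∧ q.2 ∈ Φ ω ∩ A ∧ q.1 ≠ q.2} =
        (hfin.toFinset.offDiag : Set (Space d × Space d)) := by
      ext q
      simp
    rw [hset, Finset.tsum_subtype' hfin.toFinset.offDiag
      fun q : Space d × Space d => ENNReal.ofReal (pairMass h g (dist q.1 q.2) B B')]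
    have h1 : ∀ q ∈ hfin.toFinset.offDiag, ENNReal.ofReal (pairMass h g (dist q.1 q.2) B B') ≤
        ENNReal.ofReal (h.real B * h.real B' +
          c * (weightMass p B * weightMass p B') * (1 / (1 + dist q.1 q.2 ^ γ))) := fun q _ =>
      ENNReal.ofReal_le_ofReal (pairMass_le hp hg dist_nonneg hB hB')
    refine (Finset.sum_le_sum h1).trans ?_
    rw [← ENNReal.ofReal_sum_of_nonneg fun q _ => by positivity]
    apply ENNReal.ofReal_le_ofReal
    rw [Finset.sum_add_distrib, Finset.sum_const, nsmul_eq_mul, ← Finset.mul_sum,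
      mul_comm _ (h.real B * h.real B')]
    refine add_le_add (mul_le_mul_of_nonneg_left ?_ hh)
      (mul_le_mul_of_nonneg_left (sum_offDiag_le_cellEnergy hγ hfin hAL hM) hG)
    have h2 : hfin.toFinset.offDiag.card ≤ hfin.toFinset.card ^ 2 := by
      rw [Finset.offDiag_card, sq]; exact Nat.sub_le _ _
    rw [cnt, ncard_eq_toFinset_card _ hfin]
    exact_mod_cast h2
  have htwo := hc.two_point univ MeasurableSet.univ A A hA hb hA hb B B' hB hB'
  simp only [Measure.restrict_univ] at htwo
  have hmul : ∫⁻ ω, ENNReal.ofReal (markCnt (Φ ω) (ρ ω) A B * markCnt (Φ ω) (ρ ω) A B') ∂P ≤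
      ENNReal.ofReal (h.real (B ∩ B') * ∫ ω, cnt (Φ ω) A ∂P +
        (h.real B * h.real B' * ∫ ω, cnt (Φ ω) A ^ 2 ∂P +
        c * (weightMass p B * weightMass p B') * ∫ ω, cellEnergy γ (Φ ω) A M ∂P)) := by
    have h0 : 0 ≤ ∫ ω, cnt (Φ ω) A ^ 2 ∂P := integral_nonneg fun ω => sq_nonneg _
    have h0' : 0 ≤ ∫ ω, cellEnergy γ (Φ ω) A M ∂P := integral_nonneg fun ω => cellEnergy_nonneg _ _ _ _
    have h0'' : 0 ≤ ∫ ω, cnt (Φ ω) A ∂P := integral_nonneg fun ω => cnt_nonneg _ _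
    simp_rw [ofReal_markCnt_mul_markCnt hΦ hb]
    rw [lintegral_add_left (hΦ.measurable_markCnt hA (hB.inter hB')).ennreal_ofReal, htwo,
      hc.lintegral_markCnt hsm hΦ hA hb (hB.inter hB'),
      ENNReal.ofReal_add (by positivity) (by positivity)]
    gcongr
    refine (lintegral_mono hpoint).trans ?_
    rw [← ofReal_integral_eq_lintegral_ofReal, integral_add, integral_const_mul, integral_const_mul]
    · exact hN.integrable_sq.const_mul _
    · exact hE.const_mul _
    · exact (hN.integrable_sq.const_mul _).add (hE.const_mul _)
    · exact Eventually.of_forall fun ω => add_nonneg (mul_nonneg hh (sq_nonneg _))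
        (mul_nonneg hG (cellEnergy_nonneg _ _ _ _))
  rw [integral_eq_lintegral_of_nonneg_ae (Eventually.of_forall fun ω =>
    mul_nonneg (markCnt_nonneg _ _ _ _) (markCnt_nonneg _ _ _ _))
    ((hΦ.measurable_markCnt hA hB).mul (hΦ.measurable_markCnt hA hB')).aestronglyMeasurable, add_assoc]
  refine ENNReal.toReal_le_of_le_ofReal ?_ hmul
  have h0 : 0 ≤ ∫ ω, cnt (Φ ω) A ^ 2 ∂P := integral_nonneg fun ω => sq_nonneg _
  have h0' : 0 ≤ ∫ ω, cellEnergy γ (Φ ω) A M ∂P := integral_nonneg fun ω => cellEnergy_nonneg _ _ _ _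
  have h0'' : 0 ≤ ∫ ω, cnt (Φ ω) A ∂P := integral_nonneg fun ω => cnt_nonneg _ _
  positivity

/-- The variance of a weighted sum over the marks around its conditional mean given the centres. -/
theorem HasMarkCorrelations.integral_sq_sub_le (hc : HasMarkCorrelations P Φ ρ h g)
    (hsm : HasFiniteSecondMoment P Φ) (hΦ : IsMarkedPointProcess Φ ρ)
    {c p γ : ℝ} (hp : 1 < p) (hγ : 0 ≤ γ) (hc0 : 0 ≤ c)
    (hg : ∀ r s t : ℝ, 0 ≤ r → 0 ≤ s → 0 ≤ t →
      |g r s t| ≤ c / ((1 + r ^ γ) * (1 + s ^ p) * (1 + t ^ p)))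
    {A : Set (Space d)} (hA : MeasurableSet A) {L : ℝ} {M : ℕ} (hAL : A ⊆ cube d L) (hM : L ≤ M)
    (J : Finset ℕ) (B : ℕ → Set ℝ) (hB : ∀ j, MeasurableSet (B j))
    (hdisj : ∀ i j, i ≠ j → Disjoint (B i) (B j)) (a : ℕ → ℝ) (ha : ∀ j, 0 ≤ a j) :
    ∫ ω, (∑ j ∈ J, a j * markCnt (Φ ω) (ρ ω) A (B j) -
        (∑ j ∈ J, a j * h.real (B j)) * cnt (Φ ω) A) ^ 2 ∂P ≤
      (∑ j ∈ J, a j ^ 2 * h.real (B j)) * ∫ ω, cnt (Φ ω) A ∂P +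
        c * (∑ j ∈ J, a j * weightMass p (B j)) ^ 2 * ∫ ω, cellEnergy γ (Φ ω) A M ∂P := by
  have hb : Bornology.IsBounded A := (isBounded_box _ _).subset hAL
  have hN := hsm.memLp_cnt hΦ hA hb
  have hMk : ∀ j, MemLp (fun ω => markCnt (Φ ω) (ρ ω) A (B j)) 2 P := fun j =>
    hsm.memLp_markCnt hΦ hA hb (hB j)
  set w := ∑ j ∈ J, a j * h.real (B j) with hw
  set E1 := ∫ ω, cnt (Φ ω) A ∂P
  set E2 := ∫ ω, cnt (Φ ω) A ^ 2 ∂P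
  set U := ∫ ω, cellEnergy γ (Φ ω) A M ∂P
  have hMM : ∀ i j, Integrable (fun ω => markCnt (Φ ω) (ρ ω) A (B i) *
      markCnt (Φ ω) (ρ ω) A (B j)) P := fun i j => (hMk i).integrable_mul (hMk j)
  have hMN : ∀ j, Integrable (fun ω => markCnt (Φ ω) (ρ ω) A (B j) * cnt (Φ ω) A) P := fun j =>
    (hMk j).integrable_mul hN
  have hexp : ∀ ω, (∑ j ∈ J, a j * markCnt (Φ ω) (ρ ω) A (B j) - w * cnt (Φ ω) A) ^ 2 =
      (∑ i ∈ J, ∑ j ∈ J, a i * a j * (markCnt (Φ ω) (ρ ω) A (B i) * markCnt (Φ ω) (ρ ω) A (B j)) -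
        2 * w * ∑ j ∈ J, a j * (markCnt (Φ ω) (ρ ω) A (B j) * cnt (Φ ω) A)) +
        w ^ 2 * cnt (Φ ω) A ^ 2 := by
    intro ω
    have h1 : (∑ j ∈ J, a j * markCnt (Φ ω) (ρ ω) A (B j)) ^ 2 = ∑ i ∈ J, ∑ j ∈ J,
        a i * a j * (markCnt (Φ ω) (ρ ω) A (B i) * markCnt (Φ ω) (ρ ω) A (B j)) := by
      rw [sq, Finset.sum_mul_sum]
      exact Finset.sum_congr rfl fun i _ => Finset.sum_congr rfl fun j _ => by ring
    have h2 : ∑ j ∈ J, a j * (markCnt (Φ ω) (ρ ω) A (B j) * cnt (Φ ω) A) =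
        (∑ j ∈ J, a j * markCnt (Φ ω) (ρ ω) A (B j)) * cnt (Φ ω) A := by
      rw [Finset.sum_mul]
      exact Finset.sum_congr rfl fun j _ => by ring
    rw [← h1, h2]
    ring
  simp_rw [hexp]
  have hI1 : Integrable (fun ω => ∑ i ∈ J, ∑ j ∈ J,
      a i * a j * (markCnt (Φ ω) (ρ ω) A (B i) * markCnt (Φ ω) (ρ ω) A (B j))) P :=
    integrable_finsetSum _ fun i _ => integrable_finsetSum _ fun j _ => (hMM i j).const_mul _
  have hI2 : Integrable (fun ω => 2 * w * ∑ j ∈ J, a j *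
      (markCnt (Φ ω) (ρ ω) A (B j) * cnt (Φ ω) A)) P :=
    (integrable_finsetSum _ fun j _ => (hMN j).const_mul _).const_mul _
  have hI12 : Integrable (fun ω => (∑ i ∈ J, ∑ j ∈ J,
      a i * a j * (markCnt (Φ ω) (ρ ω) A (B i) * markCnt (Φ ω) (ρ ω) A (B j))) -
      2 * w * ∑ j ∈ J, a j * (markCnt (Φ ω) (ρ ω) A (B j) * cnt (Φ ω) A)) P := hI1.sub hI2
  rw [integral_add hI12 (hN.integrable_sq.const_mul _), integral_sub hI1 hI2,
    integral_const_mul, integral_const_mul, integral_finsetSum _ fun j _ => (hMN j).const_mul _,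
    integral_finsetSum _ fun i _ => integrable_finsetSum _ fun j _ => (hMM i j).const_mul _]
  -- The cross term contributes `-2 w² E2`, cancelling the `w² E2` from the independent part of the
  -- pair moments and the `w² E2` from the squared count.
  have h3 : ∑ j ∈ J, ∫ ω, a j * (markCnt (Φ ω) (ρ ω) A (B j) * cnt (Φ ω) A) ∂P = w * E2 := by
    rw [hw, Finset.sum_mul]
    refine Finset.sum_congr rfl fun j _ => ?_
    rw [integral_const_mul, hc.integral_markCnt_mul_cnt hΦ hA hb (hB j), mul_assoc]
  have hhB : ∀ i j, h.real (B i ∩ B j) = if i = j then h.real (B i) else 0 := by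
    intro i j
    split_ifs with hij
    · rw [hij, inter_self]
    · rw [(hdisj i j hij).inter_eq, measureReal_empty]
  have h4 : ∑ i ∈ J, ∫ ω, ∑ j ∈ J, a i * a j *
      (markCnt (Φ ω) (ρ ω) A (B i) * markCnt (Φ ω) (ρ ω) A (B j)) ∂P ≤
      (∑ j ∈ J, a j ^ 2 * h.real (B j)) * E1 + w ^ 2 * E2 +
        c * (∑ j ∈ J, a j * weightMass p (B j)) ^ 2 * U := by
    have h5 : ∀ i ∈ J, ∀ j ∈ J, ∫ ω, a i * a j *
        (markCnt (Φ ω) (ρ ω) A (B i) * markCnt (Φ ω) (ρ ω) A (B j)) ∂P ≤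
        (if i = j then a i ^ 2 * h.real (B i) else 0) * E1 +
          (a i * h.real (B i)) * (a j * h.real (B j)) * E2 +
          c * ((a i * weightMass p (B i)) * (a j * weightMass p (B j))) * U := by
      intro i _ j _
      rw [integral_const_mul]
      have h6 := hc.integral_markCnt_mul_markCnt_le hsm hΦ hp hγ hc0 hg hA hAL hM (hB i) (hB j)
      rw [hhB] at h6
      refine (mul_le_mul_of_nonneg_left h6 (mul_nonneg (ha i) (ha j))).trans (le_of_eq ?_)
      split_ifs with hij
      · subst hij; ring
      · ring
    calc _ = ∑ i ∈ J, ∑ j ∈ J, ∫ ω, a i * a j *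
          (markCnt (Φ ω) (ρ ω) A (B i) * markCnt (Φ ω) (ρ ω) A (B j)) ∂P :=
          Finset.sum_congr rfl fun i _ => integral_finsetSum _ fun j _ => (hMM i j).const_mul _
      _ ≤ _ := Finset.sum_le_sum fun i hi => Finset.sum_le_sum fun j hj => h5 i hi j hj
      _ = _ := by
          simp only [Finset.sum_add_distrib, ← Finset.sum_mul, ← Finset.mul_sum]
          rw [sq w, sq (∑ j ∈ J, a j * weightMass p (B j)), hw]
          congr 3
          -- Disjointness of the mark sets leaves only the diagonal of the one-point term.
          exact Finset.sum_congr rfl fun i hi => by rw [Finset.sum_ite_eq, if_pos hi]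
  rw [h3]
  linarith

end PairMoments

/-! ### Dyadic mark levels and concentration of the truncated sums. -/

section MarkTails

variable {d : ℕ} {Ω : Type*} [MeasurableSpace Ω] {P : Measure Ω}
  {Φ : Ω → Set (Space d)} {ρ : Ω → Space d → ℝ} {h : Measure ℝ} {g : ℝ → ℝ → ℝ → ℝ}

/-- The marks `s` with `2^{dj} ≤ s^{d-2}`. -/
def markTail (d j : ℕ) : Set ℝ := {s | 0 ≤ s ∧ ((2 : ℝ) ^ d) ^ j ≤ s ^ (d - 2)}

/-- The marks `s` with `2^{dj} ≤ s^{d-2} < 2^{d(j+1)}`. -/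
def markLevel (d j : ℕ) : Set ℝ :=
  {s | 0 ≤ s ∧ ((2 : ℝ) ^ d) ^ j ≤ s ^ (d - 2) ∧ s ^ (d - 2) < ((2 : ℝ) ^ d) ^ (j + 1)}

theorem measurableSet_markTail (d j : ℕ) : MeasurableSet (markTail d j) :=
  measurableSet_Ici.inter (measurableSet_le measurable_const (measurable_id.pow_const (d - 2)))

theorem measurableSet_markLevel (d j : ℕ) : MeasurableSet (markLevel d j) :=
  measurableSet_Ici.inter ((measurableSet_le measurable_const (measurable_id.pow_const (d - 2))).inter
    (measurableSet_lt (measurable_id.pow_const (d - 2)) measurable_const))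

theorem markLevel_subset_markTail (d j : ℕ) : markLevel d j ⊆ markTail d j :=
  fun _ hs => ⟨hs.1, hs.2.1⟩

theorem disjoint_markLevel (d : ℕ) : ∀ i j, i ≠ j → Disjoint (markLevel d i) (markLevel d j) := by
  have key : ∀ i j, i < j → Disjoint (markLevel d i) (markLevel d j) := by
    intro i j hij
    rw [disjoint_left]
    intro s hi hj
    have h1 : ((2 : ℝ) ^ d) ^ (i + 1) ≤ ((2 : ℝ) ^ d) ^ j :=
      pow_le_pow_right₀ (one_le_pow₀ one_le_two) hij
    linarith [hi.2.2, hj.2.1]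
  intro i j hij
  rcases lt_or_gt_of_ne hij with h | h
  · exact key i j h
  · exact (key j i h).symm

/-- A geometric sum with ratio at least `2` is at most twice its last term, and the last term
included is at most `x`. -/
theorem sum_ite_pow_le {b x : ℝ} (hb : 2 ≤ b) (hx : 0 ≤ x) (N : ℕ) :
    ∑ n ∈ Finset.range N, (if b ^ n ≤ x then b ^ n else 0) ≤ 2 * x := by
  have hgeom : ∀ N : ℕ, ∑ n ∈ Finset.range N, b ^ n ≤ b ^ N := by
    intro N
    induction N with
    | zero => simp
    | succ N ih =>
      rw [Finset.sum_range_succ, pow_succ]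
      have : 0 ≤ b ^ N := by positivity
      nlinarith
  induction N with
  | zero => simpa using hx
  | succ N ih =>
    by_cases hN : b ^ N ≤ x
    · rw [Finset.sum_range_succ, if_pos hN]
      have h1 : ∑ n ∈ Finset.range N, (if b ^ n ≤ x then b ^ n else 0) ≤
          ∑ n ∈ Finset.range N, b ^ n := by
        refine Finset.sum_le_sum fun n _ => ?_
        have : 0 ≤ b ^ n := by positivity
        split_ifs <;> linarith
      linarith [hgeom N]
    · rwa [Finset.sum_range_succ, if_neg hN, add_zero]

theorem two_le_two_pow (hd : 0 < d) : (2 : ℝ) ≤ 2 ^ d :=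
  le_self_pow₀ one_le_two hd.ne'

/-- Interchanging sum and integral leaves `∑ b^j` over `b^j ≤ s^(d-2)`, which is at most `2
s^(d-2)`. Thus the moment assumption becomes a dyadic tail condition. -/
theorem summable_pow_mul_markTail [IsProbabilityMeasure h] (hd : 0 < d)
    (hint : (∫⁻ s, ENNReal.ofReal (s ^ (d - 2)) ∂h) < ⊤) :
    Summable fun j => ((2 : ℝ) ^ d) ^ j * h.real (markTail d j) := by
  refine summable_of_sum_range_le (c := (2 * ∫⁻ s, ENNReal.ofReal (s ^ (d - 2)) ∂h).toReal)
    (fun j => by positivity) fun N => ?_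
  rw [← ENNReal.ofReal_le_iff_le_toReal (ENNReal.mul_lt_top ENNReal.ofNat_lt_top hint).ne,
    ENNReal.ofReal_sum_of_nonneg fun j _ => by positivity]
  have h1 : ∀ j, ENNReal.ofReal (((2 : ℝ) ^ d) ^ j * h.real (markTail d j)) =
      ∫⁻ s, (markTail d j).indicator (fun _ => ENNReal.ofReal (((2 : ℝ) ^ d) ^ j)) s ∂h := by
    intro j
    rw [lintegral_indicator (measurableSet_markTail d j), setLIntegral_const,
      ENNReal.ofReal_mul (by positivity), ofReal_measureReal]
  simp_rw [h1]
  rw [← lintegral_finsetSum _ fun j _ => measurable_const.indicator (measurableSet_markTail d j),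
    ← lintegral_const_mul' _ _ ENNReal.ofNat_ne_top]
  refine lintegral_mono fun s => ?_
  by_cases hs : 0 ≤ s
  · have h2 : ∀ j ∈ Finset.range N,
        (markTail d j).indicator (fun _ => ENNReal.ofReal (((2 : ℝ) ^ d) ^ j)) s =
        ENNReal.ofReal (if ((2 : ℝ) ^ d) ^ j ≤ s ^ (d - 2) then ((2 : ℝ) ^ d) ^ j else 0) := by
      intro j _
      split_ifs with hj
      · exact indicator_of_mem (s := markTail d j) ⟨hs, hj⟩ _
      · rw [ENNReal.ofReal_zero]
        exact indicator_of_notMem (s := markTail d j) (fun h => hj h.2) _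
    rw [Finset.sum_congr rfl h2, ← ENNReal.ofReal_sum_of_nonneg fun j _ => by positivity]
    refine (ENNReal.ofReal_le_ofReal
      (sum_ite_pow_le (two_le_two_pow hd) (by positivity : 0 ≤ s ^ (d - 2)) N)).trans ?_
    rw [ENNReal.ofReal_mul (by norm_num)]
    norm_num
  · rw [Finset.sum_eq_zero fun j _ => indicator_of_notMem (s := markTail d j) (fun h => hs h.1) _]
    exact zero_le

/-- On each level `b^(j+1)` is at most `b s^(d-2)`, and the levels are disjoint, so the total is
controlled by one integral, finite because `p > d - 1`. -/
theorem sum_pow_mul_weightMass_le (hd : 2 < d) {p : ℝ} (hp : (d : ℝ) - 1 < p) (J : Finset ℕ) :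
    ∑ j ∈ J, ((2 : ℝ) ^ d) ^ (j + 1) * weightMass p (markLevel d j) ≤
      2 ^ d * ∫ s in Ici 0, s ^ (d - 2) * (1 / (1 + s ^ p)) := by
  have hd2 : (2 : ℝ) < d := by exact_mod_cast hd
  have hI : IntegrableOn (fun s : ℝ => s ^ (d - 2) * (1 / (1 + s ^ p))) (Ici 0) :=
    integrableOn_pow_div_one_add_rpow (d - 2) (by rw [Nat.cast_sub hd.le]; push_cast; linarith)
  have hm : ∀ j, MeasurableSet (markLevel d j ∩ Ici (0 : ℝ)) := fun j =>
    (measurableSet_markLevel d j).inter measurableSet_Ici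
  have h1 : ∀ j ∈ J, ((2 : ℝ) ^ d) ^ (j + 1) * weightMass p (markLevel d j) ≤
      2 ^ d * ∫ s in markLevel d j ∩ Ici 0, s ^ (d - 2) * (1 / (1 + s ^ p)) := by
    intro j _
    rw [pow_succ', mul_assoc, weightMass, ← integral_const_mul]
    refine mul_le_mul_of_nonneg_left ?_ (by positivity)
    refine setIntegral_mono_on
      (((integrableOn_one_div_one_add_rpow (by linarith)).mono_set inter_subset_right).const_mul _)
      (hI.mono_set inter_subset_right) (hm j) fun s hs => ?_
    have hs0 : (0 : ℝ) ≤ s := hs.2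
    gcongr
    exact hs.1.2.1
  refine (Finset.sum_le_sum h1).trans ?_
  rw [← Finset.mul_sum, ← integral_biUnion_finset J (fun j _ => hm j)
    (fun i _ j _ hij => (disjoint_markLevel d i j hij).mono inter_subset_left inter_subset_left)
    fun j _ => hI.mono_set inter_subset_right]
  refine mul_le_mul_of_nonneg_left ?_ (by positivity)
  refine setIntegral_mono_set hI ?_ (LE.le.eventuallyLE
    (iUnion₂_subset fun j _ => inter_subset_right))
  refine (ae_restrict_iff' measurableSet_Ici).2 (Eventually.of_forall fun s hs => ?_)
  have hs0 : (0 : ℝ) ≤ s := hs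
  positivity

theorem measurableSet_cube (d : ℕ) (L : ℝ) : MeasurableSet (cube d L) := measurableSet_box _ _

theorem isBounded_cube (d : ℕ) (L : ℝ) : Bornology.IsBounded (cube d L) := isBounded_box _ _

theorem volume_real_cube (d L : ℕ) : volume.real (cube d L) = (2 * L) ^ d := by
  have h1 : cube d L = (MeasurableEquiv.toLp 2 (Fin d → ℝ)).symm ⁻¹'
      (Set.pi univ fun _ => Ico (-(L : ℝ)) L) := by
    ext y; simp [cube, box]
  rw [measureReal_def, h1, (EuclideanSpace.volume_preserving_symm_measurableEquiv_toLp
    (Fin d)).measure_preimage_equiv, Real.volume_pi_Ico, ENNReal.toReal_prod]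
  rw [Finset.prod_const, Finset.card_univ, Fintype.card_fin,
    ENNReal.toReal_ofReal (by linarith [(Nat.cast_nonneg L : (0 : ℝ) ≤ L)])]
  ring

theorem meanCount_nonneg (q : Space d) : 0 ≤ meanCount P Φ (unitCube q) :=
  integral_nonneg fun _ => Nat.cast_nonneg _

variable [IsProbabilityMeasure P]

theorem integral_cnt_cube (hst : IsStationary P Φ) (hsm : HasFiniteSecondMoment P Φ)
    (hΦ : IsMarkedPointProcess Φ ρ) (L n : ℕ) :
    ∫ ω, cnt (Φ ω) (cube d (L * n : ℕ)) ∂P =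
      meanCount P Φ (unitCube 0) * (2 * L) ^ d * (n : ℝ) ^ d := by
  rw [integral_cnt_eq hst hsm hΦ (measurableSet_cube d _) (isBounded_cube d _) 0, volume_real_cube]
  push_cast
  rw [← mul_assoc, mul_pow]
  ring

variable [IsProbabilityMeasure h]

/-- The truncated sums of the marks in growing cubes concentrate along the scales `2^n`. -/
theorem ae_tendsto_markSum_sub (hd : 2 < d) (hΦ : IsMarkedPointProcess Φ ρ) (hst : IsStationary P Φ)
    (hsm : HasFiniteSecondMoment P Φ) (hc : HasMarkCorrelations P Φ ρ h g)
    (hint : (∫⁻ s, ENNReal.ofReal (s ^ (d - 2)) ∂h) < ⊤)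
    {c p γ : ℝ} (hp : (d : ℝ) - 1 < p) (hγ : (d : ℝ) < γ)
    (hg : ∀ r s t : ℝ, 0 ≤ r → 0 ≤ s → 0 ≤ t →
      |g r s t| ≤ c / ((1 + r ^ γ) * (1 + s ^ p) * (1 + t ^ p))) (L : ℕ) :
    ∀ᵐ ω ∂P, ∀ m : ℕ, Tendsto (fun n : ℕ => (((2 : ℝ) ^ d) ^ n)⁻¹ *
      (∑ j ∈ Finset.Ico m n, ((2 : ℝ) ^ d) ^ (j + 1) *
          markCnt (Φ ω) (ρ ω) (cube d (L * 2 ^ n : ℕ)) (markLevel d j) -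
        (∑ j ∈ Finset.Ico m n, ((2 : ℝ) ^ d) ^ (j + 1) * h.real (markLevel d j)) *
          cnt (Φ ω) (cube d (L * 2 ^ n : ℕ)))) atTop (𝓝 0) := by
  have hd2 : (2 : ℝ) < d := by exact_mod_cast hd
  -- Read off from the bound on `g` at the origin, where all powers vanish.
  have hc0 : 0 ≤ c := by
    have h1 := (abs_nonneg _).trans (hg 0 0 0 le_rfl le_rfl le_rfl)
    rw [Real.zero_rpow (by linarith), Real.zero_rpow (by linarith)] at h1
    simpa using h1
  set b : ℝ := 2 ^ d with hb
  have hb2 : 2 ≤ b := two_le_two_pow (by omega)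
  have hb0 : 0 < b := by linarith
  obtain ⟨C₂, hC₂, hU⟩ := hsm.exists_integral_cellEnergy_le hΦ hγ
  set C₁ := meanCount P Φ (unitCube 0) * (2 * L) ^ d with hC₁
  have hC₁0 : 0 ≤ C₁ := mul_nonneg (meanCount_nonneg _) (by positivity)
  set G := b * ∫ s in Ici (0 : ℝ), s ^ (d - 2) * (1 / (1 + s ^ p))
  have hx : Summable fun j => b ^ 2 * (b ^ j * h.real (markTail d j)) :=
    (summable_pow_mul_markTail (by omega) hint).mul_left _
  have hy : Summable fun j : ℕ => (b⁻¹) ^ j :=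
    summable_geometric_of_lt_one (by positivity) (inv_lt_one_of_one_lt₀ (by linarith))
  -- After normalisation, level `j` contributes its tail weight times `b^(-(n-j))` at scale `n`.
  -- Summing over `n` is a Cauchy product of two summable sequences, so only the `(d-2)`-th moment
  -- is needed.
  have hconv : Summable fun n => ∑ j ∈ Finset.range (n + 1),
      b ^ 2 * (b ^ j * h.real (markTail d j)) * (b⁻¹) ^ (n - j) :=
    summable_sum_mul_range_of_summable_norm' hx.norm hx hy.norm hy
  refine ae_all_iff.2 fun m => ae_tendsto_zero_of_lintegral_sq_le
    (a := fun n => C₁ * (∑ j ∈ Finset.range (n + 1),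
      b ^ 2 * (b ^ j * h.real (markTail d j)) * (b⁻¹) ^ (n - j)) +
      c * G ^ 2 * (C₂ * L ^ d) * (b⁻¹) ^ n) (fun n => ?_) ?_ (fun n => by positivity) fun n => ?_
  · refine (Measurable.const_mul (Measurable.sub ?_ ?_) _).aemeasurable
    · exact Finset.measurable_sum _ fun j _ => (hΦ.measurable_markCnt (measurableSet_cube d _)
        (measurableSet_markLevel d j)).const_mul _
    · exact (hΦ.measurable_cnt (measurableSet_cube d _)).const_mul _
  · exact (hconv.mul_left _).add (hy.mul_left _)
  · have hA : MeasurableSet (cube d (L * 2 ^ n : ℕ)) := measurableSet_cube d _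
    have hbd : Bornology.IsBounded (cube d (L * 2 ^ n : ℕ)) := isBounded_cube d _
    have hpown : (((2 : ℕ) ^ n : ℕ) : ℝ) ^ d = b ^ n := by
      push_cast
      rw [hb, ← pow_mul, ← pow_mul, mul_comm]
    have hvar := hc.integral_sq_sub_le hsm hΦ (by linarith : 1 < p) (by linarith : 0 ≤ γ) hc0 hg hA
      subset_rfl (M := L * 2 ^ n) le_rfl (Finset.Ico m n) (markLevel d) (measurableSet_markLevel d)
      (disjoint_markLevel d) (fun j => b ^ (j + 1)) (fun j => by positivity)
    have hcube := integral_cnt_cube hst hsm hΦ L (2 ^ n)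
    rw [hpown, ← hC₁] at hcube
    rw [hcube] at hvar
    have hUn := hU (cube d (L * 2 ^ n : ℕ)) (L * 2 ^ n) hA
    rw [show ((L * 2 ^ n : ℕ) : ℝ) ^ d = L ^ d * b ^ n by rw [Nat.cast_mul, mul_pow, hpown]] at hUn
    have hw0 : 0 ≤ ∑ j ∈ Finset.Ico m n, b ^ (j + 1) * weightMass p (markLevel d j) :=
      Finset.sum_nonneg fun j _ =>
        mul_nonneg (by positivity) (weightMass_nonneg p (measurableSet_markLevel d j))
    have hwG := sum_pow_mul_weightMass_le hd hp (Finset.Ico m n)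
    -- Uses `b^(2j) = b^n * b^j * b^(-(n-j))` for `j ≤ n`.
    have hfirst : ∑ j ∈ Finset.Ico m n, (b ^ (j + 1)) ^ 2 * h.real (markLevel d j) ≤
        b ^ n * ∑ j ∈ Finset.range (n + 1),
          b ^ 2 * (b ^ j * h.real (markTail d j)) * (b⁻¹) ^ (n - j) := by
      rw [Finset.mul_sum]
      refine (Finset.sum_le_sum fun j hj => ?_).trans
        (Finset.sum_le_sum_of_subset_of_nonneg (fun j hj => Finset.mem_range.2
          (by have := (Finset.mem_Ico.1 hj).2; omega)) fun j _ _ => by positivity)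
      have hjn : j ≤ n := (Finset.mem_Ico.1 hj).2.le
      obtain ⟨i, rfl⟩ := Nat.exists_eq_add_of_le hjn
      calc (b ^ (j + 1)) ^ 2 * h.real (markLevel d j) ≤ (b ^ (j + 1)) ^ 2 * h.real (markTail d j) := by
            gcongr
            · exact measure_ne_top _ _
            · exact markLevel_subset_markTail d j
        _ = _ := by
            rw [Nat.add_sub_cancel_left, pow_add b j i, inv_pow]
            field_simp
            ring
    have hvar' : ∫ ω, (∑ j ∈ Finset.Ico m n, b ^ (j + 1) *
          markCnt (Φ ω) (ρ ω) (cube d (L * 2 ^ n : ℕ)) (markLevel d j) -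
        (∑ j ∈ Finset.Ico m n, b ^ (j + 1) * h.real (markLevel d j)) *
          cnt (Φ ω) (cube d (L * 2 ^ n : ℕ))) ^ 2 ∂P ≤
        b ^ n * b ^ n * (C₁ * (∑ j ∈ Finset.range (n + 1),
          b ^ 2 * (b ^ j * h.real (markTail d j)) * (b⁻¹) ^ (n - j)) +
          c * G ^ 2 * (C₂ * L ^ d) * (b⁻¹) ^ n) := by
      refine hvar.trans ?_
      calc _ ≤ (b ^ n * ∑ j ∈ Finset.range (n + 1),
              b ^ 2 * (b ^ j * h.real (markTail d j)) * (b⁻¹) ^ (n - j)) * (C₁ * b ^ n) +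
            c * G ^ 2 * (C₂ * (L ^ d * b ^ n)) := by
            have hint0 : 0 ≤ ∫ ω, cellEnergy γ (Φ ω) (cube d (L * 2 ^ n : ℕ)) (L * 2 ^ n) ∂P :=
              integral_nonneg fun ω => cellEnergy_nonneg _ _ _ _
            gcongr
        _ = _ := by
            rw [inv_pow]
            field_simp
    have hS : MemLp (fun ω => ∑ j ∈ Finset.Ico m n, b ^ (j + 1) *
          markCnt (Φ ω) (ρ ω) (cube d (L * 2 ^ n : ℕ)) (markLevel d j) -
        (∑ j ∈ Finset.Ico m n, b ^ (j + 1) * h.real (markLevel d j)) *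
          cnt (Φ ω) (cube d (L * 2 ^ n : ℕ))) 2 P :=
      (memLp_finsetSum _ fun j _ => (hsm.memLp_markCnt hΦ hA hbd
        (measurableSet_markLevel d j)).const_mul _).sub ((hsm.memLp_cnt hΦ hA hbd).const_mul _)
    have hofReal := ofReal_integral_eq_lintegral_ofReal (hS.integrable_sq.const_mul (((b ^ n)⁻¹) ^ 2))
      (Eventually.of_forall fun ω => by positivity)
    simp_rw [mul_pow]
    refine hofReal.symm.le.trans (ENNReal.ofReal_le_ofReal ?_)
    rw [integral_const_mul]
    refine (mul_le_mul_of_nonneg_left hvar' (by positivity)).trans (le_of_eq ?_)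
    field_simp

/-- Eventually there are no extremely large marks in growing cubes. -/
theorem ae_eventually_notMem_markTail (hd : 0 < d) (hΦ : IsMarkedPointProcess Φ ρ)
    (hst : IsStationary P Φ) (hsm : HasFiniteSecondMoment P Φ) (hc : HasMarkCorrelations P Φ ρ h g)
    (hint : (∫⁻ s, ENNReal.ofReal (s ^ (d - 2)) ∂h) < ⊤) (L : ℕ) :
    ∀ᵐ ω ∂P, ∀ᶠ n : ℕ in atTop, ∀ z ∈ Φ ω ∩ cube d (L * 2 ^ n : ℕ), ρ ω z ∉ markTail d n := by
  set C₁ := meanCount P Φ (unitCube 0) * (2 * L) ^ d with hC₁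
  have hC₁0 : 0 ≤ C₁ := mul_nonneg (meanCount_nonneg _) (by positivity)
  have hbd : ∀ n : ℕ, Bornology.IsBounded (cube d (L * 2 ^ n : ℕ)) := fun n => isBounded_cube d _
  have hm : ∀ n : ℕ, Measurable fun ω => ENNReal.ofReal
      (markCnt (Φ ω) (ρ ω) (cube d (L * 2 ^ n : ℕ)) (markTail d n)) := fun n =>
    (hΦ.measurable_markCnt (measurableSet_cube d _) (measurableSet_markTail d n)).ennreal_ofReal
  -- The expected number of such marks at scale `n` is a constant times `b^n h(markTail d n)`, which
  -- is summable. The counts thus tend to zero almost surely and, being integers, eventually vanish.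
  have hfin : ∫⁻ ω, ∑' n : ℕ, ENNReal.ofReal
      (markCnt (Φ ω) (ρ ω) (cube d (L * 2 ^ n : ℕ)) (markTail d n)) ∂P ≠ ⊤ := by
    rw [lintegral_tsum fun n => (hm n).aemeasurable]
    have h1 : ∀ n : ℕ, ∫⁻ ω, ENNReal.ofReal
        (markCnt (Φ ω) (ρ ω) (cube d (L * 2 ^ n : ℕ)) (markTail d n)) ∂P =
        ENNReal.ofReal (C₁ * (((2 : ℝ) ^ d) ^ n * h.real (markTail d n))) := by
      intro n
      rw [hc.lintegral_markCnt hsm hΦ (measurableSet_cube d _) (hbd n) (measurableSet_markTail d n),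
        integral_cnt_cube hst hsm hΦ, ← hC₁]
      congr 1
      push_cast
      rw [← pow_mul 2 n d, ← pow_mul, mul_comm d n]
      ring
    simp_rw [h1]
    rw [← ENNReal.ofReal_tsum_of_nonneg (fun n => by positivity)
      ((summable_pow_mul_markTail hd hint).mul_left C₁)]
    exact ENNReal.ofReal_ne_top
  filter_upwards [ae_lt_top' (AEMeasurable.tsum fun n => (hm n).aemeasurable) hfin] with ω hω
  have h2 := ENNReal.tendsto_atTop_zero_of_tsum_ne_top hω.ne
  filter_upwards [h2.eventually_lt_const one_pos] with n hn z hz hzt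
  have hfinset : {z | z ∈ Φ ω ∩ cube d (L * 2 ^ n : ℕ) ∧ ρ ω z ∈ markTail d n}.Finite :=
    (hΦ.locallyFinite ω _ (hbd n)).subset fun _ hz => hz.1
  have h3 : 0 < {z | z ∈ Φ ω ∩ cube d (L * 2 ^ n : ℕ) ∧ ρ ω z ∈ markTail d n}.ncard :=
    (ncard_pos hfinset).2 ⟨z, hz, hzt⟩
  rw [← ENNReal.ofReal_one, ENNReal.ofReal_lt_ofReal_iff one_pos, markCnt] at hn
  have h4 : (1 : ℝ) ≤ {z | z ∈ Φ ω ∩ cube d (L * 2 ^ n : ℕ) ∧ ρ ω z ∈ markTail d n}.ncard := by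
    exact_mod_cast h3
  linarith

end MarkTails

/-! ### Tightness of the marks. -/

section TightMarks

variable {d : ℕ}

/-- Each mark lies in a unique level `j`, and its power is at most the upper end `b^(j+1)`. The
lower bound on the mark gives `j ≥ m` because `ρ ≤ ρ^(d-2)` for `ρ ≥ 1`; absence from the tail gives
`j < n`. -/
theorem sum_pow_le_sum_markCnt (hd : 2 < d) {S A : Set (Space d)} {ρ : Space d → ℝ}
    (hfin : (S ∩ A).Finite) {m n : ℕ} (T : Finset (Space d)) (hT : (T : Set (Space d)) ⊆ S ∩ A)
    (hm : ∀ z ∈ T, ((2 : ℝ) ^ d) ^ m < ρ z) (hn : ∀ z ∈ T, ρ z ∉ markTail d n) :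
    ∑ z ∈ T, ρ z ^ (d - 2) ≤
      ∑ j ∈ Finset.Ico m n, ((2 : ℝ) ^ d) ^ (j + 1) * markCnt S ρ A (markLevel d j) := by
  classical
  set b : ℝ := 2 ^ d with hb
  have hb2 : 2 ≤ b := two_le_two_pow (by omega)
  have h1 : ∀ z ∈ T, ρ z ^ (d - 2) ≤
      ∑ j ∈ Finset.Ico m n, (if ρ z ∈ markLevel d j then b ^ (j + 1) else 0) := by
    intro z hz
    have hbm : 1 ≤ b ^ m := one_le_pow₀ (by linarith)
    have hz1 : 1 ≤ ρ z := hbm.trans (hm z hz).le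
    have hz2 : b ^ m < ρ z ^ (d - 2) := (hm z hz).trans_le (le_self_pow₀ hz1 (by omega))
    obtain ⟨j, hj1, hj2⟩ := exists_nat_pow_near (hbm.trans hz2.le) (by linarith : 1 < b)
    have hjm : m ≤ j := Nat.lt_succ_iff.1
      ((pow_lt_pow_iff_right₀ (by linarith : 1 < b)).1 (hz2.trans hj2))
    have hjn : j < n := by
      by_contra! hcon
      exact hn z hz ⟨by linarith, (pow_le_pow_right₀ (by linarith) hcon).trans hj1⟩
    have hlev : ρ z ∈ markLevel d j := ⟨by linarith, hj1, hj2⟩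
    have hle := Finset.single_le_sum (f := fun j => if ρ z ∈ markLevel d j then b ^ (j + 1) else 0)
      (fun i _ => by split_ifs <;> positivity) (Finset.mem_Ico.2 ⟨hjm, hjn⟩)
    simp only [if_pos hlev] at hle
    exact hj2.le.trans hle
  refine (Finset.sum_le_sum h1).trans ?_
  rw [Finset.sum_comm]
  refine Finset.sum_le_sum fun j _ => ?_
  rw [← Finset.sum_filter, Finset.sum_const, nsmul_eq_mul, mul_comm]
  refine mul_le_mul_of_nonneg_left ?_ (by positivity)
  rw [markCnt, ← ncard_coe_finset]
  refine Nat.cast_le.2 (ncard_le_ncard (fun z hz => ?_) (hfin.subset fun _ hz => hz.1))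
  have hz' := Finset.mem_filter.1 hz
  exact ⟨hT hz'.1, hz'.2⟩

theorem sum_weights_le {h : Measure ℝ} [IsProbabilityMeasure h]
    (hs : Summable fun j => ((2 : ℝ) ^ d) ^ j * h.real (markTail d j)) (m n : ℕ) :
    ∑ j ∈ Finset.Ico m n, ((2 : ℝ) ^ d) ^ (j + 1) * h.real (markLevel d j) ≤
      2 ^ d * ∑' j, ((2 : ℝ) ^ d) ^ (j + m) * h.real (markTail d (j + m)) := by
  rw [Finset.sum_Ico_eq_sum_range]
  refine le_trans ?_ (mul_le_mul_of_nonneg_left (((summable_nat_add_iff m).2 hs).sum_le_tsum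
    (Finset.range (n - m)) fun j _ => by positivity) (by positivity))
  rw [Finset.mul_sum]
  refine Finset.sum_le_sum fun j _ => ?_
  rw [add_comm m j, pow_succ', mul_assoc]
  gcongr
  · exact measure_ne_top _ _
  · exact markLevel_subset_markTail d _

/-- The dyadic scale just above `1 / ε`. -/
theorem exists_two_pow_near_inv {ε : ℝ} (hε : 0 < ε) (hε1 : ε ≤ 1) :
    ∃ n : ℕ, 1 ≤ ε * 2 ^ n ∧ ε * 2 ^ n ≤ 2 := by
  obtain ⟨k, hk1, hk2⟩ := exists_nat_pow_near ((one_le_inv₀ hε).2 hε1) (one_lt_two (α := ℝ))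
  have h := mul_inv_cancel₀ hε.ne'
  refine ⟨k + 1, ?_, ?_⟩
  · nlinarith
  · rw [pow_succ]; nlinarith

/-- The sum of large marks is a fluctuation, which tends to zero, plus the level weight times the
point density. The density is bounded, and the weight is a tail of a convergent series, small for
large `m` uniformly in `n`. -/
theorem tightMarks_of_tendsto (hd : 2 < d) {S D : Set (Space d)} {ρ : Space d → ℝ} {L : ℕ}
    (hD : D ⊆ cube d L) (hfin : ∀ n : ℕ, (S ∩ cube d (L * 2 ^ n : ℕ)).Finite)
    {h : Measure ℝ} [IsProbabilityMeasure h]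
    (hs : Summable fun j => ((2 : ℝ) ^ d) ^ j * h.real (markTail d j)) {C : ℝ} (hC : 0 ≤ C)
    (hcnt : ∀ᶠ n : ℕ in atTop, (((2 : ℝ) ^ d) ^ n)⁻¹ * cnt S (cube d (L * 2 ^ n : ℕ)) ≤ C)
    (hsum : ∀ m : ℕ, Tendsto (fun n : ℕ => (((2 : ℝ) ^ d) ^ n)⁻¹ *
      (∑ j ∈ Finset.Ico m n, ((2 : ℝ) ^ d) ^ (j + 1) *
          markCnt S ρ (cube d (L * 2 ^ n : ℕ)) (markLevel d j) -
        (∑ j ∈ Finset.Ico m n, ((2 : ℝ) ^ d) ^ (j + 1) * h.real (markLevel d j)) *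
          cnt S (cube d (L * 2 ^ n : ℕ)))) atTop (𝓝 0))
    (htail : ∀ᶠ n : ℕ in atTop, ∀ z ∈ S ∩ cube d (L * 2 ^ n : ℕ), ρ z ∉ markTail d n) :
    TightMarks S ρ D := by
  intro κ hκ
  set b : ℝ := 2 ^ d with hb
  have hb0 : 0 < b := by positivity
  -- Half of the budget goes to the fluctuation and half to the mean; the factor `b` is lost in
  -- passing from `ε` to a dyadic scale with `ε 2^n ≤ 2`.
  set η : ℝ := κ / (2 * b) with hη
  have hη0 : 0 < η := by positivity
  obtain ⟨m, hm⟩ : ∃ m : ℕ, b * (∑' j, b ^ (j + m) * h.real (markTail d (j + m))) * C ≤ η := by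
    have h1 := ((tendsto_sum_nat_add fun j => b ^ j * h.real (markTail d j)).const_mul b).mul_const C
    rw [mul_zero, zero_mul] at h1
    exact (h1.eventually_le_const hη0).exists
  obtain ⟨N, hN⟩ := eventually_atTop.1
    (hcnt.and (((hsum m).eventually_le_const hη0).and htail))
  refine ⟨b ^ m, ?_⟩
  have hpos : (0 : ℝ) < (2 ^ N)⁻¹ := by positivity
  filter_upwards [self_mem_nhdsWithin, mem_nhdsWithin_of_mem_nhds (Iio_mem_nhds hpos)]
    with ε hε hεN T hT hTm
  have hε : 0 < ε := hε
  have hεN : ε < (2 ^ N)⁻¹ := hεN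
  have hεN' : ε * 2 ^ N < 1 := by
    rwa [← lt_inv_mul_iff₀' (by positivity), mul_one]
  have h2N : (1 : ℝ) ≤ 2 ^ N := one_le_pow₀ one_le_two
  obtain ⟨n, hn1, hn2⟩ := exists_two_pow_near_inv hε (by nlinarith)
  have hNn : N ≤ n := by
    by_contra! hcon
    have h1 : (2 : ℝ) ^ n ≤ 2 ^ N := pow_le_pow_right₀ one_le_two hcon.le
    nlinarith
  obtain ⟨h1, h2, h3⟩ := hN n hNn
  have hsub : dilate ε D ⊆ cube d (L * 2 ^ n : ℕ) := by
    refine dilate_subset_cube hD hε ?_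
    push_cast
    have := mul_le_mul_of_nonneg_left hn1 (Nat.cast_nonneg (α := ℝ) L)
    linarith
  have hTA : (T : Set (Space d)) ⊆ S ∩ cube d (L * 2 ^ n : ℕ) :=
    hT.trans (inter_subset_inter_right _ hsub)
  have h4 := sum_pow_le_sum_markCnt hd (hfin n) T hTA hTm fun z hz => h3 z (hTA hz)
  have h5 := sum_weights_le hs m n
  rw [← hb] at h4 h5
  have hεb : ε ^ d ≤ b * (b ^ n)⁻¹ := by
    rw [← div_eq_mul_inv, le_div_iff₀ (by positivity), hb, ← pow_mul, mul_comm d n, pow_mul,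
      ← mul_pow]
    exact pow_le_pow_left₀ (by positivity) hn2 d
  set s := ∑ j ∈ Finset.Ico m n, b ^ (j + 1) * markCnt S ρ (cube d (L * 2 ^ n : ℕ)) (markLevel d j)
  set w := ∑ j ∈ Finset.Ico m n, b ^ (j + 1) * h.real (markLevel d j)
  set N₀ := cnt S (cube d (L * 2 ^ n : ℕ))
  have hw0 : 0 ≤ w := Finset.sum_nonneg fun j _ => by positivity
  have hs0 : 0 ≤ s := Finset.sum_nonneg fun j _ => mul_nonneg (by positivity) (markCnt_nonneg _ _ _ _)
  have h6 : (b ^ n)⁻¹ * s ≤ 2 * η := by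
    have h7 : w * ((b ^ n)⁻¹ * N₀) ≤ η :=
      (mul_le_mul_of_nonneg_left h1 hw0).trans ((mul_le_mul_of_nonneg_right h5 hC).trans hm)
    have h8 : (b ^ n)⁻¹ * s = (b ^ n)⁻¹ * (s - w * N₀) + w * ((b ^ n)⁻¹ * N₀) := by ring
    rw [h8]
    linarith
  calc ε ^ d * ∑ z ∈ T, ρ z ^ (d - 2) ≤ ε ^ d * s := mul_le_mul_of_nonneg_left h4 (by positivity)
    _ ≤ b * (b ^ n)⁻¹ * s := mul_le_mul_of_nonneg_right hεb hs0
    _ = b * ((b ^ n)⁻¹ * s) := mul_assoc _ _ _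
    _ ≤ b * (2 * η) := mul_le_mul_of_nonneg_left h6 hb0.le
    _ = κ := by rw [hη]; field_simp

variable {Ω : Type*} [MeasurableSpace Ω] {P : Measure Ω} [IsProbabilityMeasure P]
  {Φ : Ω → Set (Space d)} {ρ : Ω → Space d → ℝ}

theorem ae_eventually_cnt_cube_le (hd : 1 < d) (hΦ : IsMarkedPointProcess Φ ρ)
    (hst : IsStationary P Φ) (hsm : HasFiniteSecondMoment P Φ) (hmix : IsStronglyMixing P Φ)
    (L : ℕ) : ∀ᵐ ω ∂P, ∀ᶠ n : ℕ in atTop,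
      (((2 : ℝ) ^ d) ^ n)⁻¹ * cnt (Φ ω) (cube d (L * 2 ^ n : ℕ)) ≤
        meanCount P Φ (unitCube 0) * (2 * L) ^ d + 1 := by
  filter_upwards [ae_tendsto_cnt_sub_integral hd hΦ hsm hmix (fun n => cube d (L * n : ℕ)) L
    (fun n => measurableSet_cube d _) fun n => subset_rfl] with ω hω
  have h1 := hω.comp (tendsto_pow_atTop_atTop_of_one_lt (one_lt_two (α := ℕ)))
  filter_upwards [h1.eventually_le_const one_pos] with n hn
  simp only [Function.comp_apply] at hn
  rw [integral_cnt_cube hst hsm hΦ] at hn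
  have h2 : (((2 ^ n : ℕ) : ℝ)) ^ d = ((2 : ℝ) ^ d) ^ n := by
    push_cast
    rw [← pow_mul, ← pow_mul, mul_comm]
  have h3 : (0 : ℝ) < ((2 : ℝ) ^ d) ^ n := by positivity
  have h4 : (((2 : ℝ) ^ d) ^ n)⁻¹ * (meanCount P Φ (unitCube 0) * (2 * L) ^ d * ((2 : ℝ) ^ d) ^ n) =
      meanCount P Φ (unitCube 0) * (2 * L) ^ d := by
    rw [mul_comm (meanCount P Φ (unitCube 0) * (2 * L) ^ d), inv_mul_cancel_left₀ h3.ne']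
  rw [h2, mul_sub, h4] at hn
  linarith

theorem ae_tightMarks (hd : 2 < d) {D : Set (Space d)} (hD : Bornology.IsBounded D)
    (hΦ : IsMarkedPointProcess Φ ρ) (hst : IsStationary P Φ) (hsm : HasFiniteSecondMoment P Φ)
    (hmix : IsStronglyMixing P Φ) (hmarks : HasShortRangeMarks P Φ ρ) :
    ∀ᵐ ω ∂P, TightMarks (Φ ω) (ρ ω) D := by
  obtain ⟨h, g, hprob, -, hint, -, ⟨c, p, γ, hp, hγ, hg⟩, hc⟩ := hmarks
  obtain ⟨L, -, hL⟩ := exists_subset_cube hD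
  filter_upwards [ae_eventually_cnt_cube_le (by omega) hΦ hst hsm hmix L,
    ae_tendsto_markSum_sub hd hΦ hst hsm hc hint hp hγ hg L,
    ae_eventually_notMem_markTail (by omega) hΦ hst hsm hc hint L] with ω h1 h2 h3
  exact tightMarks_of_tendsto hd hL (fun n => hΦ.locallyFinite ω _ (isBounded_cube d _))
    (summable_pow_mul_markTail (by omega) hint)
    (add_nonneg (mul_nonneg (meanCount_nonneg _) (by positivity)) zero_le_one) h1 h2 h3

end TightMarks

end PerforatedDomain

/-! ### Assembly of the theorem. -/

open PerforatedDomain in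
theorem lemma4p2 (d : ℕ) (hd : 2 < d) :
    ∃ ε₀ : ℝ, 0 < ε₀ ∧
    ∀ (Ω : Type*) [MeasurableSpace Ω] (P : Measure Ω) [IsProbabilityMeasure P]
      (Φ : Ω → Set (Space d)) (ρ : Ω → Space d → ℝ) (D : Set (Space d)),
      IsOpen D → Bornology.IsBounded D → StarConvex ℝ 0 D →
      IsMarkedPointProcess Φ ρ → IsStationary P Φ → HasFiniteSecondMoment P Φ →
      IsStronglyMixing P Φ → HasShortRangeMarks P Φ ρ →
      ∃ r : ℝ → Ω → ℝ,
        (∀ ε, 0 < ε → Measurable (r ε) ∧ ∀ ω, 0 < r ε ω) ∧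
        ∀ᵐ ω ∂P,
          Tendsto (fun ε => r ε ω) (𝓝[>] 0) (𝓝 0) ∧
          ∃ Hg Hb Db n : ℝ → Set (Space d),
            (∀ ε, 0 < ε → ε ≤ ε₀ →
              -- decomposition of the holes, safety layer, separation
              ballUnion ε (Φ ω ∩ dilate ε D) (ρ ω) = Hg ε ∪ Hb ε ∧
              IsOpen (Hb ε) ∧ IsOpen (Db ε) ∧ Hb ε ⊆ Db ε ∧
              (∀ x ∈ Hg ε, ∀ y ∈ Db ε, ε * r ε ω / 2 ≤ dist x y) ∧
              -- structure of the good holes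
              n ε ⊆ Φ ω ∩ dilate ε D ∧
              Hg ε = ballUnion ε (n ε) (ρ ω) ∧
              (n ε).PairwiseDisjoint
                (fun z => Metric.ball (ε • z) (scaledRadius d ε (ρ ω z))) ∧
              (∀ z ∈ n ε, ∀ w ∈ n ε, z ≠ w → 2 * r ε ω * ε ≤ ε * dist z w) ∧
              (∀ z ∈ n ε, scaledRadius d ε (ρ ω z) ≤ ε * r ε ω / 2)) ∧
            Tendsto (fun ε => capacity (Hb ε) (Db ε)) (𝓝[>] 0) (𝓝 0) ∧
            (∀ q : Space d, Tendsto (fun ε => ε ^ d * ((n ε).ncard : ℝ)) (𝓝[>] 0)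
              (𝓝 (meanCount P Φ (unitCube q) * volume.real D))) ∧
            -- few well-separated points are close to the safety layer
            (∀ δ : ℝ, 0 < δ →
              Tendsto (fun ε => ε ^ d *
                (({z | z ∈ thin (2 * δ) (Φ ω) ∩ dilate ε D ∧
                    Metric.infEDist (ε • z) (Db ε) ≤ ENNReal.ofReal (δ * ε)}.ncard : ℕ) : ℝ))
                (𝓝[>] 0) (𝓝 0)) := by
  have hd2 : (2 : ℝ) < d := by exact_mod_cast hd
  -- The construction works for every positive `ε`; the threshold `1` is arbitrary.
  refine ⟨1, one_pos, ?_⟩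
  intro Ω _ P _ Φ ρ D hDo hDb hDs hΦ hst hsm hmix hmarks
  have hr := isSlowScale_rpow hd
  refine ⟨fun ε _ => ε ^ (1 / ((d : ℝ) - 2)),
    fun ε hε => ⟨measurable_const, fun _ => Real.rpow_pos_of_pos hε _⟩, ?_⟩
  filter_upwards [ae_tendsto_ncard_dilate (by omega) hDo.measurableSet hDb hDs hΦ hst hsm hmix,
    ae_fewCrowdedCentres (by omega) hDb hΦ hst hsm hmix,
    ae_tightMarks hd hDb hΦ hst hsm hmix hmarks] with ω hN hC hM
  have hfin : ∀ ε, 0 < ε → (Φ ω ∩ dilate ε D).Finite := fun ε hε =>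
    hΦ.locallyFinite ω _ (isBounded_dilate hDb hε)
  have hρ := hΦ.mark_nonneg ω
  set r : ℝ → ℝ := fun ε => ε ^ (1 / ((d : ℝ) - 2))
  refine ⟨hr.tendsto, fun ε => ballUnion ε (goodCentres (Φ ω) (ρ ω) D (r ε) ε) (ρ ω),
    fun ε => ballUnion ε (badCentres (Φ ω) (ρ ω) D (r ε) ε) (ρ ω),
    fun ε => safetyLayer (Φ ω) (ρ ω) D (r ε) ε, fun ε => goodCentres (Φ ω) (ρ ω) D (r ε) ε,
    fun ε hε _ => ⟨?_, isOpen_ballUnion _, isOpen_safetyLayer, ballUnion_badCentres_subset hε hρ,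
      le_dist_safetyLayer hε, goodCentres_subset, rfl, pairwiseDisjoint_goodCentres hε (hr.pos ε hε),
      fun z hz w hw hzw => ?_, fun z hz => scaledRadius_le_of_mem_goodCentres hz⟩,
    tendsto_capacity_badCentres hd hfin hρ hC hM hr,
    fun q => tendsto_goodCentres_ncard hd hfin hρ hC hM hr (hN q),
    fun δ hδ => tendsto_ncard_near_safetyLayer hd hfin hρ hC hM hr hδ⟩
  · rw [← ballUnion_union, goodCentres_union_badCentres]
  · have h1 := mul_le_mul_of_nonneg_left
      (le_dist_of_mem_goodCentres hz (goodCentres_subset hw).1 hzw.symm) hε.le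
    linarith
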